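/- Let $\mathbf k$ be a field, $R=\mathbf k[x_1,\dots,x_n]$, $\mathfrak m=(x_1,\dots,x_n)$, and let $I=(f_0,\dots,f_n)\subset R$ be a perfect ideal of codimension $2$ generated by $n+1$ forms of the same degree, with a homogeneous presentation $R^n\xrightarrow{\varphi}R^{n+1}\xrightarrow{(f_0\cdots f_n)}I\to 0$ in which the entries of the $j$-th column of the $(n+1)\times n$ matrix $\varphi$ are homogeneous of degree $d_j$, $1\le d_1\le\dots\le d_n$. Assume that $\mu(I_p)\le\dim R_p$ for all primes $p\supseteq I$ with $p\ne\mathfrak m$, where $\mu$ is the minimal number of generators. Let $S=\mathbf k[T_0,\dots,T_n]$, $B=R\otimes_{\mathbf k}S$, bigraded by $\deg x_j=(1,0)$, $\deg T_i=(0,1)$; then $\operatorname{Sym}_R(I)$ is a bigraded quotient of $B$ via $T_i\mapsto f_i\in\operatorname{Sym}^1_R(I)$. Write $\operatorname{Sym}(I)_c=\bigoplus_j\operatorname{Sym}_R(I)_{(c,j)}$, $\mathcal A=H^0_{\mathfrak m}(\operatorname{Sym}_R(I))$, $\mathcal A_i=\bigoplus_j\mathcal A_{(i,j)}$, and $\delta=d_1+\dots+d_n-n$.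 Fix $0\le i\le\delta$. Let $[l_1\cdots l_n]=[T_0\cdots T_n]\,\varphi$. The part of $x$-degree $\delta-i$ of the Koszul complex of $l_1,\dots,l_n$ over $B$ is a linear graded free $S$-resolution $$0\to F_n\xrightarrow{\alpha_n}\cdots\to F_1\xrightarrow{\alpha_1}F_0$$ of $\operatorname{Sym}(I)_{\delta-i}$, where $F_t$ is a finite direct sum of copies of $S(-t)$ (possibly $F_t=0$). Put $f_t=\operatorname{rank}F_t$, $r_t=\operatorname{rank}\alpha_t$, $s_1=\sum_{p=1}^n(-1)^{p-1}r_p$, and let $(-)^*=\operatorname{Hom}_S(-,S)$. Fix orientations $\eta_t:\wedge^{f_t}F_t\cong S$; they identify $(\wedge^kF_t)^*$ with $\wedge^{f_t-k}F_t$. There are unique $S$-linear maps (Buchsbaum–Eisenbud multipliers) $a_t:S\to\wedge^{r_t}F_{t-1}$, $1\le t\le n$, with $a_n=\wedge^{r_n}\alpha_n$ (where $\wedge^{r_n}F_n\cong S$ by $\eta_n$) and $\wedge^{r_t}\alpha_t=a_t\circ a_{t+1}^*$ for $t<n$. Let $\eta=\eta_0$, let $m_\wedge$ be multiplication in $\wedge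 F_0$, and identify $\wedge^{f_0-1}F_0$ with $F_0^*$ by $\eta$. Then $a_1$ is a graded map $S(-s_1)\to\wedge^{r_1}F_0$, and the following hold. (1) The sequence $$\wedge^{f_0-r_1-1}F_0\otimes S(-s_1)\xrightarrow{\ \eta\circ m_\wedge\circ(\mathrm{id}\otimes a_1)\ }F_0^*\xrightarrow{\ \alpha_1^*\ }F_1^*$$ is a complex of graded free $S$-modules. So the image of the first map lies in $\ker\alpha_1^*$, and $\ker\alpha_1^*\cong\mathcal A_i(n)$ as graded $S$-modules. In particular, if $f_0=r_1+1$, the image of $a_1$, viewed in $F_0^*$, lies in $\ker\alpha_1^*$. (2) If $\operatorname{rank}_S\operatorname{Sym}(I)_{\delta-i}>1$, then $$\wedge^{f_0-r_1-1}F_1\otimes S(-s_1)\xrightarrow{\wedge^{f_0-r_1-1}\alpha_1\otimes\mathrm{id}}\wedge^{f_0-r_1-1}F_0\otimes S(-s_1)\xrightarrow{\eta\circ m_\wedge\circ(\mathrm{id}\otimes a_1)}F_0^*\xrightarrow{\alpha_1^*}F_1^*$$ is a complex of graded free $S$-modules. -/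

import Mathlib

open scoped BigOperators

noncomputable section

namespace BEMult

/-! ## The rings `R = k[x_1, …, x_n]`, `S = k[T_0, …, T_n]`, `B = R ⊗ S = S[x_1, …, x_n]` -/

/-- `R = k[x_1, …, x_n]`. -/
abbrev RingR (k : Type*) [Field k] (n : ℕ) : Type _ := MvPolynomial (Fin n) k

/-- `S = k[T_0, …, T_n]`. -/
abbrev RingS (k : Type*) [Field k] (n : ℕ) : Type _ := MvPolynomial (Fin (n + 1)) k

/-- `B = R ⊗_k S`, written as `S[x_1, …, x_n]`. The grading by `x`-degree is the usual grading of
this polynomial ring over `S`; the grading by `T`-degree is the one on the coefficients. -/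
abbrev RingB (k : Type*) [Field k] (n : ℕ) : Type _ := MvPolynomial (Fin n) (RingS k n)

/-- The homogeneous maximal ideal `𝔪 = (x_1, …, x_n)` of `R`. -/
def maxIdeal (k : Type*) [Field k] (n : ℕ) : Ideal (RingR k n) :=
  Ideal.span (Set.range MvPolynomial.X)

/-! ## Gradings and graded maps -/

/-- The degree `j` part of `S`, for an integer `j`. -/
def degS (k : Type*) [Field k] (n : ℕ) (j : ℤ) : Set (RingS k n) :=
  {p | ∀ m ∈ p.support, (m.degree : ℤ) = j}

/-- The degree `j` part of the graded free module `S(-t)^ι`. -/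
def degFree {k : Type*} [Field k] {n : ℕ} {ι : Type*} (t j : ℤ) : Set (ι → RingS k n) :=
  {v | ∀ i, v i ∈ degS k n (j - t)}

/-- The degree `j` part of the exterior power `⋀^p (S(-t)^ι)`: the sums of elements
`c • (e_{i_1} ∧ ⋯ ∧ e_{i_p})` where `c` is homogeneous of degree `j - p t`. -/
def degExt {k : Type*} [Field k] {n : ℕ} {ι : Type*} [DecidableEq ι] (p : ℕ) (t j : ℤ) :
    Set (⋀[RingS k n]^p (ι → RingS k n)) :=
  {x | x ∈ AddSubgroup.closure
    {y : ⋀[RingS k n]^p (ι → RingS k n) | ∃ c ∈ degS k n (j - p * t), ∃ i : Fin p → ι,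
      y = c • exteriorPower.ιMulti (RingS k n) p (fun q => Pi.single (i q) 1)}}

/-- The degree `j` part of the graded dual `M^* = Hom_S(M, S)` of a graded module `M` whose degree
`m` part is `gr m`: the functionals which raise degrees by `j`. -/
def degDual {k : Type*} [Field k] {n : ℕ} {M : Type*} [AddCommGroup M] [Module (RingS k n) M]
    (gr : ℤ → Set M) (j : ℤ) : Set (Module.Dual (RingS k n) M) :=
  {g | ∀ m, ∀ x ∈ gr m, g x ∈ degS k n (j + m)}

/-- The graded shift `M(s)`. -/
def shift {M : Type*} (gr : ℤ → Set M) (s : ℤ) : ℤ → Set M := fun j => gr (s + j)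

/-- A map of graded modules preserves degrees. -/
def IsGradedMap {M N : Type*} (grM : ℤ → Set M) (grN : ℤ → Set N) (g : M → N) : Prop :=
  ∀ j, ∀ x ∈ grM j, g x ∈ grN j

/-! ## The symmetric algebra of `I = (f_0, …, f_n)` -/

/-- The ideal `I = (f_0, …, f_n)` of `R`. -/
def idealI {k : Type*} [Field k] {n : ℕ} (f : Fin (n + 1) → RingR k n) : Ideal (RingR k n) :=
  Ideal.span (Set.range f)

/-- `Sym_R(I)`. -/
def SymI {k : Type*} [Field k] {n : ℕ} (f : Fin (n + 1) → RingR k n) : Type _ :=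
  SymmetricAlgebra (RingR k n) (idealI f)

instance {k : Type*} [Field k] {n : ℕ} (f : Fin (n + 1) → RingR k n) : CommRing (SymI f) :=
  inferInstanceAs (CommRing (SymmetricAlgebra (RingR k n) (idealI f)))

instance {k : Type*} [Field k] {n : ℕ} (f : Fin (n + 1) → RingR k n) :
    Algebra (RingR k n) (SymI f) :=
  inferInstanceAs (Algebra (RingR k n) (SymmetricAlgebra (RingR k n) (idealI f)))

/-- The generator `f_i` of `I`, as an element of degree one of `Sym_R(I)`. -/
def symGen {k : Type*} [Field k] {n : ℕ} (f : Fin (n + 1) → RingR k n) (i : Fin (n + 1)) :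
    SymI f :=
  SymmetricAlgebra.ι (RingR k n) (idealI f) ⟨f i, Ideal.subset_span ⟨i, rfl⟩⟩

/-- The ring homomorphism `S → Sym_R(I)`, `T_i ↦ f_i`. -/
def coordHom {k : Type*} [Field k] {n : ℕ} (f : Fin (n + 1) → RingR k n) :
    RingS k n →+* SymI f :=
  MvPolynomial.eval₂Hom ((algebraMap (RingR k n) (SymI f)).comp MvPolynomial.C) (symGen f)

/-- `Sym_R(I)` as an `S`-algebra. -/
instance {k : Type*} [Field k] {n : ℕ} (f : Fin (n + 1) → RingR k n) :
    Algebra (RingS k n) (SymI f) :=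
  (coordHom f).toAlgebra

/-- The presentation `B → Sym_R(I)`, `x_j ↦ x_j`, `T_i ↦ f_i`. -/
def presMap {k : Type*} [Field k] {n : ℕ} (f : Fin (n + 1) → RingR k n) :
    RingB k n →ₐ[RingS k n] SymI f :=
  MvPolynomial.aeval (fun j => algebraMap (RingR k n) (SymI f) (MvPolynomial.X j))

/-- The `S`-module `Sym(I)_i`, the part of `x`-degree `i` of `Sym_R(I)`. -/
def symPiece {k : Type*} [Field k] {n : ℕ} (f : Fin (n + 1) → RingR k n) (i : ℕ) :
    Submodule (RingS k n) (SymI f) :=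
  (MvPolynomial.homogeneousSubmodule (Fin n) (RingS k n) i).map (presMap f).toLinearMap

/-- The part of bidegree `(i, j)` of `Sym_R(I)`. -/
def degSym {k : Type*} [Field k] {n : ℕ} (f : Fin (n + 1) → RingR k n) (i : ℕ) (j : ℤ) :
    Set (SymI f) :=
  presMap f '' {b | b.IsHomogeneous i ∧ ∀ m, b.coeff m ∈ degS k n j}

/-- `𝒜 = H^0_𝔪(Sym_R(I))`: the elements of `Sym_R(I)` annihilated by a power of `𝔪`. -/
def locCoh {k : Type*} [Field k] {n : ℕ} (f : Fin (n + 1) → RingR k n) :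
    Submodule (RingS k n) (SymI f) where
  carrier := {x | ∃ N : ℕ, ∀ r ∈ maxIdeal k n ^ N, algebraMap (RingR k n) (SymI f) r * x = 0}
  zero_mem' := ⟨0, fun r _ => mul_zero _⟩
  add_mem' := by
    rintro x y ⟨N, hN⟩ ⟨M, hM⟩
    refine ⟨N + M, fun r hr => ?_⟩
    rw [mul_add, hN r (Ideal.pow_le_pow_right (Nat.le_add_right N M) hr),
      hM r (Ideal.pow_le_pow_right (Nat.le_add_left M N) hr), add_zero]
  smul_mem' := by
    rintro c x ⟨N, hN⟩
    refine ⟨N, fun r hr => ?_⟩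
    rw [mul_smul_comm, hN r hr, smul_zero]

/-- The `S`-module `𝒜_i`, the part of `x`-degree `i` of `𝒜`. -/
def locCohPiece {k : Type*} [Field k] {n : ℕ} (f : Fin (n + 1) → RingR k n) (i : ℕ) :
    Submodule (RingS k n) (SymI f) :=
  locCoh f ⊓ symPiece f i

/-! ## The strands of the Koszul complex of `l_1, …, l_n` over `B` -/

/-- The forms `[l_1 ⋯ l_n] = [T_0 ⋯ T_n] φ` of `B`. -/
def koszulForm {k : Type*} [Field k] {n : ℕ} (φ : Matrix (Fin (n + 1)) (Fin n) (RingR k n))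
    (j : Fin n) : RingB k n :=
  ∑ i, MvPolynomial.C (MvPolynomial.X i) * MvPolynomial.map MvPolynomial.C (φ i j)

/-- The index set of the `S`-basis `x^μ e_J` of the part of `x`-degree `c` of the `t`-th module
`⋀^t (⊕_j B(-d_j, -1))` of the Koszul complex: `J ⊆ {1, …, n}` has `t` elements and
`|μ| + ∑_{j ∈ J} d_j = c`. -/
def StrandIdx {n : ℕ} (d : Fin n → ℕ) (c t : ℕ) : Type :=
  {p : Finset (Fin n) × (Fin n →₀ ℕ) // p.1.card = t ∧ p.2.degree + ∑ j ∈ p.1, d j = c}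

instance {n : ℕ} (d : Fin n → ℕ) (c t : ℕ) : DecidableEq (StrandIdx d c t) :=
  Classical.decEq _

instance {n : ℕ} (d : Fin n → ℕ) (c t : ℕ) : Finite (StrandIdx d c t) := by
  refine Set.Finite.to_subtype (Set.Finite.subset
    ((Set.finite_univ (α := Finset (Fin n))).prod (Finsupp.finite_of_degree_le (σ := Fin n) c)) ?_)
  rintro ⟨J, μ⟩ ⟨_, h⟩
  refine ⟨Set.mem_univ _, ?_⟩
  change μ.degree ≤ c
  have h' : μ.degree + ∑ j ∈ J, d j = c := h
  omega

instance {n : ℕ} (d : Fin n → ℕ) (c t : ℕ) : Fintype (StrandIdx d c t) :=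
  Fintype.ofFinite _

/-- The free `S`-module `F_t` in the strand of `x`-degree `c`; as a graded module it is
a direct sum of copies of `S(-t)`, so that its grading is `degFree t`. -/
abbrev StrandMod (k : Type*) [Field k] {n : ℕ} (d : Fin n → ℕ) (c t : ℕ) : Type _ :=
  StrandIdx d c t → RingS k n

/-- The matrix of the differential `F_{t+1} → F_t`, that is of
`x^μ e_J ↦ ∑_{j ∈ J} (-1)^{#{i ∈ J | i < j}} l_j x^μ e_{J \ j}`. -/
def strandMatrix {k : Type*} [Field k] {n : ℕ} (φ : Matrix (Fin (n + 1)) (Fin n) (RingR k n))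
    (d : Fin n → ℕ) (c t : ℕ) :
    Matrix (StrandIdx d c t) (StrandIdx d c (t + 1)) (RingS k n) :=
  fun q p => ∑ j ∈ p.1.1,
    if q.1.1 = p.1.1.erase j then
      (-1) ^ (p.1.1.filter (· < j)).card *
        (koszulForm φ j * MvPolynomial.monomial p.1.2 1).coeff q.1.2
    else 0

/-- The differential `α_{t+1} : F_{t+1} → F_t`. -/
def strandDiff {k : Type*} [Field k] {n : ℕ} (φ : Matrix (Fin (n + 1)) (Fin n) (RingR k n))
    (d : Fin n → ℕ) (c t : ℕ) :
    StrandMod k d c (t + 1) →ₗ[RingS k n] StrandMod k d c t :=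
  (strandMatrix φ d c t).mulVecLin

/-- The augmentation `F_0 → Sym_R(I)`, `x^μ ↦ x^μ`. -/
def strandAug {k : Type*} [Field k] {n : ℕ} (f : Fin (n + 1) → RingR k n)
    (d : Fin n → ℕ) (c : ℕ) : StrandMod k d c 0 →ₗ[RingS k n] SymI f :=
  Fintype.linearCombination (RingS k n) (fun p => presMap f (MvPolynomial.monomial p.1.2 1))

/-! ## Orientations and Buchsbaum–Eisenbud multipliers -/

/-- An orientation of a finite free module `F` of rank `f`: an isomorphism `⋀^f F ≅ S`. -/
abbrev TopOrientation (S : Type*) [CommRing S] (F : Type*) [AddCommGroup F] [Module S F] : Type _ :=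
  ⋀[S]^(Module.finrank S F) F ≃ₗ[S] S

/-- The orientation `η`, applied to the component in top degree of an element of `⋀ F`. -/
def topForm {S : Type*} [CommRing S] {F : Type*} [AddCommGroup F] [Module S F]
    (η : TopOrientation S F) : ExteriorAlgebra S F →ₗ[S] S where
  toFun x := η (DirectSum.decompose (fun i : ℕ => ⋀[S]^i F) x (Module.finrank S F))
  map_add' x y := by rw [DirectSum.decompose_add, DirectSum.add_apply, map_add]
  map_smul' c x := by
    rw [DirectSum.decompose_smul, DirectSum.smul_apply, map_smul, RingHom.id_apply]

/-- The identification `⋀^{f-1} F ≅ F^*` given by an orientation `η` of `F`: the element `y`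
corresponds to the functional `v ↦ η(v ∧ y)`. -/
def toDual {S : Type*} [CommRing S] {F : Type*} [AddCommGroup F] [Module S F]
    (η : TopOrientation S F) : ExteriorAlgebra S F →ₗ[S] Module.Dual S F :=
  (((LinearMap.mul S (ExteriorAlgebra S F)).compr₂ (topForm η)).comp (ExteriorAlgebra.ι S)).flip

/-- The map `η ∘ m_∧ ∘ (id ⊗ a) : ⋀^p F ⊗ S → F^*` built from an element `a` of `⋀^r F`
(a map `a : S → ⋀^r F`): it sends `ω` to the functional `v ↦ η(v ∧ ω ∧ a)`. Here `M ⊗_S S`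
is identified with `M`. -/
def multMap {S : Type*} [CommRing S] {F : Type*} [AddCommGroup F] [Module S F]
    (η : TopOrientation S F) {r : ℕ} (a : ⋀[S]^r F) (p : ℕ) : ⋀[S]^p F →ₗ[S] Module.Dual S F :=
  toDual η ∘ₗ LinearMap.mulRight S (a : ExteriorAlgebra S F) ∘ₗ (⋀[S]^p F).subtype

/-- The rank of a linear map. -/
abbrev rk {S : Type*} [CommRing S] {M N : Type*} [AddCommGroup M] [Module S M]
    [AddCommGroup N] [Module S N] (α : M →ₗ[S] N) : ℕ :=
  Module.finrank S (LinearMap.range α)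

/-- The Buchsbaum–Eisenbud multipliers of a complex `0 → F_n → ⋯ → F_1 → F_0` of oriented finite
free modules. Here `α t` is the differential `α_{t+1} : F_{t+1} → F_t`, of rank `r_{t+1}`, and
`a t` is the multiplier `a_{t+1} : S → ⋀^{r_{t+1}} F_t`, given by the image of `1`. -/
structure IsMultiplierSystem {S : Type*} [CommRing S] (n : ℕ) {F : ℕ → Type*}
    [∀ t, AddCommGroup (F t)] [∀ t, Module S (F t)] (α : ∀ t, F (t + 1) →ₗ[S] F t)
    (η : ∀ t, TopOrientation S (F t)) (a : ∀ t : Fin n, ⋀[S]^(rk (α t)) (F t)) : Prop where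
  /-- `a_n = ⋀^{r_n} α_n`, where `⋀^{r_n} F_n = S` by the orientation. -/
  last : ∀ (t : ℕ) (h : t + 1 = n) (x : ⋀[S]^(rk (α t)) (F (t + 1))),
    exteriorPower.map (rk (α t)) (α t) x = topForm (η (t + 1)) x • a ⟨t, by omega⟩
  /-- `⋀^{r_t} α_t = a_t ∘ a_{t+1}^*` for `t < n`, where `a_{t+1}^* : ⋀^{r_t} F_t → S` is the dual
  of `a_{t+1}` under the identification `⋀^{r_t} F_t = (⋀^{r_{t+1}} F_t)^*` by the orientation. -/
  step : ∀ (t : ℕ) (h : t + 1 < n) (x : ⋀[S]^(rk (α t)) (F (t + 1))),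
    exteriorPower.map (rk (α t)) (α t) x =
      topForm (η (t + 1)) ((a ⟨t + 1, h⟩ : ExteriorAlgebra S (F (t + 1))) * x) •
        a ⟨t, by omega⟩

/-! ## The objects attached to a strand -/

/-- The rank `r_{t+1}` of `α_{t+1} : F_{t+1} → F_t`. -/
abbrev strandRk {k : Type*} [Field k] {n : ℕ} (φ : Matrix (Fin (n + 1)) (Fin n) (RingR k n))
    (d : Fin n → ℕ) (c t : ℕ) : ℕ :=
  rk (strandDiff φ d c t)

/-- The rank `f_0` of `F_0`. -/
abbrev strandF0 (k : Type*) [Field k] {n : ℕ} (d : Fin n → ℕ) (c : ℕ) : ℕ :=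
  Module.finrank (RingS k n) (StrandMod k d c 0)

/-- The exponent `f_0 - r_1 - 1`. -/
abbrev strandExp {k : Type*} [Field k] {n : ℕ} (φ : Matrix (Fin (n + 1)) (Fin n) (RingR k n))
    (d : Fin n → ℕ) (c : ℕ) : ℕ :=
  strandF0 k d c - strandRk φ d c 0 - 1

/-- The shift `s_1 = r_1 - r_2 + ⋯ + (-1)^{n-1} r_n`. -/
def strandShift {k : Type*} [Field k] {n : ℕ} (φ : Matrix (Fin (n + 1)) (Fin n) (RingR k n))
    (d : Fin n → ℕ) (c : ℕ) : ℤ :=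
  ∑ t ∈ Finset.range n, (-1) ^ t * (strandRk φ d c t : ℤ)

/-- The dual `α_1^* : F_0^* → F_1^*` of the first differential. -/
abbrev strandDual {k : Type*} [Field k] {n : ℕ} (φ : Matrix (Fin (n + 1)) (Fin n) (RingR k n))
    (d : Fin n → ℕ) (c : ℕ) :
    Module.Dual (RingS k n) (StrandMod k d c 0) →ₗ[RingS k n]
      Module.Dual (RingS k n) (StrandMod k d c 1) :=
  (strandDiff φ d c 0).dualMap

/-- The strand `0 → F_n → ⋯ → F_1 → F_0`, with `F_t` a sum of copies of `S(-t)`, is a (linear)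
graded free resolution of `Sym(I)_c`. -/
structure IsStrandResolution {k : Type*} [Field k] {n : ℕ} (f : Fin (n + 1) → RingR k n)
    (φ : Matrix (Fin (n + 1)) (Fin n) (RingR k n)) (d : Fin n → ℕ) (c : ℕ) : Prop where
  diff_graded : ∀ t : ℕ, IsGradedMap (degFree ((t + 1 : ℕ) : ℤ)) (degFree (t : ℤ))
    (strandDiff φ d c t)
  aug_graded : IsGradedMap (degFree 0) (degSym f c) (strandAug f d c)
  aug_range : LinearMap.range (strandAug f d c) = symPiece f c
  aug_exact : LinearMap.ker (strandAug f d c) = LinearMap.range (strandDiff φ d c 0)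
  exact : ∀ t : ℕ, LinearMap.ker (strandDiff φ d c t) = LinearMap.range (strandDiff φ d c (t + 1))

end BEMult

end

/-! There are three ingredients: acyclicity of the Koszul complex of l_1, …, l_n over B, a duality
between its strands and 𝒜, and a divisibility argument producing the multipliers.

Acyclicity. Let Q be a prime of B = R[T] containing all l_j and let p be its contraction to R. Then
ht Q ≥ ht p + rank(φ mod p) (`height_add_rank_le`), while the presentation of I_p gives rank(φ mod
p) ≥ n + 1 - μ(I_p) (`le_rank_add_ncard`). The hypothesis on μ makes the sum at least n, so (l_1, …,
l_n) has height at least n. In the localization of B at the ideal of all variables, the l_j extend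
to a system of parameters, whose ideal contains powers of the variables. These powers form a regular
sequence of full length, so the Koszul complex of the extended system is acyclic, and Nakayama's
lemma passes acyclicity to the subsystem (`koszulExact_of_local`). Since the l_j are bihomogeneous,
taking components clears the denominators (`koszulExact_koszulForm`). As Sym(I) = B/(l), the strands
resolve the modules Sym(I)_c.

Duality. Choose N so large that each x_j^N kills 𝒜_i. In the double complex built from the Koszul
complexes of l and of x_1^N, …, x_n^N, both acyclic in positive degrees, a diagram chase matches the
elements of B/(l) killed by all x_j^N with the elements of B/(x^N) killed by all l_j. The
correspondence is recorded by whole families, the zigzags (`exists_zigzag`, `zigzag_end_mem`).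
Multiplication followed by the coefficient of the socle monomial (x_1⋯x_n)^{N-1} makes the x-degree
n(N-1) - c part of B/(x^N) the S-dual of F_0, and being killed by the l_j becomes membership in the
kernel of α_1^*. The n forms l_j, each of T-degree one, account for the shift by n.

Multipliers. They are built downwards from 1 ∈ ⋀^0 F_n. Given a_{t+1}, the maps ⋀^{r_t} α_t and
η(a_{t+1} ∧ ·) both factor through the rank r_t image of α_t, hence are proportional. The values of
the second have no common prime factor, because the image of α_{t+1} is a kernel and therefore
saturated; in the UFD S the proportionality factor is then an element a_t of ⋀^{r_t} F_{t-1}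
(`exists_multiplier`, `multiplier_primitive`). A nonzero multiple of a_1 is a wedge of r_1 vectors
in the image of α_1, so a_1 ∧ α_1(x) = 0. This one identity gives the vanishing of the composites in
both (1) and (2). -/

open scoped BigOperators

noncomputable section

namespace BEMult

/-! ### Koszul complexes and their exactness over regular sequences -/

section Koszul

variable {ι A M N : Type*} [LinearOrder ι] [CommRing A] [AddCommGroup M] [Module A M]
  [AddCommGroup N] [Module A N]

/-- The sign of `j` relative to `J` in the Koszul differential. -/
def ksign (A : Type*) [CommRing A] (j : ι) (J : Finset ι) : A := (-1) ^ (J.filter (· < j)).card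

lemma ksign_mul_self (j : ι) (J : Finset ι) : ksign A j J * ksign A j J = 1 := by
  rw [ksign, ← mul_pow]; simp

lemma ksign_erase (j : ι) (J : Finset ι) : ksign A j (J.erase j) = ksign A j J := by
  rw [ksign, ksign]
  congr 2
  ext i
  simp only [Finset.mem_filter, Finset.mem_erase]
  constructor
  · rintro ⟨⟨-, h⟩, h'⟩; exact ⟨h, h'⟩
  · rintro ⟨h, h'⟩; exact ⟨⟨ne_of_lt h', h⟩, h'⟩

lemma ksign_insert (j : ι) (J : Finset ι) : ksign A j (insert j J) = ksign A j J := by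
  rw [← ksign_erase (A := A) j (insert j J), ← ksign_erase (A := A) j J]
  congr 1
  ext i; simp [Finset.mem_erase]

lemma ksign_insert_of_lt {i j : ι} (h : j < i) (J : Finset ι) :
    ksign A j (insert i J) = ksign A j J := by
  rw [ksign, ksign, Finset.filter_insert, if_neg (not_lt.mpr h.le)]

lemma ksign_insert_of_gt {i j : ι} (h : i < j) {J : Finset ι} (hi : i ∉ J) :
    ksign A j (insert i J) = - ksign A j J := by
  rw [ksign, ksign, Finset.filter_insert, if_pos h, Finset.card_insert_of_notMem (by simp [hi]),
    pow_succ]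
  ring

lemma ksign_swap {i j : ι} (h : i ≠ j) {J : Finset ι} (hi : i ∉ J) (hj : j ∉ J) :
    ksign A i J * ksign A j (insert i J) = - (ksign A j J * ksign A i (insert j J)) := by
  rcases lt_or_gt_of_ne h with h | h
  · rw [ksign_insert_of_gt h hi, ksign_insert_of_lt h]; ring
  · rw [ksign_insert_of_lt h, ksign_insert_of_gt h hj]; ring

/-- Contraction with the `j`-th coordinate. -/
def kcontr (j : ι) : (Finset ι → M) →ₗ[A] (Finset ι → M) where
  toFun z J := if j ∈ J then 0 else ksign A j J • z (insert j J)
  map_add' x y := by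
    ext J; simp only [Pi.add_apply]; split_ifs <;> simp
  map_smul' c x := by
    ext J; simp only [Pi.smul_apply, RingHom.id_apply]
    split_ifs <;> simp [smul_comm c]

/-- Exterior multiplication by the `j`-th basis vector. -/
def kmult (j : ι) : (Finset ι → M) →ₗ[A] (Finset ι → M) where
  toFun z J := if j ∈ J then ksign A j J • z (J.erase j) else 0
  map_add' x y := by
    ext J; simp only [Pi.add_apply]; split_ifs <;> simp
  map_smul' c x := by
    ext J; simp only [Pi.smul_apply, RingHom.id_apply]
    split_ifs <;> simp [smul_comm c]

lemma kmult_apply (j : ι) (z : Finset ι → M) (J : Finset ι) :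
    kmult (A := A) j z J = if j ∈ J then ksign A j J • z (J.erase j) else 0 := rfl

lemma kcontr_apply (j : ι) (z : Finset ι → M) (J : Finset ι) :
    kcontr (A := A) j z J = if j ∈ J then 0 else ksign A j J • z (insert j J) := rfl

lemma kcontr_self (j : ι) (z : Finset ι → M) : kcontr (A := A) j (kcontr (A := A) j z) = 0 := by
  ext J
  simp [kcontr_apply]

lemma kcontr_anticomm (i j : ι) (z : Finset ι → M) :
    kcontr (A := A) i (kcontr (A := A) j z) = - kcontr (A := A) j (kcontr (A := A) i z) := by
  rcases eq_or_ne i j with rfl | h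
  · simp [kcontr_self]
  ext J
  simp only [kcontr_apply, Pi.neg_apply, Finset.mem_insert, h, h.symm, false_or]
  by_cases hi : i ∈ J
  · simp [hi]
  by_cases hj : j ∈ J
  · simp [hj]
  simp only [hi, hj, if_false, smul_smul]
  rw [ksign_swap h hi hj, Finset.insert_comm, neg_smul]

/-- With `kcontr_kmult` this is the pair of canonical anticommutation relations between contraction
and exterior multiplication, from which the homotopy formula follows. -/
lemma kcontr_kmult_self (j : ι) (z : Finset ι → M) :
    kcontr (A := A) j (kmult (A := A) j z) + kmult (A := A) j (kcontr (A := A) j z) = z := by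
  ext J
  simp only [kcontr_apply, kmult_apply, Pi.add_apply]
  by_cases hj : j ∈ J
  · simp [hj, smul_smul, ksign_erase, ksign_mul_self]
  · simp [hj, smul_smul, ksign_insert, ksign_mul_self]

lemma kcontr_kmult {i j : ι} (h : i ≠ j) (z : Finset ι → M) :
    kcontr (A := A) j (kmult (A := A) i z) = - kmult (A := A) i (kcontr (A := A) j z) := by
  ext J
  simp only [kcontr_apply, kmult_apply, Pi.neg_apply, Finset.mem_insert, h, false_or,
    Finset.mem_erase, h.symm, ne_eq, not_false_iff, true_and]
  by_cases hj : j ∈ J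
  · simp [hj]
  by_cases hi : i ∈ J
  · simp only [hi, hj, if_true, if_false, smul_smul]
    obtain ⟨J, hi', rfl⟩ : ∃ J', i ∉ J' ∧ J = insert i J' :=
      ⟨J.erase i, by simp, (Finset.insert_erase hi).symm⟩
    have hj' : j ∉ J := fun hh => hj (by simp [hh])
    have e1 : (insert j (insert i J)).erase i = insert j J := by
      rw [Finset.insert_comm, Finset.erase_insert]; simp [hi', h]
    rw [e1, Finset.erase_insert hi', ← neg_smul]
    congr 1
    rw [Finset.insert_comm, ksign_insert, ksign_insert]
    have h1 := ksign_swap (A := A) h hi' hj'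
    have h2 := ksign_mul_self (A := A) i J
    have h3 := ksign_mul_self (A := A) j J
    calc _ = (ksign A i J * ksign A i J) * (ksign A j (insert i J) * ksign A i (insert j J)) := by
          rw [h2, one_mul]
      _ = ksign A i J * (ksign A i J * ksign A j (insert i J)) * ksign A i (insert j J) := by ring
      _ = - (ksign A i J * ksign A j J) *
          (ksign A i (insert j J) * ksign A i (insert j J)) := by rw [h1]; ring
      _ = _ := by rw [ksign_mul_self]; ring
  · simp [hi]

variable [Fintype ι]

/-- The differential of the Koszul complex of `a` with coefficients in `M`, on all degrees at once:
the component of degree `t` consists of the functions supported on the subsets with `t` elements. -/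
def koszulD (a : ι → A) : (Finset ι → M) →ₗ[A] (Finset ι → M) := ∑ j, a j • kcontr j

/-- The homotopy given by exterior multiplication by `∑ c_j e_j`. -/
def koszulH (c : ι → A) : (Finset ι → M) →ₗ[A] (Finset ι → M) := ∑ j, c j • kmult j

lemma koszulD_apply (a : ι → A) (z : Finset ι → M) (J : Finset ι) :
    koszulD a z J = ∑ j, if j ∈ J then 0 else (a j * ksign A j J) • z (insert j J) := by
  simp only [koszulD, LinearMap.sum_apply, LinearMap.smul_apply, Finset.sum_apply, Pi.smul_apply,
    kcontr_apply, smul_ite, smul_zero, smul_smul]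

lemma koszulD_koszulD (a : ι → A) (z : Finset ι → M) : koszulD a (koszulD a z) = 0 := by
  simp only [koszulD, LinearMap.sum_apply, LinearMap.smul_apply, map_sum, map_smul, smul_smul,
    Finset.smul_sum]
  rw [← Finset.sum_product']
  refine Finset.sum_involution (fun p _ => (p.2, p.1)) ?_ ?_ (by simp) (by simp)
  · rintro ⟨i, j⟩ -
    dsimp only
    rw [kcontr_anticomm i j, smul_neg, mul_comm, add_neg_cancel]
  · rintro ⟨i, j⟩ - h h'
    obtain rfl : j = i := congrArg Prod.fst h'
    exact h (by simp [kcontr_self])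

/-- The homotopy formula: every element of the ideal (a_j) acts null-homotopically on the Koszul
complex. -/
lemma koszulD_koszulH (a c : ι → A) (z : Finset ι → M) :
    koszulD a (koszulH c z) + koszulH c (koszulD a z) = (∑ j, c j * a j) • z := by
  simp only [koszulD, koszulH, LinearMap.sum_apply, LinearMap.smul_apply, map_sum, map_smul,
    smul_smul, Finset.smul_sum, Finset.sum_smul]
  rw [Finset.sum_comm, ← Finset.sum_add_distrib]
  refine Finset.sum_congr rfl fun i _ => ?_
  rw [← Finset.sum_add_distrib, Finset.sum_eq_single i]
  · rw [mul_comm (a i), ← smul_add, kcontr_kmult_self]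
  · intro j _ h
    rw [kcontr_kmult h, smul_neg, mul_comm, neg_add_cancel]
  · simp

lemma koszulD_comp (a : ι → A) (g : M →ₗ[A] N) (z : Finset ι → M) :
    koszulD a (fun J => g (z J)) = fun J => g (koszulD a z J) := by
  ext J
  simp only [koszulD_apply, map_sum]
  refine Finset.sum_congr rfl fun j _ => ?_
  split_ifs <;> simp

lemma koszulD_eq_zero_of_card {a : ι → A} {z : Finset ι → M} {t : ℕ}
    (hz : ∀ J, J.card ≠ t + 1 → z J = 0) (J : Finset ι) (hJ : J.card ≠ t) : koszulD a z J = 0 := by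
  rw [koszulD_apply]
  refine Finset.sum_eq_zero fun j _ => ?_
  split_ifs with h
  · rfl
  · rw [hz, smul_zero]
    rw [Finset.card_insert_of_notMem h]; omega

lemma koszulH_eq_zero_of_card {c : ι → A} {z : Finset ι → M} {t : ℕ}
    (hz : ∀ J, J.card ≠ t → z J = 0) (J : Finset ι) (hJ : J.card ≠ t + 1) : koszulH c z J = 0 := by
  simp only [koszulH, LinearMap.sum_apply, LinearMap.smul_apply, Finset.sum_apply, Pi.smul_apply,
    kmult_apply]
  refine Finset.sum_eq_zero fun j _ => ?_
  split_ifs with h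
  · rw [hz, smul_zero, smul_zero]
    rw [Finset.card_erase_of_mem h]
    have := Finset.card_pos.mpr ⟨j, h⟩
    omega
  · simp

/-- The component of degree `t`. -/
def kpart (t : ℕ) (z : Finset ι → M) : Finset ι → M := fun J => if J.card = t then z J else 0

lemma koszulD_kpart (a : ι → A) (t : ℕ) (z : Finset ι → M) :
    koszulD a (kpart (t + 1) z) = kpart t (koszulD a z) := by
  ext J
  simp only [kpart]
  split_ifs with h
  · rw [koszulD_apply, koszulD_apply]
    refine Finset.sum_congr rfl fun j _ => ?_
    split_ifs with h1
    · rfl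
    · rw [kpart, if_pos (by rw [Finset.card_insert_of_notMem h1, h])]
  · exact koszulD_eq_zero_of_card (fun J hJ => if_neg hJ) J h

/-- The Koszul complex of `a` with coefficients in `M` is exact in degree `t`. -/
def KoszulExact (a : ι → A) (M : Type*) [AddCommGroup M] [Module A M] (t : ℕ) : Prop :=
  ∀ z : Finset ι → M, (∀ J, J.card ≠ t → z J = 0) → koszulD a z = 0 →
    ∃ w : Finset ι → M, (∀ J, J.card ≠ t + 1 → w J = 0) ∧ koszulD a w = z

/-- The support condition on a preimage costs nothing: its component of degree t + 1 is again a
preimage. -/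
lemma KoszulExact.of_exists {a : ι → A} {t : ℕ}
    (h : ∀ z : Finset ι → M, (∀ J, J.card ≠ t → z J = 0) → koszulD a z = 0 →
      ∃ w : Finset ι → M, koszulD a w = z) : KoszulExact a M t := by
  intro z hz h0
  obtain ⟨w, rfl⟩ := h z hz h0
  refine ⟨kpart (t + 1) w, fun J hJ => if_neg hJ, ?_⟩
  rw [koszulD_kpart]
  ext J
  by_cases hJ : J.card = t
  · exact if_pos hJ
  · rw [hz J hJ]; exact if_neg hJ

/-- Depth sensitivity, by induction on the regular sequence. For a cycle z and b = ∑ c_j a_j, the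
homotopy formula gives D(Hz) = bz, so Hz is a cycle of degree t + 1 modulo b; exactness over M/bM
and cancellation of b then exhibit z as a boundary. For the empty sequence the degree exceeds the
number of elements and z = 0. -/
lemma koszulExact_of_isWeaklyRegular (a : ι → A) (bs : List A)
    (hb : ∀ b ∈ bs, b ∈ Ideal.span (Set.range a)) :
    ∀ (M : Type _) [AddCommGroup M] [Module A M],
      RingTheory.Sequence.IsWeaklyRegular M bs → ∀ t, Fintype.card ι < t + bs.length →
        KoszulExact a M t := by
  induction bs with
  | nil =>
    intro M _ _ _ t ht z hz _
    refine ⟨0, fun _ _ => rfl, ?_⟩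
    rw [map_zero]
    ext J
    rw [hz J]
    · rfl
    · have := Finset.card_le_univ J
      simp at ht; omega
  | cons b bs ih =>
    intro M _ _ hreg t ht
    rw [RingTheory.Sequence.isWeaklyRegular_cons_iff] at hreg
    refine KoszulExact.of_exists fun z hz h0 => ?_
    obtain ⟨c, hc⟩ := (Ideal.mem_span_range_iff_exists_fun).mp (hb b (by simp))
    have hbz : koszulD a (koszulH c z) = b • z := by
      have := koszulD_koszulH a c z
      rwa [h0, map_zero, add_zero, hc] at this
    let π : M →ₗ[A] QuotSMulTop b M := Submodule.mkQ _
    have hker : ∀ x, π x = 0 → ∃ y, x = b • y := by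
      intro x hx
      have := (Submodule.Quotient.mk_eq_zero _).mp hx
      obtain ⟨y, -, hy⟩ := (Submodule.mem_smul_pointwise_iff_exists _ _ _).mp this
      exact ⟨y, hy.symm⟩
    have hπb : ∀ x, π (b • x) = 0 := fun x =>
      (Submodule.Quotient.mk_eq_zero _).mpr (Submodule.smul_mem_pointwise_smul _ _ _ trivial)
    -- The degree rises by one while the sequence loses one element, so the numerical condition
    -- persists.
    obtain ⟨w, -, hw⟩ := ih (fun b hb' => hb b (by simp [hb'])) (QuotSMulTop b M) hreg.2 (t + 1)
      (by simp at ht; omega) (fun J => π (koszulH c z J))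
      (fun J hJ => by rw [koszulH_eq_zero_of_card hz J hJ, map_zero])
      (by rw [koszulD_comp, hbz]; ext J; exact hπb _)
    choose w' hw' using fun J => Submodule.mkQ_surjective _ (w J)
    obtain rfl : (fun J => π (w' J)) = w := funext hw'
    rw [koszulD_comp] at hw
    have : ∀ J, ∃ y, koszulH c z J - koszulD a w' J = b • y := fun J =>
      hker _ (by rw [map_sub, sub_eq_zero]; exact (congrFun hw J).symm)
    choose v hv using this
    refine ⟨v, ?_⟩
    -- Applying D yields bz = b·Dv, and b is a nonzerodivisor on M.
    have e : koszulH c z = koszulD a w' + b • v := by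
      ext J
      rw [Pi.add_apply, Pi.smul_apply, ← hv J]; abel
    rw [e, map_add, koszulD_koszulD, zero_add, map_smul] at hbz
    ext J
    exact hreg.1 (congrFun hbz J)

end Koszul

/-! ### Diagram chase in the double complex of two Koszul complexes -/

section Zigzag

variable {ι A M : Type*} [Fintype ι] [CommRing A] [AddCommGroup M] [Module A M]

/-- The submodule `(a_j)_j M` of `M`. -/
def kimg (a : ι → A) (M : Type*) [AddCommGroup M] [Module A M] : Submodule A M :=
  LinearMap.range (∑ j, a j • LinearMap.proj j : (ι → M) →ₗ[A] M)

lemma mem_kimg {a : ι → A} {m : M} : m ∈ kimg a M ↔ ∃ c : ι → M, ∑ j, a j • c j = m := by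
  simp [kimg, LinearMap.mem_range]

variable [LinearOrder ι]

lemma koszulD_empty (a : ι → A) (w : Finset ι → M) : koszulD a w ∅ = ∑ j, a j • w {j} := by
  rw [koszulD_apply]
  simp [ksign]

lemma koszulD_empty_mem (a : ι → A) (w : Finset ι → M) : koszulD a w ∅ ∈ kimg a M :=
  mem_kimg.mpr ⟨fun j => w {j}, (koszulD_empty a w).symm⟩

lemma koszulD_univ (a : ι → A) (w : Finset ι → M) : koszulD a w Finset.univ = 0 := by
  rw [koszulD_apply]
  simp

lemma koszulD_eq_zero_of_card_zero (a : ι → A) {z : Finset ι → M}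
    (hz : ∀ J, J.card ≠ 0 → z J = 0) : koszulD a z = 0 := by
  ext J
  rw [koszulD_apply]
  refine Finset.sum_eq_zero fun j _ => ?_
  split_ifs
  · rfl
  · rw [hz _ (by simp), smul_zero]

lemma exists_koszulD_of_mem_kimg (a : ι → A) {z : Finset ι → M}
    (hz : ∀ J, J.card ≠ 0 → z J = 0) (h : z ∅ ∈ kimg a M) :
    ∃ w : Finset ι → M, (∀ J, J.card ≠ 1 → w J = 0) ∧ koszulD a w = z := by
  obtain ⟨c, hc⟩ := mem_kimg.mp h
  have hw : ∀ J : Finset ι, J.card ≠ 1 → (∑ i, if J = {i} then c i else 0) = 0 := by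
    intro J hJ
    refine Finset.sum_eq_zero fun i _ => if_neg ?_
    rintro rfl
    exact hJ (Finset.card_singleton i)
  refine ⟨fun J => ∑ i, if J = {i} then c i else 0, hw, ?_⟩
  ext J
  by_cases hJ : J.card = 0
  · obtain rfl := Finset.card_eq_zero.mp hJ
    rw [koszulD_empty, ← hc]
    simp
  · rw [hz J hJ]
    exact koszulD_eq_zero_of_card (t := 0) hw J hJ

/-- Exactness of the l-direction, applied separately for each fixed L. In degree zero the Koszul
complex is not exact, and membership in lM takes the place of exactness. -/
lemma exists_koszulD_row {l : ι → A} (hl : ∀ t, 1 ≤ t → KoszulExact l M t) {p q : ℕ}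
    {z : Finset ι → Finset ι → M} (hz : ∀ J L, ¬(J.card = p ∧ L.card = q) → z J L = 0)
    (h0 : koszulD l z = 0) (hp : p = 0 → ∀ L, z ∅ L ∈ kimg l M) :
    ∃ w : Finset ι → Finset ι → M,
      (∀ J L, ¬(J.card = p + 1 ∧ L.card = q) → w J L = 0) ∧ koszulD l w = z := by
  have key : ∀ L, ∃ w : Finset ι → M, (∀ J, ¬(J.card = p + 1 ∧ L.card = q) → w J = 0) ∧
      koszulD l w = fun J => z J L := by
    intro L
    by_cases hL : L.card = q
    · have h1 : koszulD l (fun J => z J L) = 0 := by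
        have := koszulD_comp l (LinearMap.proj (R := A) (φ := fun _ : Finset ι => M) L) z
        rw [h0] at this
        exact this
      have h2 : ∀ J, J.card ≠ p → z J L = 0 := fun J hJ => hz J L (fun h => hJ h.1)
      rcases Nat.eq_zero_or_pos p with rfl | hp'
      · obtain ⟨w, hw, hw'⟩ := exists_koszulD_of_mem_kimg l h2 (hp rfl L)
        exact ⟨w, fun J hJ => hw J (fun h => hJ ⟨h, hL⟩), hw'⟩
      · obtain ⟨w, hw, hw'⟩ := hl p hp' _ h2 h1
        exact ⟨w, fun J hJ => hw J (fun h => hJ ⟨h, hL⟩), hw'⟩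
    · refine ⟨0, fun _ _ => rfl, ?_⟩
      rw [map_zero]
      ext J
      rw [hz J L (fun h => hL h.2)]
      rfl
  choose w hw hw' using key
  refine ⟨fun J L => w L J, fun J L h => hw L J h, ?_⟩
  ext J L
  have := koszulD_comp l (LinearMap.proj (R := A) (φ := fun _ : Finset ι => M) L)
    (fun J L => w L J)
  have h2 := congrFun this J
  simp only [LinearMap.proj_apply] at h2
  rw [← h2]
  exact congrFun (hw' L) J

lemma koszulD_swap (l : ι → A) (x : Finset ι → Finset ι → M) (J L : Finset ι) :
    koszulD l x J L = koszulD l (fun J => x J L) J :=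
  (congrFun (koszulD_comp l (LinearMap.proj (R := A) (φ := fun _ : Finset ι => M) L) x) J).symm

/-- The zigzags of the double complex `K(l) ⊗ K(g) ⊗ M`: the families of elements of bidegrees
`(p, n - p)` with matching differentials. -/
def zigzag (l g : ι → A) (M : Type*) [AddCommGroup M] [Module A M] :
    Submodule A (Finset ι → Finset ι → M) where
  carrier := {x | (∀ J L, J.card + L.card ≠ Fintype.card ι → x J L = 0) ∧
    ∀ J, koszulD l x J = koszulD g (x J)}
  zero_mem' := by simp
  add_mem' := by
    rintro x y ⟨hx, hx'⟩ ⟨hy, hy'⟩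
    exact ⟨fun J L h => by simp [hx J L h, hy J L h], fun J => by simp [hx', hy']⟩
  smul_mem' := by
    rintro c x ⟨hx, hx'⟩
    exact ⟨fun J L h => by simp [hx J L h], fun J => by simp [hx']⟩

lemma mem_zigzag {l g : ι → A} {x : Finset ι → Finset ι → M} :
    x ∈ zigzag l g M ↔ (∀ J L, J.card + L.card ≠ Fintype.card ι → x J L = 0) ∧
      ∀ J, koszulD l x J = koszulD g (x J) := Iff.rfl

lemma swap_mem_zigzag {l g : ι → A} {x : Finset ι → Finset ι → M} (hx : x ∈ zigzag l g M) :
    (fun L J => x J L) ∈ zigzag g l M := by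
  refine ⟨fun L J h => hx.1 J L (by omega), fun L => ?_⟩
  ext J
  rw [koszulD_swap, ← hx.2 J, koszulD_swap]

/-- The defect D_g x - D_l x, concentrated in row p, is an l-cycle because the two differentials
commute and square to zero. It is therefore D_l w with w in row p + 1; adding w repairs row p, moves
the defect to row p + 1, and leaves the starting entry untouched. -/
lemma exists_zigzag_step {l g : ι → A} (hl : ∀ t, 1 ≤ t → KoszulExact l M t) (p : ℕ)
    {x : Finset ι → Finset ι → M} (hx : ∀ J L, J.card + L.card ≠ Fintype.card ι → x J L = 0)
    (hy : ∀ J L, ¬(J.card = p ∧ J.card + L.card + 1 = Fintype.card ι) →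
      koszulD g (x J) L = koszulD l x J L)
    (hp : p = 0 → ∀ L, koszulD g (x ∅) L ∈ kimg l M) :
    ∃ x' : Finset ι → Finset ι → M, (∀ J L, J.card + L.card ≠ Fintype.card ι → x' J L = 0) ∧
      x' ∅ Finset.univ = x ∅ Finset.univ ∧
      ∀ J L, ¬(J.card = p + 1 ∧ J.card + L.card + 1 = Fintype.card ι) →
        koszulD g (x' J) L = koszulD l x' J L := by
  by_cases hpn : p + 1 ≤ Fintype.card ι
  swap
  · exact ⟨x, hx, rfl, fun J L _ => hy J L (by omega)⟩
  obtain ⟨q, hq⟩ := Nat.exists_eq_add_of_le hpn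
  let y : Finset ι → Finset ι → M := fun J => koszulD g (x J) - koszulD l x J
  have hy' : ∀ J L, ¬(J.card = p ∧ L.card = q) → y J L = 0 := by
    intro J L h
    exact sub_eq_zero.mpr (hy J L (by omega))
  have h1 : koszulD l y = - fun J => koszulD g (y J) := by
    have : y = (fun J => koszulD g (x J)) - koszulD l x := rfl
    rw [this, map_sub, koszulD_koszulD, sub_zero, koszulD_comp]
    ext1 J
    simp only [Pi.neg_apply, Pi.sub_apply, map_sub, koszulD_koszulD]
    simp
  have h0 : koszulD l y = 0 := by
    ext J L
    by_cases hJ : J.card = p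
    · rcases Nat.eq_zero_or_pos p with hp0 | hp0
      · rw [koszulD_eq_zero_of_card_zero]
        intro J hJ
        ext L
        exact hy' J L (by omega)
      · rw [koszulD_eq_zero_of_card (t := p - 1) _ J (by omega)]
        · rfl
        intro J hJ
        ext L
        exact hy' J L (by omega)
    · rw [h1, Pi.neg_apply]
      have : y J = 0 := by ext L; exact hy' J L (by omega)
      rw [this, map_zero, neg_zero]; rfl
  obtain ⟨w, hw, hw'⟩ := exists_koszulD_row hl hy' h0 (by
    intro hp0 L
    refine Submodule.sub_mem _ (hp hp0 L) ?_
    rw [koszulD_swap]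
    exact koszulD_empty_mem _ _)
  refine ⟨x + w, fun J L h => ?_, ?_, fun J L h => ?_⟩
  · rw [Pi.add_apply, Pi.add_apply, hx J L h, hw J L (by omega), add_zero]
  · rw [Pi.add_apply, Pi.add_apply, hw ∅ _ (by simp), add_zero]
  · rw [map_add, hw', Pi.add_apply, map_add, Pi.add_apply, Pi.add_apply]
    have : koszulD g (w J) L = 0 := by
      by_cases hJ : J.card = p + 1
      · rw [koszulD_apply]
        refine Finset.sum_eq_zero fun j _ => ?_
        split_ifs with hj
        · rfl
        · rw [hw, smul_zero]
          rw [Finset.card_insert_of_notMem hj]; omega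
      · have : w J = 0 := by ext L; exact hw J L (by omega)
        rw [this, map_zero]; rfl
    rw [this]
    change _ = _ + (koszulD g (x J) L - koszulD l x J L)
    abel

/-- Every element of `M / lM` killed by `g` is the start of a zigzag. -/
lemma exists_zigzag {l g : ι → A} (hl : ∀ t, 1 ≤ t → KoszulExact l M t) {u : M}
    (hu : ∀ j, g j • u ∈ kimg l M) : ∃ x ∈ zigzag l g M, x ∅ Finset.univ = u := by
  -- The initial family has the single entry u at (∅, univ). Its defect lies in row 0 with values
  -- among ± g_j u, which are in lM by assumption; after row `card ι` no defect can remain.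
  let x0 : Finset ι → Finset ι → M := fun J L => if J = ∅ ∧ L = Finset.univ then u else 0
  have key : ∀ p : ℕ, ∃ x' : Finset ι → Finset ι → M,
      (∀ J L, J.card + L.card ≠ Fintype.card ι → x' J L = 0) ∧ x' ∅ Finset.univ = u ∧
      ∀ J L, ¬(J.card = p + 1 ∧ J.card + L.card + 1 = Fintype.card ι) →
        koszulD g (x' J) L = koszulD l x' J L := by
    intro p
    induction p with
    | zero =>
      have h0 : ∀ J L, J ≠ ∅ → x0 J L = 0 := fun J L h => if_neg (fun h' => h h'.1)
      have hx0 : ∀ J L, J.card + L.card ≠ Fintype.card ι → x0 J L = 0 := by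
        intro J L h
        refine if_neg ?_
        rintro ⟨rfl, rfl⟩
        simp [Finset.card_univ] at h
      have hl0 : koszulD l x0 = 0 := koszulD_eq_zero_of_card_zero l (fun J hJ => by
        ext L; exact h0 J L (by rintro rfl; simp at hJ))
      obtain ⟨x, h1, h2, h3⟩ := exists_zigzag_step (g := g) hl 0 hx0 (by
        intro J L h
        rw [hl0]
        by_cases hJ : J = ∅
        · subst hJ
          rw [koszulD_apply]
          refine Finset.sum_eq_zero fun j _ => ?_
          split_ifs with hj
          · rfl
          · rw [hx0, smul_zero]
            rw [Finset.card_insert_of_notMem hj]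
            simp at h ⊢
            omega
        · have : x0 J = 0 := by ext L; exact h0 J L hJ
          rw [this, map_zero]; rfl) (by
        intro _ L
        rw [koszulD_apply]
        refine Submodule.sum_mem _ fun j _ => ?_
        split_ifs
        · exact Submodule.zero_mem _
        · by_cases hj : insert j L = Finset.univ
          · rw [mul_comm, mul_smul]
            refine Submodule.smul_mem _ _ ?_
            simp only [x0, hj, and_self, if_true]
            exact hu j
          · simp [x0, hj])
      exact ⟨x, h1, h2.trans (by simp [x0]), h3⟩
    | succ p ih =>
      obtain ⟨x, h1, h2, h3⟩ := ih
      obtain ⟨x', h1', h2', h3'⟩ := exists_zigzag_step hl (p + 1) h1 h3 (by simp)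
      exact ⟨x', h1', h2'.trans h2, h3'⟩
  obtain ⟨x, h1, h2, h3⟩ := key (Fintype.card ι)
  exact ⟨x, ⟨h1, fun J => by ext L; exact (h3 J L (by omega)).symm⟩, h2⟩

/-- A zigzag which starts at `0` in `M / lM` ends at `0` in `M / gM`. -/
lemma zigzag_end_mem {l g : ι → A} (hl : ∀ t, 1 ≤ t → KoszulExact l M t)
    {x : Finset ι → Finset ι → M} (hx : x ∈ zigzag l g M) (h : x ∅ Finset.univ ∈ kimg l M) :
    x Finset.univ ∅ ∈ kimg g M := by
  -- Here q is the first row that may be nonzero. Row q is an l-cycle, hence an l-boundary D_l w,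
  -- and subtracting the total boundary of w clears it. Once q exceeds `card ι`, the end entry
  -- itself is zero.
  have key : ∀ m q : ℕ, m + q = Fintype.card ι + 1 → ∀ x ∈ zigzag l g M,
      (∀ J L, J.card < q → x J L = 0) → (q = 0 → x ∅ Finset.univ ∈ kimg l M) →
      x Finset.univ ∅ ∈ kimg g M := by
    intro m
    induction m with
    | zero =>
      intro q hq x _ h0 _
      rw [h0 _ _ (by rw [Finset.card_univ]; omega)]
      exact Submodule.zero_mem _
    | succ m ih =>
      intro q hq x hx h0 hq0
      obtain ⟨r, hr⟩ := Nat.exists_eq_add_of_le (show q ≤ Fintype.card ι by omega)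
      have hz : ∀ J L, ¬(J.card = q ∧ L.card = r) → kpart q x J L = 0 := by
        intro J L h
        by_cases hJ : J.card = q
        · rw [kpart, if_pos hJ]; exact hx.1 J L (by omega)
        · rw [kpart, if_neg hJ]; rfl
      obtain ⟨w, hw, hw'⟩ := exists_koszulD_row hl hz (by
        rcases q with _ | q
        · exact koszulD_eq_zero_of_card_zero l (fun J hJ => if_neg hJ)
        · rw [koszulD_kpart]
          ext J L
          by_cases hJ : J.card = q
          · have : x J = 0 := by ext L; exact h0 J L (by omega)
            rw [kpart, if_pos hJ, hx.2, this, map_zero]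
            rfl
          · rw [kpart, if_neg hJ]
            rfl) (by
        rintro rfl L
        rw [kpart, if_pos Finset.card_empty]
        by_cases hL : L = Finset.univ
        · rw [hL]; exact hq0 rfl
        · rw [hx.1]
          · exact Submodule.zero_mem _
          · rw [Finset.card_empty, zero_add]
            exact fun h => hL (Finset.card_eq_iff_eq_univ L |>.mp h))
      have hgw : ∀ J, J.card ≠ q + 1 → w J = 0 := fun J hJ => by
        ext L; exact hw J L (by omega)
      -- The total boundary of w is itself a zigzag. Its entry at (univ, ∅) comes from D_g alone,
      -- since D_l vanishes at univ, so the end entry changes by an element of gM only.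
      let x' : Finset ι → Finset ι → M := x - (koszulD l w + fun J => koszulD g (w J))
      have hx' : x' ∈ zigzag l g M := by
        refine Submodule.sub_mem _ hx ⟨fun J L h => ?_, fun J => ?_⟩
        · rw [hw', Pi.add_apply, Pi.add_apply, hz J L (by omega), zero_add, koszulD_apply]
          refine Finset.sum_eq_zero fun j _ => ?_
          split_ifs with hj
          · rfl
          · rw [hw, smul_zero]
            rw [Finset.card_insert_of_notMem hj]; omega
        · rw [map_add, koszulD_koszulD, zero_add, koszulD_comp, Pi.add_apply, map_add,
            koszulD_koszulD, add_zero]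
      have hend := ih (q + 1) (by omega) x' hx' (by
        intro J L hJ
        simp only [x', Pi.sub_apply, Pi.add_apply]
        rw [hgw J (by omega), map_zero, hw']
        by_cases hJ' : J.card = q
        · simp [kpart, hJ']
        · simp [kpart, hJ', h0 J L (by omega)]) (by simp)
      have e : x Finset.univ ∅ = x' Finset.univ ∅ + koszulD g (w Finset.univ) ∅ := by
        simp only [x', Pi.sub_apply, Pi.add_apply, koszulD_univ]
        simp
      rw [e]
      exact Submodule.add_mem _ hend (koszulD_empty_mem _ _)
  exact key (Fintype.card ι + 1) 0 rfl x hx (by simp) (fun _ => h)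

end Zigzag

/-! ### Passing from a family to a subfamily in the Jacobson radical -/

section SubKoszul

variable {ι κ A : Type*} [LinearOrder ι] [Fintype ι] [LinearOrder κ] [Fintype κ] [CommRing A]

lemma kcontr_koszulD (a : ι → A) (u : ι) (w : Finset ι → A) :
    kcontr (A := A) u (koszulD a w) = - koszulD a (kcontr (A := A) u w) := by
  simp only [koszulD, LinearMap.sum_apply, LinearMap.smul_apply, map_sum, map_smul]
  rw [← Finset.sum_neg_distrib]
  exact Finset.sum_congr rfl fun i _ => by rw [kcontr_anticomm, smul_neg]

/-- Exactness in degree `t` of the Koszul complex on the elements `a_j`, `j ∈ U`. -/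
def KoszulExactOn (a : ι → A) (U : Finset ι) (t : ℕ) : Prop :=
  ∀ z : Finset ι → A, (∀ J, ¬(J.card = t ∧ J ⊆ U) → z J = 0) → koszulD a z = 0 →
    ∃ w : Finset ι → A, (∀ J, ¬ J ⊆ U → w J = 0) ∧ koszulD a w = z

/-- Let Z be the cycles on U. A preimage over U ∪ {u} has the form w' + e_u ∧ w'' with w'' again in
Z, so z = D w' + a_u w''. Thus Z ⊆ D(W) + a_u Z, where W is the module of chains on U, and
Nakayama's lemma gives Z ⊆ D(W). -/
lemma KoszulExactOn.of_insert [IsNoetherianRing A] {a : ι → A} {U : Finset ι} {u : ι}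
    (hu : u ∉ U) (hau : a u ∈ (⊥ : Ideal A).jacobson) {t : ℕ}
    (h : KoszulExactOn a (insert u U) t) : KoszulExactOn a U t := by
  let Z : Submodule A (Finset ι → A) :=
    { carrier := {z | (∀ J, ¬(J.card = t ∧ J ⊆ U) → z J = 0) ∧ koszulD a z = 0}
      zero_mem' := by simp
      add_mem' := by
        rintro x y ⟨hx, hx'⟩ ⟨hy, hy'⟩
        exact ⟨fun J hJ => by simp [hx J hJ, hy J hJ], by simp [hx', hy']⟩
      smul_mem' := by
        rintro c x ⟨hx, hx'⟩
        exact ⟨fun J hJ => by simp [hx J hJ], by simp [hx']⟩ }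
  let W : Submodule A (Finset ι → A) :=
    { carrier := {w | ∀ J, ¬ J ⊆ U → w J = 0}
      zero_mem' := by simp
      add_mem' := fun {x y} hx hy J hJ => by simp [hx J hJ, hy J hJ]
      smul_mem' := fun c x hx J hJ => by simp [hx J hJ] }
  suffices hZ : Z ≤ W.map (koszulD a) by
    intro z hz h0
    obtain ⟨w, hw, hw'⟩ := hZ ⟨hz, h0⟩
    exact ⟨w, hw, hw'⟩
  refine Submodule.le_of_le_smul_of_le_jacobson_bot (I := Ideal.span {a u})
    (IsNoetherian.noetherian Z) ((Ideal.span_singleton_le_iff_mem _).mpr hau) ?_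
  rintro z ⟨hz, h0⟩
  obtain ⟨w0, hw0, hw0'⟩ := h z (fun J hJ => hz J (fun h' => hJ
    ⟨h'.1, h'.2.trans (Finset.subset_insert _ _)⟩)) h0
  let w := kpart (t + 1) w0
  have hw : ∀ J, ¬ J ⊆ insert u U → w J = 0 := fun J hJ => by
    simp only [w, kpart]; split_ifs; exacts [hw0 J hJ, rfl]
  have hwt : ∀ J, J.card ≠ t + 1 → w J = 0 := fun J hJ => if_neg hJ
  have hw' : koszulD a w = z := by
    rw [koszulD_kpart, hw0']
    ext J
    by_cases hJ : J.card = t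
    · exact if_pos hJ
    · rw [hz J (fun h => hJ h.1)]; exact if_neg hJ
  let w' : Finset ι → A := fun J => if u ∈ J then 0 else w J
  let w'' := kcontr (A := A) u w
  -- The operator `koszulH` with coefficient vector `Pi.single u 1` is multiplication by e_u, so the
  -- homotopy formula evaluates D(e_u ∧ w'') as a_u w'' for the cycle w''.
  have hsplit : w = w' + koszulH (Pi.single u (1 : A)) w'' := by
    ext J
    simp only [koszulH, LinearMap.sum_apply, LinearMap.smul_apply, Pi.add_apply, Finset.sum_apply,
      Pi.smul_apply]
    rw [Finset.sum_eq_single u (by intro j _ hj; simp [hj]) (by simp)]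
    by_cases hJ : u ∈ J
    · simp [w', w'', hJ, kmult_apply, kcontr_apply, ksign_erase, ← mul_assoc, ksign_mul_self]
    · simp [w', hJ, kmult_apply]
  have hw''0 : koszulD a w'' = 0 := by
    have h1 := kcontr_koszulD a u w
    rw [hw'] at h1
    have h2 : kcontr (A := A) u z = 0 := by
      ext J
      rw [kcontr_apply]
      split_ifs
      · rfl
      · rw [hz, smul_zero]
        · rfl
        · exact fun h' => hu (h'.2 (Finset.mem_insert_self u J))
    rw [h2] at h1
    exact (neg_eq_zero.mp h1.symm)
  have hw''Z : w'' ∈ Z := by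
    refine ⟨fun J hJ => ?_, hw''0⟩
    simp only [w'', kcontr_apply]
    split_ifs with huJ
    · rfl
    · by_cases h1 : J.card = t
      · rw [hw, smul_zero]
        intro h2
        refine hJ ⟨h1, fun x hx => ?_⟩
        rcases Finset.mem_insert.mp (h2 (Finset.mem_insert_of_mem hx)) with rfl | h3
        · exact absurd hx huJ
        · exact h3
      · rw [hwt, smul_zero]
        rw [Finset.card_insert_of_notMem huJ]; omega
  have hfin : z = koszulD a w' + a u • w'' := by
    have h1 := koszulD_koszulH a (Pi.single u (1 : A)) w''
    rw [hw''0, map_zero, add_zero] at h1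
    rw [← hw', hsplit, map_add, h1]
    congr 2
    rw [Finset.sum_eq_single u (by intro j _ hj; simp [hj]) (by simp)]
    simp
  rw [hfin]
  refine Submodule.add_mem_sup ⟨w', ?_, rfl⟩
    (Submodule.smul_mem_smul (Ideal.mem_span_singleton_self _) hw''Z)
  intro J hJ
  simp only [w']
  split_ifs with huJ
  · rfl
  · refine hw J fun h2 => hJ fun x hx => ?_
    rcases Finset.mem_insert.mp (h2 hx) with rfl | h3
    · exact absurd hx huJ
    · exact h3

lemma KoszulExact.on [IsNoetherianRing A] {a : ι → A} {t : ℕ} (h : KoszulExact a A t)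
    (ha : ∀ i, a i ∈ (⊥ : Ideal A).jacobson) (U : Finset ι) : KoszulExactOn a U t := by
  have key : ∀ V : Finset ι, KoszulExactOn a Vᶜ t := by
    intro V
    induction V using Finset.induction_on with
    | empty =>
      intro z hz h0
      obtain ⟨w, -, hw⟩ := h z (fun J hJ => hz J (fun h' => hJ h'.1)) h0
      exact ⟨w, fun J hJ => absurd (by simp) hJ, hw⟩
    | insert u V hu ih =>
      refine KoszulExactOn.of_insert (u := u) (by simp) (ha u) ?_
      have : insert u (insert u V)ᶜ = Vᶜ := by
        ext x; by_cases hx : x = u <;> simp [hx, hu]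
      rwa [this]
  have := key Uᶜ
  rwa [compl_compl] at this

lemma koszulD_comp_embedding (e : κ ↪o ι) (a : ι → A) {w : Finset ι → A}
    (hw : ∀ J, ¬ J ⊆ Finset.univ.map e.toEmbedding → w J = 0) (J : Finset κ) :
    koszulD (a ∘ e) (fun J => w (J.map e.toEmbedding)) J = koszulD a w (J.map e.toEmbedding) := by
  rw [koszulD_apply, koszulD_apply]
  have hs : ∀ j, ksign A (e j) (J.map e.toEmbedding) = ksign A j J := by
    intro j
    rw [ksign, ksign, Finset.filter_map, Finset.card_map]
    congr 2
    ext i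
    simp
  symm
  refine (Finset.sum_subset (Finset.subset_univ (Finset.univ.map e.toEmbedding)) ?_).symm.trans ?_
  · intro i _ hi
    split_ifs
    · rfl
    · rw [hw, smul_zero]
      exact fun h => hi (h (Finset.mem_insert_self _ _))
  · rw [Finset.sum_map]
    refine Finset.sum_congr rfl fun j _ => ?_
    have e1 : e.toEmbedding j = e j := rfl
    rw [e1, hs]
    have e2 : (e j ∈ J.map e.toEmbedding) ↔ j ∈ J := by
      rw [← e1, Finset.mem_map']
    simp only [e2, Function.comp_apply, Finset.map_insert, e1]

/-- An order embedding preserves the signs, so the complex on the image of e is the complex of the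
reindexed family; extension by zero transports cycles. -/
lemma KoszulExactOn.comp_embedding (e : κ ↪o ι) {a : ι → A} {t : ℕ}
    (h : KoszulExactOn a (Finset.univ.map e.toEmbedding) t) : KoszulExact (a ∘ e) A t := by
  refine KoszulExact.of_exists fun z hz h0 => ?_
  let z' : Finset ι → A := fun J => if J ⊆ Finset.univ.map e.toEmbedding then
    z (J.preimage e e.injective.injOn) else 0
  have hpre : ∀ J : Finset κ, (J.map e.toEmbedding).preimage e e.injective.injOn = J := by
    intro J; ext x; simp
  have hz'e : ∀ J : Finset κ, z' (J.map e.toEmbedding) = z J := by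
    intro J
    simp only [z']
    rw [if_pos (Finset.map_subset_map.mpr (Finset.subset_univ _)), hpre]
  have hmap : ∀ J, J ⊆ Finset.univ.map e.toEmbedding →
      J = (J.preimage e e.injective.injOn).map e.toEmbedding := by
    intro J hJ
    ext x
    simp only [Finset.mem_map, Finset.mem_preimage]
    constructor
    · intro hx
      obtain ⟨y, -, rfl⟩ := Finset.mem_map.mp (hJ hx)
      exact ⟨y, hx, rfl⟩
    · rintro ⟨y, hy, rfl⟩; exact hy
  have hz'U : ∀ J, ¬ J ⊆ Finset.univ.map e.toEmbedding → z' J = 0 := fun J hJ => if_neg hJ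
  have hz'0 : koszulD a z' = 0 := by
    ext J
    by_cases hJ : J ⊆ Finset.univ.map e.toEmbedding
    · rw [hmap J hJ, ← koszulD_comp_embedding e a hz'U]
      simp only [hz'e]
      exact congrFun h0 _
    · rw [koszulD_apply]
      refine Finset.sum_eq_zero fun j _ => ?_
      split_ifs
      · rfl
      · rw [hz'U _ (fun h' => hJ ((Finset.subset_insert _ _).trans h')), smul_zero]
  obtain ⟨w, hw, hw'⟩ := h z' (by
    intro J hJ
    by_cases hJU : J ⊆ Finset.univ.map e.toEmbedding
    · rw [hmap J hJU, hz'e]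
      refine hz _ fun hc => hJ ⟨?_, hJU⟩
      rw [hmap J hJU, Finset.card_map, hc]
    · exact hz'U J hJU) hz'0
  refine ⟨fun J => w (J.map e.toEmbedding), ?_⟩
  ext J
  rw [koszulD_comp_embedding e a hw, hw', hz'e]

end SubKoszul

/-! ### Height conditions imply acyclicity in a local ring -/

section Height

open RingTheory.Sequence

/-- After localizing at Q the sequence is regular, and each of its members lowers the dimension by
one. -/
lemma length_le_height_of_isWeaklyRegular {A : Type*} [CommRing A] [IsNoetherianRing A]
    {rs : List A} (h : IsWeaklyRegular A rs) (Q : Ideal A) [Q.IsPrime] (hQ : ∀ r ∈ rs, r ∈ Q) :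
    (rs.length : ℕ∞) ≤ Q.height := by
  have h1 := h.isRegular_of_isLocalization_of_mem (Localization.AtPrime Q) Q hQ
  have h2 := ringKrullDim_add_length_eq_ringKrullDim_of_isRegular _ h1
  rw [IsLocalization.AtPrime.ringKrullDim_eq_height Q (Localization.AtPrime Q),
    List.length_map] at h2
  have : Nontrivial (Localization.AtPrime Q ⧸
      Ideal.ofList (rs.map (algebraMap A (Localization.AtPrime Q)))) := by
    rw [Ideal.Quotient.nontrivial_iff]
    intro h3
    exact h1.2 (by rw [h3, Submodule.top_smul])
  have h3 := ringKrullDim_nonneg_of_nontrivial (R := Localization.AtPrime Q ⧸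
      Ideal.ofList (rs.map (algebraMap A (Localization.AtPrime Q))))
  have h4 : ((rs.length : ℕ∞) : WithBot ℕ∞) ≤ (Q.height : WithBot ℕ∞) := by
    rw [← h2]
    calc ((rs.length : ℕ∞) : WithBot ℕ∞) = 0 + (rs.length : WithBot ℕ∞) := by simp
      _ ≤ _ := by gcongr
  exact_mod_cast h4

/-- In a Noetherian local ring, a sequence of `m` elements generating an ideal of height `≥ m` can
be extended to a sequence of `N` elements generating an ideal of height `≥ N`, for every `N` up to
the dimension. -/
lemma exists_extend_height {A : Type*} [CommRing A] [IsNoetherianRing A] [IsLocalRing A] {m N : ℕ}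
    (hmN : m ≤ N) (hN : (N : ℕ∞) ≤ (IsLocalRing.maximalIdeal A).height) (a : Fin m → A)
    (ha : ∀ i, a i ∈ IsLocalRing.maximalIdeal A)
    (hht : ∀ Q : Ideal A, Q.IsPrime → (∀ i, a i ∈ Q) → (m : ℕ∞) ≤ Q.height) :
    ∃ b : Fin N → A, (∀ i, b (Fin.castLE hmN i) = a i) ∧
      (∀ i, b i ∈ IsLocalRing.maximalIdeal A) ∧
      ∀ Q : Ideal A, Q.IsPrime → (∀ i, b i ∈ Q) → (N : ℕ∞) ≤ Q.height := by
  induction N, hmN using Nat.le_induction with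
  | base => exact ⟨a, fun i => rfl, ha, hht⟩
  | succ N hmN ih =>
    obtain ⟨b, hb1, hb2, hb3⟩ := ih (le_trans (by exact_mod_cast Nat.le_succ N) hN)
    let I := Ideal.span (Set.range b)
    have hfin := Ideal.finite_minimalPrimes_of_isNoetherianRing A I
    -- Prime avoidance: by Krull's height theorem the minimal primes of (b) have height at most N,
    -- while the maximal ideal has height at least N + 1.
    have hnot : ¬ ((IsLocalRing.maximalIdeal A : Set A) ⊆
        ⋃ P ∈ (hfin.toFinset : Set (Ideal A)), (P : Set A)) := by
      intro hsub
      rw [Ideal.subset_union_prime (s := hfin.toFinset) (f := fun P => P) ⊥ ⊥ (by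
        intro P hP _ _
        exact ((hfin.mem_toFinset).mp hP).1.1)] at hsub
      obtain ⟨P, hP, hle⟩ := hsub
      have hP' := (hfin.mem_toFinset).mp hP
      have h1 := Ideal.height_le_card_of_mem_minimalPrimes_span (Set.finite_range b) hP'
      have h2 : (Set.range b).ncard ≤ N := by
        have := Set.ncard_image_le (f := b) (Set.finite_univ)
        rwa [Set.image_univ, Set.ncard_univ, Nat.card_eq_fintype_card, Fintype.card_fin] at this
      have h3 := hN.trans ((Ideal.height_mono hle).trans (h1.trans (Nat.cast_le.mpr h2)))
      have : N + 1 ≤ N := by exact_mod_cast h3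
      omega
    obtain ⟨y, hy, hy'⟩ := Set.not_subset.mp hnot
    refine ⟨Fin.snoc b y, ?_, ?_, ?_⟩
    · intro i
      rw [← hb1 i]
      have : Fin.castLE (Nat.le_succ_of_le hmN) i = (Fin.castLE hmN i).castSucc := rfl
      rw [this, Fin.snoc_castSucc (α := fun _ => A)]
    · intro i
      refine Fin.lastCases ?_ (fun i => ?_) i
      · rw [Fin.snoc_last (α := fun _ => A)]; exact hy
      · rw [Fin.snoc_castSucc (α := fun _ => A)]; exact hb2 i
    · intro Q hQ hbQ
      have hI : I ≤ Q := by
        rw [Ideal.span_le]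
        rintro _ ⟨i, rfl⟩
        have := hbQ i.castSucc
        rwa [Fin.snoc_castSucc (α := fun _ => A)] at this
      -- A minimal prime P of (b) inside Q has height at least N and avoids y, so the inclusion P <
      -- Q is strict.
      obtain ⟨P, hP, hPQ⟩ := Ideal.exists_minimalPrimes_le hI
      have hPp : P.IsPrime := hP.1.1
      have hyP : y ∉ P := by
        intro h
        apply hy'
        simp only [Set.mem_iUnion]
        exact ⟨P, by simpa using hP, h⟩
      have hyQ : y ∈ Q := by
        have := hbQ (Fin.last N)
        rwa [Fin.snoc_last (α := fun _ => A)] at this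
      have hlt : P < Q := lt_of_le_of_ne hPQ (by rintro rfl; exact hyP hyQ)
      have h1 := hb3 P hPp (fun i => hP.1.2 (Ideal.subset_span ⟨i, rfl⟩))
      have h2 := Ideal.height_add_one_le_of_lt_of_isPrime hlt
      refine le_trans ?_ h2
      push_cast
      gcongr

/-- Let `A` be a Noetherian local ring whose maximal ideal is generated by a sequence all of whose
powers are regular. Then the Koszul complex of `n` elements generating an ideal of height `≥ n` is
acyclic. -/
lemma koszulExact_of_local {A : Type*} [CommRing A] [IsNoetherianRing A] [IsLocalRing A]
    (gs : List A) (hgs : Ideal.ofList gs = IsLocalRing.maximalIdeal A)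
    (hreg : ∀ s : ℕ, IsWeaklyRegular A (gs.map (· ^ s))) {n : ℕ} (l : Fin n → A)
    (hl : ∀ i, l i ∈ IsLocalRing.maximalIdeal A)
    (hht : ∀ Q : Ideal A, Q.IsPrime → (∀ i, l i ∈ Q) → (n : ℕ∞) ≤ Q.height) {t : ℕ} (ht : 1 ≤ t) :
    KoszulExact l A t := by
  have hspan : Ideal.span {r | r ∈ gs} = IsLocalRing.maximalIdeal A := hgs
  have hmem : ∀ r ∈ gs, r ∈ IsLocalRing.maximalIdeal A := fun r hr => by
    rw [← hspan]; exact Ideal.subset_span hr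
  have hN1 : (gs.length : ℕ∞) ≤ (IsLocalRing.maximalIdeal A).height :=
    length_le_height_of_isWeaklyRegular (by simpa using hreg 1) _ hmem
  have hN2 : (IsLocalRing.maximalIdeal A).height ≤ gs.length := by
    classical
    have h0 := Ideal.height_le_card_of_mem_minimalPrimes_span (p := IsLocalRing.maximalIdeal A)
      (s := {r | r ∈ gs}) (List.finite_toSet gs) (by
        rw [hspan, Ideal.minimalPrimes_eq_subsingleton_self]; rfl)
    refine h0.trans ?_
    have : {r | r ∈ gs} = (gs.toFinset : Set A) := by ext; simp
    rw [this, Set.ncard_coe_finset]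
    exact_mod_cast List.toFinset_card_le gs
  have hnN : n ≤ gs.length := by
    have := (hht _ inferInstance hl).trans hN2
    exact_mod_cast this
  obtain ⟨b, hb1, hb2, hb3⟩ := exists_extend_height hnN hN1 l hl hht
  -- A prime containing b has height at least the dimension, so it is the maximal ideal and (b) is
  -- primary to it.
  have hrad : IsLocalRing.maximalIdeal A ≤ (Ideal.span (Set.range b)).radical := by
    rw [Ideal.radical_eq_sInf]
    refine le_sInf ?_
    rintro Q ⟨hQ, hQp⟩
    have h1 := hb3 Q hQp (fun i => hQ (Ideal.subset_span ⟨i, rfl⟩))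
    by_contra hne
    have hlt : Q < IsLocalRing.maximalIdeal A :=
      lt_of_le_of_ne (IsLocalRing.le_maximalIdeal hQp.ne_top) (by rintro rfl; exact hne le_rfl)
    have h2 := (Ideal.height_add_one_le_of_lt_of_isPrime hlt).trans hN2
    have h3 : (gs.length : ℕ∞) + 1 ≤ gs.length := le_trans (by gcongr) h2
    have : gs.length + 1 ≤ gs.length := by exact_mod_cast h3
    omega
  have hpow : ∃ s : ℕ, ∀ r ∈ gs, r ^ s ∈ Ideal.span (Set.range b) := by
    obtain ⟨s, hs⟩ := Ideal.exists_pow_le_of_le_radical_of_fg hrad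
      (IsNoetherian.noetherian _)
    exact ⟨s, fun r hr => hs (Ideal.pow_mem_pow (hmem r hr) s)⟩
  obtain ⟨s, hs⟩ := hpow
  -- The powers of the generators `gs` form a regular sequence inside (b), as long as b itself;
  -- hence exactness in every positive degree.
  have hex : KoszulExact b A t := by
    refine koszulExact_of_isWeaklyRegular b (gs.map (· ^ s)) ?_ A (hreg s) t ?_
    · intro r hr
      obtain ⟨g, hg, rfl⟩ := List.mem_map.mp hr
      exact hs g hg
    · simp; omega
  have hbj : ∀ i, b i ∈ (⊥ : Ideal A).jacobson := fun i => by
    rw [IsLocalRing.jacobson_eq_maximalIdeal ⊥ bot_ne_top]; exact hb2 i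
  have := (hex.on hbj (Finset.univ.map (Fin.castLEOrderEmb hnN).toEmbedding)).comp_embedding
  have e : b ∘ (Fin.castLEOrderEmb hnN) = l := funext hb1
  rwa [e] at this

/-- The global version: cycles become boundaries after multiplication by an element outside of the
maximal ideal. -/
theorem exists_smul_koszulD {P : Type*} [CommRing P] [IsNoetherianRing P] (Mx : Ideal P)
    [Mx.IsPrime] (gs : List P) (hgs : Ideal.ofList gs = Mx)
    (hreg : ∀ s : ℕ, IsWeaklyRegular P (gs.map (· ^ s))) {n : ℕ} (l : Fin n → P)
    (hl : ∀ i, l i ∈ Mx)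
    (hht : ∀ Q : Ideal P, Q.IsPrime → (∀ i, l i ∈ Q) → (n : ℕ∞) ≤ Q.height) {t : ℕ} (ht : 1 ≤ t)
    (z : Finset (Fin n) → P) (hz : ∀ J, J.card ≠ t → z J = 0) (h0 : koszulD l z = 0) :
    ∃ s : P, s ∉ Mx ∧ ∃ w, koszulD l w = s • z := by
  let A := Localization.AtPrime Mx
  let φ := algebraMap P A
  have hnat : ∀ w : Finset (Fin n) → P, koszulD (φ ∘ l) (φ ∘ w) = φ ∘ koszulD l w := by
    intro w
    ext J
    simp only [koszulD_apply, Function.comp_apply, map_sum]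
    refine Finset.sum_congr rfl fun j _ => ?_
    split_ifs
    · simp
    · simp [ksign]
  have hex : KoszulExact (φ ∘ l) A t := by
    refine koszulExact_of_local (gs.map φ) ?_ ?_ (φ ∘ l) ?_ ?_ ht
    · rw [← Ideal.map_ofList, hgs]
      exact Localization.AtPrime.map_eq_maximalIdeal
    · intro s
      have := (hreg s).of_isLocalization A Mx.primeCompl
      rw [List.map_map] at this ⊢
      convert this using 2
      ext x; simp [φ]
    · intro i
      rw [← Localization.AtPrime.map_eq_maximalIdeal]
      exact Ideal.mem_map_of_mem _ (hl i)
    · intro Q hQ hlQ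
      rw [← IsLocalization.height_under Mx.primeCompl Q]
      exact hht _ inferInstance hlQ
  obtain ⟨w, -, hw⟩ := hex (φ ∘ z) (fun J hJ => by simp [hz J hJ]) (by
    rw [hnat, h0]; ext; simp)
  obtain ⟨s, hs⟩ := IsLocalization.exist_integer_multiples Mx.primeCompl Finset.univ w
  choose w' hw' using fun J => hs J (Finset.mem_univ J)
  have h1 : φ ∘ koszulD l w' = φ ∘ ((s : P) • z) := by
    rw [← hnat]
    have : φ ∘ w' = φ s • w := by
      ext J
      change φ (w' J) = φ s * w J
      rw [hw', Algebra.smul_def]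
    rw [this, map_smul, hw]
    ext J; simp
  -- Equality in the localization holds in P after multiplication by some c J; the product over the
  -- finitely many J serves all components at once.
  have h2 : ∀ J, ∃ c : Mx.primeCompl, (c : P) * koszulD l w' J = c * ((s : P) • z) J := fun J =>
    (IsLocalization.eq_iff_exists Mx.primeCompl A).mp (congrFun h1 J)
  choose c hc using h2
  refine ⟨(∏ J, (c J : P)) * s, ?_, (∏ J, (c J : P)) • w', ?_⟩
  · have := (∏ J, c J * s : Mx.primeCompl).2
    have h3 : ((∏ J, c J) * s : Mx.primeCompl).1 ∉ Mx := ((∏ J, c J) * s : Mx.primeCompl).2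
    simpa using h3
  · rw [map_smul, mul_smul]
    ext J
    obtain ⟨d, hd⟩ := Finset.dvd_prod_of_mem (fun J => (c J : P)) (Finset.mem_univ J)
    simp only [Pi.smul_apply, smul_eq_mul]
    rw [hd]
    have := hc J
    simp only [Pi.smul_apply, smul_eq_mul] at this
    calc _ = d * (c J * koszulD l w' J) := by ring
      _ = _ := by rw [this]; ring

end Height

open RingTheory.Sequence

/-! ### Powers of the variables form a regular sequence -/

section Regular

/-- Membership in a monomial ideal is tested on monomials, and for i ≠ j divisibility by X_j^s is
unaffected by multiplication with X_i^s. -/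
lemma isWeaklyRegular_X_pow {σ A : Type*} [CommRing A] (xs : List σ) (hxs : xs.Nodup) (s : ℕ) :
    IsWeaklyRegular (MvPolynomial σ A)
      (xs.map fun i => (MvPolynomial.X i : MvPolynomial σ A) ^ s) := by
  induction xs using List.reverseRecOn with
  | nil => simp
  | append_singleton xs i ih =>
    rw [List.nodup_append] at hxs
    rw [List.map_append, isWeaklyRegular_append_iff]
    refine ⟨ih hxs.1, ?_⟩
    rw [List.map_singleton, isWeaklyRegular_singleton_iff]
    have hi : i ∉ xs := fun h => (hxs.2.2 i h i (by simp)) rfl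
    have hideal : (Ideal.ofList (xs.map fun i => (MvPolynomial.X i : MvPolynomial σ A) ^ s)) =
        Ideal.span ((fun m => MvPolynomial.monomial m (1 : A)) ''
          ((fun j => Finsupp.single j s) '' {j | j ∈ xs})) := by
      rw [Ideal.ofList]
      congr 1
      ext q
      simp only [Set.mem_ofPred_eq, List.mem_map, Set.mem_image, exists_exists_and_eq_and,
        MvPolynomial.X_pow_eq_monomial]
    rw [isSMulRegular_iff_right_eq_zero_of_smul]
    intro x hx
    obtain ⟨f, rfl⟩ := Submodule.mkQ_surjective _ x
    rw [← map_smul, Submodule.mkQ_apply, Submodule.Quotient.mk_eq_zero, smul_eq_mul,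
      Ideal.mul_top, hideal, MvPolynomial.mem_ideal_span_monomial_image] at hx
    rw [Submodule.mkQ_apply, Submodule.Quotient.mk_eq_zero, smul_eq_mul, Ideal.mul_top, hideal,
      MvPolynomial.mem_ideal_span_monomial_image]
    intro m hm
    obtain ⟨_, ⟨j, hj, rfl⟩, hle⟩ := hx (m + Finsupp.single i s) (by
      rw [MvPolynomial.mem_support_iff, smul_eq_mul, mul_comm, MvPolynomial.X_pow_eq_monomial,
        MvPolynomial.coeff_mul_monomial]
      simpa using hm)
    refine ⟨_, ⟨j, hj, rfl⟩, ?_⟩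
    have hji : i ≠ j := by rintro rfl; exact hi hj
    classical
    rw [Finsupp.single_le_iff] at hle ⊢
    simpa [Finsupp.single_apply, hji] using hle

lemma isWeaklyRegular_map_ringEquiv {A A' : Type*} [CommRing A] [CommRing A'] (e : A ≃+* A')
    {rs : List A} (h : IsWeaklyRegular A rs) : IsWeaklyRegular A' (rs.map e) :=
  (AddEquiv.isWeaklyRegular_congr (e := e.toAddEquiv) (by
    rw [List.forall₂_map_right_iff, List.forall₂_same]
    intro r _ x
    simp)).mp h

end Regular

/-! ### Ideals of linear forms and heights of primes in a polynomial ring -/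

section LinearForms

variable {τ K : Type*} [Fintype τ] [Field K]

/-- The linear form with given coefficients. -/
def linForm : (τ → K) →ₗ[K] MvPolynomial τ K := Fintype.linearCombination K MvPolynomial.X

lemma linForm_apply (v : τ → K) : linForm v = ∑ i, v i • (MvPolynomial.X i : MvPolynomial τ K) :=
  rfl

lemma linForm_injective : Function.Injective (linForm : (τ → K) →ₗ[K] MvPolynomial τ K) := by
  classical
  intro v w h
  ext i
  have := congrArg (MvPolynomial.coeff (Finsupp.single i 1)) h
  simpa [linForm_apply, MvPolynomial.coeff_sum, MvPolynomial.coeff_X, Finsupp.single_left_inj]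
    using this

/-- The ideal generated by the linear forms in `V`. -/
def formIdeal (V : Submodule K (τ → K)) : Ideal (MvPolynomial τ K) := Ideal.span (linForm '' V)

/-- The ideal generated by a space of linear forms is the kernel of an endomorphism. -/
lemma exists_formIdeal_eq_ker (V : Submodule K (τ → K)) :
    ∃ Φ : MvPolynomial τ K →ₐ[K] MvPolynomial τ K, formIdeal V = RingHom.ker Φ ∧
      ∀ v, Φ (linForm v) = 0 → v ∈ V := by
  classical
  obtain ⟨W, hW⟩ := V.exists_isCompl
  -- The endomorphism Φ substitutes for the variables according to the projection onto a complement
  -- W with kernel V, so it kills exactly those linear forms that come from V.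
  let π := W.projection V hW.symm
  let Φ : MvPolynomial τ K →ₐ[K] MvPolynomial τ K :=
    MvPolynomial.aeval (fun i => linForm (π (Pi.single i 1)))
  have hπ : ∀ v, π v = 0 ↔ v ∈ V := fun v => by
    rw [← LinearMap.mem_ker, Submodule.ker_projection]
  have hΦ : ∀ v, Φ (linForm v) = linForm (π v) := by
    intro v
    have : (Φ.toLinearMap ∘ₗ linForm) = linForm ∘ₗ π := by
      refine LinearMap.pi_ext' fun i => LinearMap.ext_ring ?_
      simp [linForm_apply, Φ, Pi.single_apply]
    exact LinearMap.congr_fun this v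
  refine ⟨Φ, le_antisymm ?_ ?_, fun v hv => ?_⟩
  · rw [formIdeal, Ideal.span_le]
    rintro _ ⟨v, hv, rfl⟩
    rw [SetLike.mem_coe, RingHom.mem_ker]
    change Φ (linForm v) = 0
    rw [hΦ, (hπ v).mpr hv, map_zero]
  · have h : ∀ f, f - Φ f ∈ formIdeal V := by
      intro f
      rw [← Ideal.Quotient.eq]
      have : (Ideal.Quotient.mkₐ K (formIdeal V)) =
          (Ideal.Quotient.mkₐ K (formIdeal V)).comp Φ := by
        ext i
        simp only [Ideal.Quotient.mkₐ_eq_mk, AlgHom.comp_apply]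
        rw [Ideal.Quotient.eq]
        have e : (MvPolynomial.X i : MvPolynomial τ K) = linForm (Pi.single i 1) := by
          simp [linForm_apply, Pi.single_apply]
        rw [e, hΦ, ← map_sub]
        refine Ideal.subset_span ⟨_, ?_, rfl⟩
        rw [SetLike.mem_coe, ← hπ, map_sub]
        have : π (π (Pi.single i 1)) = π (Pi.single i 1) := by
          exact LinearMap.congr_fun (Submodule.isIdempotentElem_projection hW.symm) _
        rw [this, sub_self]
      exact AlgHom.congr_fun this f
    intro f hf
    have := h f
    rw [show Φ f = 0 from hf, sub_zero] at this
    exact this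
  · rw [hΦ] at hv
    exact (hπ v).mp (linForm_injective (by rw [hv, map_zero]))

instance (V : Submodule K (τ → K)) : (formIdeal V).IsPrime := by
  obtain ⟨Φ, h, -⟩ := exists_formIdeal_eq_ker V
  rw [h]
  exact RingHom.ker_isPrime _

lemma linForm_mem_formIdeal {V : Submodule K (τ → K)} {v : τ → K} :
    linForm v ∈ formIdeal V ↔ v ∈ V := by
  refine ⟨fun h => ?_, fun h => Ideal.subset_span ⟨v, h, rfl⟩⟩
  obtain ⟨Φ, hΦ, hv⟩ := exists_formIdeal_eq_ker V
  rw [hΦ] at h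
  exact hv v h

lemma formIdeal_span {κ : Type*} (c : κ → τ → K) :
    formIdeal (Submodule.span K (Set.range c)) = Ideal.span (Set.range fun j => linForm (c j)) := by
  refine le_antisymm ?_ ?_
  · rw [formIdeal, Ideal.span_le]
    rintro _ ⟨v, hv, rfl⟩
    induction hv using Submodule.span_induction with
    | mem x hx => obtain ⟨j, rfl⟩ := hx; exact Ideal.subset_span ⟨j, rfl⟩
    | zero => simp
    | add x y _ _ hx hy => rw [map_add]; exact Ideal.add_mem _ hx hy
    | smul a x _ hx => rw [map_smul]; exact Submodule.smul_of_tower_mem _ a hx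
  · rw [Ideal.span_le]
    rintro _ ⟨j, rfl⟩
    exact linForm_mem_formIdeal.mpr (Submodule.subset_span ⟨j, rfl⟩)

lemma formIdeal_bot : formIdeal (⊥ : Submodule K (τ → K)) = ⊥ := by
  rw [formIdeal, Ideal.span_eq_bot]
  rintro _ ⟨v, hv, rfl⟩
  rw [SetLike.mem_coe, Submodule.mem_bot] at hv
  rw [hv, map_zero]

variable {R : Type*} [CommRing R] [IsNoetherianRing R]

/-- The extension of p has height at least ht p by going-down, and each further independent form
gives a strictly larger prime. Strictness must be witnessed over R, which is why each form has to
lift to R[T]. -/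
lemma height_comap_formIdeal (p : Ideal R) [p.IsPrime] {r : ℕ}
    (c : Fin r → τ → p.ResidueField) (hc : LinearIndependent p.ResidueField c)
    (hlift : ∀ j, ∃ L : MvPolynomial τ R,
      MvPolynomial.map (algebraMap R p.ResidueField) L = linForm (c j)) :
    p.height + r ≤ ((formIdeal (Submodule.span p.ResidueField (Set.range c))).comap
      (MvPolynomial.map (σ := τ) (algebraMap R p.ResidueField))).height := by
  induction r with
  | zero =>
    have : Set.range c = ∅ := Set.range_eq_empty c
    rw [this, Submodule.span_empty, formIdeal_bot, Nat.cast_zero, add_zero]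
    set P := (⊥ : Ideal (MvPolynomial τ p.ResidueField)).comap
      (MvPolynomial.map (σ := τ) (algebraMap R p.ResidueField))
    have hP : P.IsPrime := inferInstance
    have : P.LiesOver p := ⟨by
      ext a
      rw [Ideal.under_def, Ideal.mem_comap, Ideal.mem_comap, MvPolynomial.algebraMap_eq,
        MvPolynomial.map_C, Ideal.mem_bot, MvPolynomial.C_eq_zero,
        Ideal.algebraMap_residueField_eq_zero]⟩
    rw [Ideal.height_eq_height_add_of_liesOver_of_hasGoingDown p P]
    exact le_self_add
  | succ r ih =>
    have hc' : LinearIndependent p.ResidueField (Fin.init c) :=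
      hc.comp Fin.castSucc (Fin.castSucc_injective r)
    have h1 := ih (Fin.init c) hc' (fun j => hlift j.castSucc)
    set V' := Submodule.span p.ResidueField (Set.range (Fin.init c))
    set V := Submodule.span p.ResidueField (Set.range c)
    have hVV : V' ≤ V := Submodule.span_mono (by
      rintro _ ⟨j, rfl⟩; exact ⟨j.castSucc, rfl⟩)
    have hlast : c (Fin.last r) ∉ V' := by
      have h2 : Fin.init c = fun j => c j.castSucc := rfl
      have h3 : V' = Submodule.span p.ResidueField (c '' (Set.range Fin.castSucc)) := by
        rw [← Set.range_comp]; rfl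
      rw [h3]
      refine hc.notMem_span_image ?_
      rintro ⟨j, hj⟩
      exact (Fin.castSucc_lt_last j).ne hj
    have hlt : (formIdeal V').comap (MvPolynomial.map (σ := τ) (algebraMap R p.ResidueField)) <
        (formIdeal V).comap (MvPolynomial.map (σ := τ) (algebraMap R p.ResidueField)) := by
      refine lt_of_le_of_ne (Ideal.comap_mono (Ideal.span_mono (Set.image_mono hVV))) ?_
      intro heq
      obtain ⟨L, hL⟩ := hlift (Fin.last r)
      have : L ∈ (formIdeal V).comap
          (MvPolynomial.map (σ := τ) (algebraMap R p.ResidueField)) := by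
        rw [Ideal.mem_comap, hL, linForm_mem_formIdeal]
        exact Submodule.subset_span ⟨_, rfl⟩
      rw [← heq, Ideal.mem_comap, hL, linForm_mem_formIdeal] at this
      exact hlast this
    have h2 := Ideal.height_add_one_le_of_lt_of_isPrime hlt
    calc p.height + ((r + 1 : ℕ) : ℕ∞) = p.height + r + 1 := by push_cast; rw [add_assoc]
      _ ≤ _ := le_trans (by gcongr) h2

/-- If a prime ideal `Q` of `R[T]` contains the linear forms `∑ i, φ i j T_i`, then its height is
at least the height of `p = Q ∩ R` plus the rank of `φ` modulo `p`. -/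
lemma height_add_rank_le {κ : Type*} [Finite κ] (φ : τ → κ → R) (Q : Ideal (MvPolynomial τ R))
    [Q.IsPrime] (hQ : ∀ j, ∑ i, MvPolynomial.C (φ i j) * MvPolynomial.X i ∈ Q) (p : Ideal R)
    [p.IsPrime] (hp : Q.comap MvPolynomial.C = p) :
    p.height + (Module.finrank p.ResidueField (Submodule.span p.ResidueField
      (Set.range fun j i => algebraMap R p.ResidueField (φ i j))) : ℕ) ≤ Q.height := by
  have hmapL : ∀ j, MvPolynomial.map (algebraMap R p.ResidueField)
      (∑ i, MvPolynomial.C (φ i j) * MvPolynomial.X i) =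
      linForm (fun i => algebraMap R p.ResidueField (φ i j)) := by
    intro j
    simp only [linForm_apply, map_sum, map_mul, MvPolynomial.map_C, MvPolynomial.map_X,
      MvPolynomial.smul_eq_C_mul]
  obtain ⟨c, hc1, hc2, hc3⟩ := Submodule.exists_fun_fin_finrank_span_eq p.ResidueField
    (Set.range fun j i => algebraMap R p.ResidueField (φ i j))
  have h1 := height_comap_formIdeal p c hc3 (by
    intro j
    obtain ⟨j', hj'⟩ := hc1 j
    exact ⟨_, (hmapL j').trans (by rw [← hj'])⟩)
  -- It remains to see that the contraction of the ideal generated by the reduced forms lies in Q.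
  refine h1.trans (Ideal.height_mono ?_)
  rw [hc2, formIdeal_span]
  intro f hf
  rw [Ideal.mem_comap] at hf
  have := Fintype.ofFinite κ
  obtain ⟨h, hh⟩ := Ideal.mem_span_range_iff_exists_fun.mp hf
  -- Polynomials over the residue field lift to R[T] after multiplication by a denominator outside
  -- p.
  have hsurj : ∀ g : MvPolynomial τ p.ResidueField, ∃ s : R, s ∉ p ∧ ∃ g' : MvPolynomial τ R,
      MvPolynomial.map (algebraMap R p.ResidueField) g' =
        MvPolynomial.C (algebraMap R p.ResidueField s) * g := by
    intro g
    induction g using MvPolynomial.induction_on' with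
    | monomial m a =>
      obtain ⟨x, y, hy, hxy⟩ := IsFractionRing.div_surjective (A := R ⧸ p) a
      obtain ⟨x, rfl⟩ := Ideal.Quotient.mk_surjective x
      obtain ⟨y, rfl⟩ := Ideal.Quotient.mk_surjective y
      have hy0 : (Ideal.Quotient.mk p y) ≠ 0 := nonZeroDivisors.ne_zero hy
      have hyp : y ∉ p := fun h => hy0 (Ideal.Quotient.eq_zero_iff_mem.mpr h)
      have e : ∀ z : R, algebraMap (R ⧸ p) p.ResidueField (Ideal.Quotient.mk p z) =
          algebraMap R p.ResidueField z := fun z => rfl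
      rw [e, e] at hxy
      have hy1 : algebraMap R p.ResidueField y ≠ 0 := fun h =>
        hyp (Ideal.algebraMap_residueField_eq_zero.mp h)
      refine ⟨y, hyp, MvPolynomial.monomial m x, ?_⟩
      rw [MvPolynomial.map_monomial, MvPolynomial.C_mul_monomial, ← hxy, mul_div_cancel₀ _ hy1]
    | add f g hf hg =>
      obtain ⟨s, hs, f', hf'⟩ := hf
      obtain ⟨t, ht, g', hg'⟩ := hg
      refine ⟨s * t, fun h => (Ideal.IsPrime.mem_or_mem inferInstance h).elim hs ht,
        MvPolynomial.C t * f' + MvPolynomial.C s * g', ?_⟩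
      rw [map_add, map_mul, map_mul, hf', hg', MvPolynomial.map_C, MvPolynomial.map_C, map_mul,
        map_mul]
      ring
  choose s hs h' hh' using fun j => hsurj (h j)
  have hprod : (∏ j, s j) ∉ p := by
    intro hmem
    obtain ⟨j, -, hj⟩ := (Ideal.IsPrime.prod_mem_iff).mp hmem
    exact hs j hj
  classical
  -- With all denominators cleared, a multiple of f minus a combination of the forms reduces to 0
  -- modulo p. Its coefficients therefore lie in p ⊆ Q, and the multiplier of f is outside p.
  let g : MvPolynomial τ R := MvPolynomial.C (∏ j, s j) * f -
    ∑ j, MvPolynomial.C (∏ j' ∈ Finset.univ.erase j, s j') * h' j *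
      (∑ i, MvPolynomial.C (φ i j) * MvPolynomial.X i)
  have hg : MvPolynomial.map (algebraMap R p.ResidueField) g = 0 := by
    simp only [g, map_sub, map_sum (MvPolynomial.map (algebraMap R p.ResidueField)), map_mul, hh',
      MvPolynomial.map_C]
    have hL := hmapL
    simp only [map_sum (MvPolynomial.map (algebraMap R p.ResidueField)), map_mul,
      MvPolynomial.map_C] at hL
    simp only [hL]
    rw [← hh, Finset.mul_sum, sub_eq_zero]
    refine Finset.sum_congr rfl fun j _ => ?_
    rw [← Finset.mul_prod_erase Finset.univ s (Finset.mem_univ j), map_mul, map_mul]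
    ring
  have hgQ : g ∈ Q := by
    rw [MvPolynomial.as_sum g]
    refine Ideal.sum_mem _ fun m _ => ?_
    have hm : g.coeff m ∈ p := by
      rw [← Ideal.algebraMap_residueField_eq_zero, ← MvPolynomial.coeff_map, hg,
        MvPolynomial.coeff_zero]
    rw [← mul_one (g.coeff m), ← MvPolynomial.C_mul_monomial]
    refine Ideal.mul_mem_right _ _ ?_
    rw [← hp, Ideal.mem_comap] at hm
    exact hm
  have h2 : MvPolynomial.C (∏ j, s j) * f ∈ Q := by
    have := Ideal.add_mem _ hgQ (Ideal.sum_mem Q (t := Finset.univ)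
      (f := fun j => MvPolynomial.C (∏ j' ∈ Finset.univ.erase j, s j') * h' j *
      (∑ i, MvPolynomial.C (φ i j) * MvPolynomial.X i)) fun j _ =>
        Ideal.mul_mem_left _ _ (hQ j))
    simpa [g] using this
  rcases Ideal.IsPrime.mem_or_mem inferInstance h2 with h3 | h3
  · exact absurd (by rw [← hp]; exact h3) hprod
  · exact h3

end LinearForms

/-! ### Rank of the presentation matrix versus number of local generators -/

section RankBound

variable {R : Type*} [CommRing R] [IsDomain R] {m : ℕ} {κ : Type*} [Fintype κ]

/-- If the localization at `p` of the ideal generated by `f_0, …, f_{m-1}` is generated by `μ`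
elements, then the presentation matrix `φ` has rank at least `m - μ` modulo `p`. -/
lemma le_rank_add_ncard (f : Fin m → R) (φ : Matrix (Fin m) κ R)
    (hpres : ∀ v : Fin m → R, ∑ i, v i * f i = 0 ↔ ∃ w : κ → R, φ.mulVec w = v)
    (p : Ideal R) [p.IsPrime] (s : Set (Localization.AtPrime p)) (hs : s.Finite)
    (hgen : (Ideal.span (Set.range f)).map (algebraMap R (Localization.AtPrime p)) =
      Ideal.span s) :
    m ≤ Module.finrank p.ResidueField (Submodule.span p.ResidueField
      (Set.range fun j i => algebraMap R p.ResidueField (φ i j))) + s.ncard := by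
  classical
  let A := Localization.AtPrime p
  let K := p.ResidueField
  have := hs.fintype
  rw [Ideal.map_span, ← Set.range_comp] at hgen
  have h1 : ∀ i, ∃ c : s → A, ∑ g, c g * (g : A) = algebraMap R A (f i) := by
    intro i
    have : algebraMap R A (f i) ∈ Ideal.span (Set.range ((↑) : s → A)) := by
      rw [Subtype.range_coe, ← hgen]
      exact Ideal.subset_span ⟨i, rfl⟩
    exact Ideal.mem_span_range_iff_exists_fun.mp this
  have h2 : ∀ g : s, ∃ h : Fin m → A, ∑ i, h i * algebraMap R A (f i) = g := by
    intro g
    have : (g : A) ∈ Ideal.span (Set.range (algebraMap R A ∘ f)) := by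
      rw [hgen]; exact Ideal.subset_span g.2
    exact Ideal.mem_span_range_iff_exists_fun.mp this
  choose C hC using h1
  choose H hH using h2
  set V := Submodule.span K (Set.range fun j i => algebraMap R K (φ i j))
  let W := Submodule.span K (Set.range fun (g : s) i => algebraMap A K (H g i))
  have hinj : Function.Injective (algebraMap R A) :=
    IsLocalization.injective A p.primeCompl_le_nonZeroDivisors
  -- A relation over R_p becomes one over R after clearing denominators, hence a combination of
  -- columns of φ; modulo p it lies in the column space V.
  have key : ∀ v : Fin m → A, ∑ i, v i * algebraMap R A (f i) = 0 →
      (fun i => algebraMap A K (v i)) ∈ V := by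
    intro v hv
    obtain ⟨b, hb⟩ := IsLocalization.exist_integer_multiples p.primeCompl Finset.univ v
    choose v' hv' using fun i => hb i (Finset.mem_univ i)
    have h3 : ∑ i, v' i * f i = 0 := by
      apply hinj
      rw [map_sum, map_zero]
      simp only [map_mul, hv']
      simp only [Algebra.smul_def, mul_assoc]
      rw [← Finset.mul_sum, hv, mul_zero]
    obtain ⟨w, hw⟩ := (hpres v').mp h3
    have hb0 : algebraMap R K b ≠ 0 := fun h => b.2 (Ideal.algebraMap_residueField_eq_zero.mp h)
    have h4 : algebraMap R K b • (fun i => algebraMap A K (v i)) ∈ V := by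
      have : algebraMap R K b • (fun i => algebraMap A K (v i)) =
          ∑ j, algebraMap R K (w j) • (fun i => algebraMap R K (φ i j)) := by
        ext i
        rw [Finset.sum_apply]
        simp only [Pi.smul_apply, smul_eq_mul]
        have h5 : algebraMap R K (v' i) = algebraMap R K b * algebraMap A K (v i) := by
          rw [IsScalarTower.algebraMap_apply R A K (v' i), hv', Algebra.smul_def, map_mul,
            ← IsScalarTower.algebraMap_apply]
        rw [← h5, ← hw, Matrix.mulVec, dotProduct, map_sum]
        exact Finset.sum_congr rfl fun j _ => by rw [map_mul, mul_comm]
      rw [this]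
      exact Submodule.sum_mem _ fun j _ => Submodule.smul_mem _ _ (Submodule.subset_span ⟨j, rfl⟩)
    exact (Submodule.smul_mem_iff _ hb0).mp h4
  -- Writing f_i through the generators in s and those back through the f's gives a relation e_i - ∑
  -- C H; hence V together with the vectors H_g, at most `s.ncard` of them, spans K^m.
  have htop : (⊤ : Submodule K (Fin m → K)) ≤ V ⊔ W := by
    rw [← (Pi.basisFun K (Fin m)).span_eq, Submodule.span_le]
    rintro _ ⟨i, rfl⟩
    have h3 := key (fun i' => (Pi.single i 1 : Fin m → A) i' - ∑ g, C i g * H g i') (by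
      simp only [sub_mul, Finset.sum_sub_distrib, Finset.sum_mul]
      rw [Finset.sum_comm]
      simp only [mul_assoc, ← Finset.mul_sum, hH, hC]
      simp [Pi.single_apply])
    have h4 : (Pi.basisFun K (Fin m) i) =
        (fun i' => algebraMap A K ((Pi.single i 1 : Fin m → A) i' - ∑ g, C i g * H g i')) +
        ∑ g, algebraMap A K (C i g) • (fun i' => algebraMap A K (H g i')) := by
      ext i'
      simp only [Pi.basisFun_apply, map_sub, map_sum, map_mul, Pi.add_apply, Finset.sum_apply,
        Pi.smul_apply, smul_eq_mul, sub_add_cancel, Pi.single_apply]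
      split_ifs <;> simp
    rw [SetLike.mem_coe, h4]
    exact Submodule.add_mem_sup h3 (Submodule.sum_mem _ fun g _ =>
      Submodule.smul_mem _ _ (Submodule.subset_span ⟨g, rfl⟩))
  have h5 := Submodule.finrank_mono htop
  rw [finrank_top, Module.finrank_fin_fun] at h5
  refine h5.trans ((Submodule.finrank_add_le_finrank_add_finrank V W).trans ?_)
  gcongr
  refine (finrank_range_le_card _).trans ?_
  rw [Set.ncard_eq_toFinset_card', Set.toFinset_card]

end RankBound

/-! ### The ideal of the Koszul forms has height at least n -/

section KoszulForms

variable {k : Type*} [Field k] {n : ℕ}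

lemma le_height_maxIdeal [(maxIdeal k n).IsPrime] : (n : ℕ∞) ≤ (maxIdeal k n).height := by
  have := length_le_height_of_isWeaklyRegular
    (isWeaklyRegular_X_pow (A := k) (List.finRange n) (List.nodup_finRange n) 1) (maxIdeal k n) (by
      intro r hr
      obtain ⟨i, -, rfl⟩ := List.mem_map.mp hr
      rw [pow_one]
      exact Ideal.subset_span ⟨i, rfl⟩)
  simpa using this

/-- Three cases. For p = 𝔪 the height alone is at least n. For other p ⊇ I, μ(I_p) ≤ ht p and rank ≥
n + 1 - μ(I_p) even give n + 1. If p does not contain I, then I_p is the unit ideal with one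
generator and the rank is at least n. -/
lemma le_height_add_rank (f : Fin (n + 1) → RingR k n)
    (φ : Matrix (Fin (n + 1)) (Fin n) (RingR k n))
    (hpres : ∀ v : Fin (n + 1) → RingR k n,
      ∑ i, v i * f i = 0 ↔ ∃ w : Fin n → RingR k n, φ.mulVec w = v)
    (hG : ∀ (p : Ideal (RingR k n)) [p.IsPrime], idealI f ≤ p → p ≠ maxIdeal k n →
      ((((idealI f).map (algebraMap (RingR k n)
        (Localization.AtPrime p))).spanFinrank : ℕ) : WithBot ℕ∞) ≤
          ringKrullDim (Localization.AtPrime p))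
    (p : Ideal (RingR k n)) [p.IsPrime] :
    (n : ℕ∞) ≤ p.height + (Module.finrank p.ResidueField (Submodule.span p.ResidueField
      (Set.range fun j i => algebraMap (RingR k n) p.ResidueField (φ i j))) : ℕ) := by
  by_cases hpm : p = maxIdeal k n
  · subst hpm
    exact le_height_maxIdeal.trans le_self_add
  by_cases hIp : idealI f ≤ p
  · let Ip := (idealI f).map (algebraMap (RingR k n) (Localization.AtPrime p))
    have hfg : Ip.FG := IsNoetherian.noetherian _
    have h1 := le_rank_add_ncard f φ hpres p (Submodule.generators Ip)
      (Submodule.FG.finite_generators hfg) (Submodule.span_generators Ip).symm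
    rw [Submodule.FG.generators_ncard hfg] at h1
    have h2 := hG p hIp hpm
    rw [IsLocalization.AtPrime.ringKrullDim_eq_height p (Localization.AtPrime p)] at h2
    have h3 : ((Ip.spanFinrank : ℕ) : ℕ∞) ≤ p.height := by exact_mod_cast h2
    calc (n : ℕ∞) ≤ ((n + 1 : ℕ) : ℕ∞) := by exact_mod_cast Nat.le_succ n
      _ ≤ _ := Nat.cast_le.mpr h1
      _ = _ + (Ip.spanFinrank : ℕ∞) := by push_cast; rfl
      _ ≤ _ := by rw [add_comm]; gcongr
  · have h1 := le_rank_add_ncard f φ hpres p {1} (Set.finite_singleton _) (by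
      rw [Ideal.span_singleton_one]
      obtain ⟨x, hx, hxp⟩ := Set.not_subset.mp hIp
      exact Ideal.eq_top_of_isUnit_mem _ (Ideal.mem_map_of_mem _ hx)
        (IsLocalization.map_units _ (⟨x, hxp⟩ : p.primeCompl)))
    rw [Set.ncard_singleton, Nat.add_le_add_iff_right] at h1
    exact (Nat.cast_le.mpr h1).trans le_add_self

lemma commAlgEquiv_koszulForm (φ : Matrix (Fin (n + 1)) (Fin n) (RingR k n)) (j : Fin n) :
    (MvPolynomial.commAlgEquiv k (Fin n) (Fin (n + 1))) (koszulForm φ j) =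
      ∑ i, MvPolynomial.C (φ i j) * MvPolynomial.X i := by
  rw [koszulForm, map_sum]
  refine Finset.sum_congr rfl fun i _ => ?_
  rw [map_mul, MvPolynomial.commAlgEquiv_C_X, mul_comm]
  congr 1
  have : ((MvPolynomial.commAlgEquiv k (Fin n) (Fin (n + 1))).toAlgHom.toRingHom.comp
      (MvPolynomial.map MvPolynomial.C)) = (MvPolynomial.C :
        RingR k n →+* MvPolynomial (Fin (n + 1)) (RingR k n)) := by
    refine MvPolynomial.ringHom_ext ?_ ?_
    · intro r; simp
    · intro i; simp
  exact RingHom.congr_fun this (φ i j)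

/-- Exchanging the two sets of variables turns B into R[T], where the Koszul forms are linear with
coefficient matrix φ and the height bounds apply. -/
lemma le_height_of_koszulForm_mem (f : Fin (n + 1) → RingR k n)
    (φ : Matrix (Fin (n + 1)) (Fin n) (RingR k n))
    (hpres : ∀ v : Fin (n + 1) → RingR k n,
      ∑ i, v i * f i = 0 ↔ ∃ w : Fin n → RingR k n, φ.mulVec w = v)
    (hG : ∀ (p : Ideal (RingR k n)) [p.IsPrime], idealI f ≤ p → p ≠ maxIdeal k n →
      ((((idealI f).map (algebraMap (RingR k n)
        (Localization.AtPrime p))).spanFinrank : ℕ) : WithBot ℕ∞) ≤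
          ringKrullDim (Localization.AtPrime p))
    (Q : Ideal (RingB k n)) (hQ : Q.IsPrime) (hl : ∀ j, koszulForm φ j ∈ Q) :
    (n : ℕ∞) ≤ Q.height := by
  let e := (MvPolynomial.commAlgEquiv k (Fin n) (Fin (n + 1))).toRingEquiv
  let Q' : Ideal (MvPolynomial (Fin (n + 1)) (RingR k n)) := Q.comap e.symm
  have hQ' : Q'.IsPrime := Ideal.comap_isPrime _ _
  have e1 : Q'.height = Q.height := RingEquiv.height_comap e.symm Q
  rw [← e1]
  let p := Q'.comap (MvPolynomial.C : RingR k n →+* _)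
  have hp : p.IsPrime := Ideal.comap_isPrime _ _
  refine (le_height_add_rank f φ hpres hG p).trans (height_add_rank_le φ Q' ?_ p rfl)
  intro j
  rw [← commAlgEquiv_koszulForm]
  change e.symm (e (koszulForm φ j)) ∈ Q
  rw [RingEquiv.symm_apply_apply]
  exact hl j

end KoszulForms

/-! ### Bihomogeneous components in B and in its Koszul complex -/

section Bigrading

variable {k : Type*} [Field k] {n : ℕ}

/-- The component of degree `τ` in the `T`-grading of `S`. -/
def tcomp (τ : ℤ) (p : RingS k n) : RingS k n :=
  if 0 ≤ τ then MvPolynomial.homogeneousComponent τ.toNat p else 0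

lemma coeff_tcomp (τ : ℤ) (p : RingS k n) (m : Fin (n + 1) →₀ ℕ) :
    (tcomp τ p).coeff m = if (m.degree : ℤ) = τ then p.coeff m else 0 := by
  rw [tcomp]
  split_ifs with h1 h2 h2
  · rw [MvPolynomial.coeff_homogeneousComponent, if_pos (by omega)]
  · rw [MvPolynomial.coeff_homogeneousComponent, if_neg (by omega)]
  · omega
  · rw [MvPolynomial.coeff_zero]

/-- The component of bidegree `(e, τ)` of an element of `B`. -/
def bcomp (e τ : ℤ) (b : RingB k n) : RingB k n :=
  ∑ m ∈ b.support, if (m.degree : ℤ) = e then MvPolynomial.monomial m (tcomp τ (b.coeff m)) else 0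

lemma coeff_bcomp (e τ : ℤ) (b : RingB k n) (m : Fin n →₀ ℕ) :
    (bcomp e τ b).coeff m = if (m.degree : ℤ) = e then tcomp τ (b.coeff m) else 0 := by
  classical
  rw [bcomp, MvPolynomial.coeff_sum]
  by_cases hm : m ∈ b.support
  · rw [Finset.sum_eq_single m]
    · split_ifs
      · rw [MvPolynomial.coeff_monomial, if_pos rfl]
      · rw [MvPolynomial.coeff_zero]
    · intro m' _ hne
      split_ifs
      · rw [MvPolynomial.coeff_monomial, if_neg hne]
      · rw [MvPolynomial.coeff_zero]
    · exact fun h => absurd hm h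
  · rw [Finset.sum_eq_zero]
    · rw [MvPolynomial.notMem_support_iff.mp hm]
      have : tcomp τ (0 : RingS k n) = 0 := by ext; simp [coeff_tcomp]
      simp [this]
    · intro m' hm'
      have hne : m' ≠ m := by rintro rfl; exact hm hm'
      split_ifs
      · rw [MvPolynomial.coeff_monomial, if_neg hne]
      · rw [MvPolynomial.coeff_zero]

lemma coeff_coeff_bcomp (e τ : ℤ) (b : RingB k n) (m : Fin n →₀ ℕ) (m' : Fin (n + 1) →₀ ℕ) :
    ((bcomp e τ b).coeff m).coeff m' =
      if (m.degree : ℤ) = e ∧ (m'.degree : ℤ) = τ then (b.coeff m).coeff m' else 0 := by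
  rw [coeff_bcomp]
  split_ifs with h1 h2 h2
  · rw [coeff_tcomp, if_pos h2.2]
  · rw [coeff_tcomp, if_neg (fun h => h2 ⟨h1, h⟩)]
  · exact absurd h2.1 h1
  · rw [MvPolynomial.coeff_zero]

lemma ringB_ext {b b' : RingB k n} (h : ∀ m m', (b.coeff m).coeff m' = (b'.coeff m).coeff m') :
    b = b' := by
  ext m m'
  exact h m m'

lemma bcomp_add (e τ : ℤ) (b b' : RingB k n) : bcomp e τ (b + b') = bcomp e τ b + bcomp e τ b' := by
  refine ringB_ext fun m m' => ?_
  simp only [coeff_coeff_bcomp, MvPolynomial.coeff_add]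
  split_ifs <;> simp

lemma bcomp_zero (e τ : ℤ) : bcomp e τ (0 : RingB k n) = 0 := by
  refine ringB_ext fun m m' => ?_
  simp [coeff_coeff_bcomp]

lemma bcomp_sum {ι : Type*} (s : Finset ι) (e τ : ℤ) (b : ι → RingB k n) :
    bcomp e τ (∑ i ∈ s, b i) = ∑ i ∈ s, bcomp e τ (b i) :=
  map_sum (AddMonoidHom.mk' (bcomp e τ) (bcomp_add e τ)) b s

/-- `b` is homogeneous of bidegree `(e, τ)`. -/
def IsBihom (e τ : ℤ) (b : RingB k n) : Prop :=
  ∀ m m', (b.coeff m).coeff m' ≠ 0 → (m.degree : ℤ) = e ∧ (m'.degree : ℤ) = τ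

lemma isBihom_bcomp (e τ : ℤ) (b : RingB k n) : IsBihom e τ (bcomp e τ b) := by
  intro m m' h
  rw [coeff_coeff_bcomp] at h
  by_contra hc
  exact h (if_neg hc)

lemma IsBihom.bcomp_eq {e τ : ℤ} {b : RingB k n} (h : IsBihom e τ b) : bcomp e τ b = b := by
  refine ringB_ext fun m m' => ?_
  rw [coeff_coeff_bcomp]
  split_ifs with hc
  · rfl
  · by_contra h0
    exact hc (h m m' (Ne.symm h0))

lemma IsBihom.bcomp_eq_zero {e τ e' τ' : ℤ} {b : RingB k n} (h : IsBihom e τ b)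
    (hne : ¬(e = e' ∧ τ = τ')) : bcomp e' τ' b = 0 := by
  refine ringB_ext fun m m' => ?_
  rw [coeff_coeff_bcomp, MvPolynomial.coeff_zero, MvPolynomial.coeff_zero]
  split_ifs with hc
  · by_contra h0
    have := h m m' h0
    exact hne ⟨this.1.symm.trans hc.1, this.2.symm.trans hc.2⟩
  · rfl

lemma IsBihom.mul {e τ e' τ' : ℤ} {b b' : RingB k n} (h : IsBihom e τ b) (h' : IsBihom e' τ' b') :
    IsBihom (e + e') (τ + τ') (b * b') := by
  classical
  intro m m' h0
  rw [MvPolynomial.coeff_mul, MvPolynomial.coeff_sum] at h0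
  obtain ⟨p, hp, h1⟩ := Finset.exists_ne_zero_of_sum_ne_zero h0
  rw [MvPolynomial.coeff_mul] at h1
  obtain ⟨q, hq, h2⟩ := Finset.exists_ne_zero_of_sum_ne_zero h1
  obtain ⟨h3, h4⟩ := h p.1 q.1 (left_ne_zero_of_mul h2)
  obtain ⟨h5, h6⟩ := h' p.2 q.2 (right_ne_zero_of_mul h2)
  rw [Finset.HasAntidiagonal.mem_antidiagonal] at hp hq
  rw [← hp, ← hq, map_add, map_add]
  push_cast
  exact ⟨by omega, by omega⟩

lemma IsBihom.sum {ι : Type*} {s : Finset ι} {e τ : ℤ} {b : ι → RingB k n}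
    (h : ∀ i ∈ s, IsBihom e τ (b i)) : IsBihom e τ (∑ i ∈ s, b i) := by
  intro m m' h0
  rw [MvPolynomial.coeff_sum, MvPolynomial.coeff_sum] at h0
  obtain ⟨i, hi, h1⟩ := Finset.exists_ne_zero_of_sum_ne_zero h0
  exact h i hi m m' h1

lemma isBihom_monomial (m : Fin n →₀ ℕ) (m' : Fin (n + 1) →₀ ℕ) (c : k) :
    IsBihom (m.degree : ℤ) (m'.degree : ℤ)
      (MvPolynomial.monomial m (MvPolynomial.monomial m' c) : RingB k n) := by
  classical
  intro p q h
  rw [MvPolynomial.coeff_monomial] at h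
  split_ifs at h with h1
  · rw [MvPolynomial.coeff_monomial] at h
    split_ifs at h with h2
    · rw [h1, h2]; exact ⟨rfl, rfl⟩
    · exact absurd rfl h
  · simp at h

lemma ringB_induction {P : RingB k n → Prop} (hadd : ∀ b b', P b → P b' → P (b + b'))
    (hmon : ∀ m m' c, P (MvPolynomial.monomial m (MvPolynomial.monomial m' c))) (b : RingB k n) :
    P b := by
  induction b using MvPolynomial.induction_on' with
  | monomial m a =>
    induction a using MvPolynomial.induction_on' with
    | monomial m' c => exact hmon m m' c
    | add p q hp hq => rw [map_add]; exact hadd _ _ hp hq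
  | add p q hp hq => exact hadd _ _ hp hq

/-- The principle behind all reductions to components: multiplication by a bihomogeneous element
shifts components. Indices are integers, so components of negative degree are allowed and vanish. -/
lemma IsBihom.bcomp_mul {d t : ℤ} {l : RingB k n} (hl : IsBihom d t l) (e τ : ℤ) (b : RingB k n) :
    bcomp (e + d) (τ + t) (l * b) = l * bcomp e τ b := by
  induction b using ringB_induction with
  | hadd b b' h h' => rw [mul_add, bcomp_add, bcomp_add, h, h', mul_add]
  | hmon m m' c =>
    have h1 := isBihom_monomial m m' c
    by_cases hc : (m.degree : ℤ) = e ∧ (m'.degree : ℤ) = τ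
    · obtain ⟨rfl, rfl⟩ := hc
      rw [h1.bcomp_eq, add_comm _ d, add_comm _ t, (hl.mul h1).bcomp_eq]
    · rw [h1.bcomp_eq_zero hc, mul_zero, (hl.mul h1).bcomp_eq_zero (by omega)]

lemma IsBihom.neg {e τ : ℤ} {b : RingB k n} (h : IsBihom e τ b) : IsBihom e τ (-b) := by
  intro m m' h0
  refine h m m' fun h1 => h0 ?_
  rw [MvPolynomial.coeff_neg, MvPolynomial.coeff_neg, h1, neg_zero]

lemma IsBihom.mul_ksign {e τ : ℤ} {b : RingB k n} (h : IsBihom e τ b) (j : Fin n)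
    (J : Finset (Fin n)) : IsBihom e τ (b * ksign (RingB k n) j J) := by
  rw [ksign]
  rcases neg_one_pow_eq_or (RingB k n) (J.filter (· < j)).card with h1 | h1
  · rwa [h1, mul_one]
  · rw [h1, mul_neg_one]; exact h.neg

lemma bcomp_zero_zero (s : RingB k n) :
    bcomp 0 0 s = MvPolynomial.C (MvPolynomial.C
      (MvPolynomial.constantCoeff (MvPolynomial.constantCoeff s))) := by
  classical
  refine ringB_ext fun m m' => ?_
  rw [coeff_coeff_bcomp, MvPolynomial.coeff_C]
  by_cases hm : 0 = m
  · subst hm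
    rw [if_pos rfl, MvPolynomial.coeff_C]
    by_cases hm' : 0 = m'
    · subst hm'
      simp [MvPolynomial.constantCoeff_eq]
    · rw [if_neg hm', if_neg]
      rintro ⟨-, h⟩
      exact hm' ((Finsupp.degree_eq_zero_iff m').mp (by exact_mod_cast h)).symm
  · rw [if_neg hm, if_neg, MvPolynomial.coeff_zero]
    rintro ⟨h, -⟩
    exact hm ((Finsupp.degree_eq_zero_iff m).mp (by exact_mod_cast h)).symm

lemma isBihom_koszulForm {φ : Matrix (Fin (n + 1)) (Fin n) (RingR k n)} {d : Fin n → ℕ}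
    (hφ : ∀ i j, (φ i j).IsHomogeneous (d j)) (j : Fin n) :
    IsBihom (d j) 1 (koszulForm φ j) := by
  classical
  refine IsBihom.sum fun i _ => ?_
  have h1 : IsBihom 0 1 (MvPolynomial.C (MvPolynomial.X i) : RingB k n) := by
    have := isBihom_monomial (k := k) (0 : Fin n →₀ ℕ) (Finsupp.single i 1) 1
    rw [map_zero, Finsupp.degree_single] at this
    exact this
  have h2 : IsBihom (d j) 0 (MvPolynomial.map MvPolynomial.C (φ i j) : RingB k n) := by
    intro m m' h
    rw [MvPolynomial.coeff_map, MvPolynomial.coeff_C] at h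
    split_ifs at h with h3
    · subst h3
      refine ⟨?_, by simp⟩
      have h4 := hφ i j h
      have h5 : m.degree = Finsupp.weight (1 : Fin n → ℕ) m := by
        rw [Finsupp.degree_eq_weight_one]; rfl
      rw [h5]
      exact_mod_cast h4
    · exact absurd rfl h
  simpa using h1.mul h2

/-- The component of bidegree `(e, τ)` of the Koszul complex. -/
def kcomp (d : Fin n → ℕ) (e τ : ℤ) (z : Finset (Fin n) → RingB k n) : Finset (Fin n) → RingB k n :=
  fun J => bcomp (e - ∑ j ∈ J, (d j : ℤ)) (τ - J.card) (z J)

/-- Giving e_J the bidegree (∑_{j ∈ J} d_j, |J|) makes the differential homogeneous of bidegree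
zero. -/
lemma koszulD_kcomp {φ : Matrix (Fin (n + 1)) (Fin n) (RingR k n)} {d : Fin n → ℕ}
    (hφ : ∀ i j, (φ i j).IsHomogeneous (d j)) (e τ : ℤ) (z : Finset (Fin n) → RingB k n) :
    koszulD (koszulForm φ) (kcomp d e τ z) = kcomp d e τ (koszulD (koszulForm φ) z) := by
  ext1 J
  rw [kcomp, koszulD_apply, koszulD_apply, bcomp_sum]
  refine Finset.sum_congr rfl fun j _ => ?_
  split_ifs with hj
  · rw [bcomp_zero]
  · have h1 := ((isBihom_koszulForm hφ j).mul_ksign j J).bcomp_mul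
      (e - ∑ i ∈ insert j J, (d i : ℤ)) (τ - (insert j J).card) (z (insert j J))
    rw [smul_eq_mul, kcomp, ← h1, smul_eq_mul]
    congr 1
    · rw [Finset.sum_insert hj]; ring
    · rw [Finset.card_insert_of_notMem hj]; push_cast; ring

lemma exists_eq_sum_kcomp (d : Fin n → ℕ) (z : Finset (Fin n) → RingB k n) :
    ∃ E T : ℕ, z = ∑ e ∈ Finset.range E, ∑ τ ∈ Finset.range T, kcomp d e τ z := by
  classical
  let E := (Finset.univ.sup fun J => ((z J).support.sup fun m => m.degree) + ∑ j ∈ J, d j) + 1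
  let T := (Finset.univ.sup fun J => (((z J).support.sup fun m =>
    ((z J).coeff m).support.sup fun m' => m'.degree) + J.card)) + 1
  refine ⟨E, T, ?_⟩
  ext1 J
  rw [Finset.sum_apply]
  refine ringB_ext fun m m' => ?_
  simp only [Finset.sum_apply, MvPolynomial.coeff_sum, kcomp, coeff_coeff_bcomp]
  by_cases h0 : ((z J).coeff m).coeff m' = 0
  · simp [h0]
  have hm : m ∈ (z J).support := by
    rw [MvPolynomial.mem_support_iff]; rintro h; rw [h] at h0; simp at h0
  have hm' : m' ∈ ((z J).coeff m).support := MvPolynomial.mem_support_iff.mpr h0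
  have hE : m.degree + ∑ j ∈ J, d j ∈ Finset.range E := by
    rw [Finset.mem_range, Nat.lt_succ_iff]
    refine le_trans ?_ (Finset.le_sup (f := fun J => ((z J).support.sup fun m => m.degree) +
      ∑ j ∈ J, d j) (Finset.mem_univ J))
    exact Nat.add_le_add_right (Finset.le_sup (f := fun m => m.degree) hm) _
  have hT : m'.degree + J.card ∈ Finset.range T := by
    rw [Finset.mem_range, Nat.lt_succ_iff]
    refine le_trans ?_ (Finset.le_sup (f := fun J => (((z J).support.sup fun m =>
      ((z J).coeff m).support.sup fun m' => m'.degree) + J.card)) (Finset.mem_univ J))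
    refine Nat.add_le_add_right (le_trans (Finset.le_sup (f := fun m' => m'.degree) hm') ?_) _
    exact Finset.le_sup (f := fun m => ((z J).coeff m).support.sup fun m' => m'.degree) hm
  rw [Finset.sum_eq_single_of_mem _ hE, Finset.sum_eq_single_of_mem _ hT]
  · rw [if_pos]
    push_cast
    constructor <;> ring
  · intro τ _ hτ
    rw [if_neg]
    rintro ⟨-, h⟩
    exact hτ (by omega)
  · intro e _ he
    refine Finset.sum_eq_zero fun τ _ => if_neg ?_
    rintro ⟨h, -⟩
    refine he ?_
    have : ((∑ j ∈ J, d j : ℕ) : ℤ) = ∑ j ∈ J, (d j : ℤ) := by push_cast; rfl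
    omega

end Bigrading

/-! ### Acyclicity of the Koszul complex over B -/

section Acyclic

open RingTheory.Sequence

variable {k : Type*} [Field k] {n : ℕ}

/-- The maximal ideal `(x_1, …, x_n, T_0, …, T_n)` of `B`. -/
def irrelevant (k : Type*) [Field k] (n : ℕ) : Ideal (RingB k n) :=
  RingHom.ker ((MvPolynomial.constantCoeff (σ := Fin (n + 1)) (R := k)).comp
    (MvPolynomial.constantCoeff (σ := Fin n)))

instance : (irrelevant k n).IsPrime := RingHom.ker_isPrime _

/-- The variables of `B`. -/
def varList (k : Type*) [Field k] (n : ℕ) : List (RingB k n) :=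
  ((Finset.univ : Finset (Fin n ⊕ Fin (n + 1))).toList.map
    (fun i => (MvPolynomial.X i : MvPolynomial (Fin n ⊕ Fin (n + 1)) k) ^ 1)).map
    (MvPolynomial.sumRingEquiv k (Fin n) (Fin (n + 1)))

lemma ofList_map_ringEquiv {A A' : Type*} [CommRing A] [CommRing A'] (e : A ≃+* A')
    (L : List A) : Ideal.ofList (L.map e) = (Ideal.ofList L).map (e : A →+* A') :=
  (Ideal.map_ofList (e : A →+* A') L).symm

lemma ofList_varList : Ideal.ofList (varList k n) = irrelevant k n := by
  let e := MvPolynomial.sumRingEquiv k (Fin n) (Fin (n + 1))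
  have h1 : Ideal.ofList ((Finset.univ : Finset (Fin n ⊕ Fin (n + 1))).toList.map
      (fun i => (MvPolynomial.X i : MvPolynomial (Fin n ⊕ Fin (n + 1)) k) ^ 1)) =
      RingHom.ker (MvPolynomial.constantCoeff (σ := Fin n ⊕ Fin (n + 1)) (R := k)) := by
    ext f
    have : Ideal.ofList ((Finset.univ : Finset (Fin n ⊕ Fin (n + 1))).toList.map
      (fun i => (MvPolynomial.X i : MvPolynomial (Fin n ⊕ Fin (n + 1)) k) ^ 1)) =
      Ideal.span (MvPolynomial.X '' Set.univ) := by
      rw [Ideal.ofList]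
      congr 1
      ext g
      simp
    rw [this, MvPolynomial.mem_ideal_span_X_image, RingHom.mem_ker,
      MvPolynomial.constantCoeff_eq]
    constructor
    · intro h
      by_contra h0
      obtain ⟨i, -, hi⟩ := h 0 (MvPolynomial.mem_support_iff.mpr h0)
      exact hi rfl
    · intro h m hm
      by_contra hc
      push Not at hc
      have : m = 0 := by ext i; exact hc i (Set.mem_univ i)
      rw [this] at hm
      exact MvPolynomial.mem_support_iff.mp hm h
  have h2 : ((MvPolynomial.constantCoeff (σ := Fin (n + 1)) (R := k)).comp
      (MvPolynomial.constantCoeff (σ := Fin n))).comp (e : _ →+* RingB k n) =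
      MvPolynomial.constantCoeff (σ := Fin n ⊕ Fin (n + 1)) (R := k) := by
    refine MvPolynomial.ringHom_ext ?_ ?_
    · intro r; simp [e]
    · rintro (i | i) <;> simp [e]
  rw [varList, ofList_map_ringEquiv, h1, ← h2]
  ext f
  rw [irrelevant, RingHom.mem_ker]
  constructor
  · intro hf
    obtain ⟨g, hg, rfl⟩ := (Ideal.mem_map_iff_of_surjective _ e.surjective).mp hf
    exact hg
  · intro hf
    refine (Ideal.mem_map_iff_of_surjective _ e.surjective).mpr ⟨e.symm f, ?_, e.apply_symm_apply f⟩
    rw [RingHom.mem_ker]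
    change ((MvPolynomial.constantCoeff (σ := Fin (n + 1)) (R := k)).comp
      (MvPolynomial.constantCoeff (σ := Fin n))) (e (e.symm f)) = 0
    rw [e.apply_symm_apply]
    exact hf

lemma isWeaklyRegular_varList (s : ℕ) :
    IsWeaklyRegular (RingB k n) ((varList k n).map (· ^ s)) := by
  have := isWeaklyRegular_map_ringEquiv (MvPolynomial.sumRingEquiv k (Fin n) (Fin (n + 1)))
    (isWeaklyRegular_X_pow (A := k) (Finset.univ : Finset (Fin n ⊕ Fin (n + 1))).toList
      (Finset.nodup_toList _) s)
  rw [varList]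
  simp only [List.map_map] at this ⊢
  refine (congrArg (fun F => IsWeaklyRegular (RingB k n) (List.map F
    (Finset.univ : Finset (Fin n ⊕ Fin (n + 1))).toList)) (funext fun i => ?_)).mp this
  simp only [Function.comp_apply, pow_one, map_pow]

/-- The Koszul complex of `l_1, …, l_n` over `B` is acyclic. -/
theorem koszulExact_koszulForm (f : Fin (n + 1) → RingR k n) (d : Fin n → ℕ)
    (φ : Matrix (Fin (n + 1)) (Fin n) (RingR k n))
    (hφ : ∀ i j, (φ i j).IsHomogeneous (d j))
    (hpres : ∀ v : Fin (n + 1) → RingR k n,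
      ∑ i, v i * f i = 0 ↔ ∃ w : Fin n → RingR k n, φ.mulVec w = v)
    (hG : ∀ (p : Ideal (RingR k n)) [p.IsPrime], idealI f ≤ p → p ≠ maxIdeal k n →
      ((((idealI f).map (algebraMap (RingR k n)
        (Localization.AtPrime p))).spanFinrank : ℕ) : WithBot ℕ∞) ≤
          ringKrullDim (Localization.AtPrime p))
    (t : ℕ) (ht : 1 ≤ t) : KoszulExact (koszulForm φ) (RingB k n) t := by
  refine KoszulExact.of_exists fun z hz h0 => ?_
  obtain ⟨E, T, hsum⟩ := exists_eq_sum_kcomp d z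
  suffices h : ∀ e τ : ℤ, kcomp d e τ z ∈ LinearMap.range (koszulD (koszulForm φ)) by
    have : z ∈ LinearMap.range (koszulD (koszulForm φ)) := by
      rw [hsum]
      exact Submodule.sum_mem _ fun e _ => Submodule.sum_mem _ fun τ _ => h e τ
    exact this
  intro e τ
  -- Localization at the ideal of all variables shows that s times the component is a boundary,
  -- where s has nonzero constant term s0.
  obtain ⟨s, hs, w, hw⟩ := exists_smul_koszulD (irrelevant k n) (varList k n) ofList_varList
    isWeaklyRegular_varList (koszulForm φ) (fun j => by
      rw [irrelevant, RingHom.mem_ker, koszulForm, map_sum]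
      exact Finset.sum_eq_zero fun i _ => by simp)
    (le_height_of_koszulForm_mem f φ hpres hG) ht (kcomp d e τ z)
    (fun J hJ => by rw [kcomp, hz J hJ, bcomp_zero]) (by
      rw [koszulD_kcomp hφ, h0]
      ext1 J
      exact bcomp_zero _ _)
  set s0 := MvPolynomial.constantCoeff (MvPolynomial.constantCoeff s) with hs0
  have hs0' : s0 ≠ 0 := fun h => hs h
  -- On a bihomogeneous cycle, the component of the same bidegree of multiplication by s is
  -- multiplication by s0, a unit of the field.
  have h1 : koszulD (koszulForm φ) (kcomp d e τ w) =
      (MvPolynomial.C (MvPolynomial.C s0) : RingB k n) • kcomp d e τ z := by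
    rw [koszulD_kcomp hφ, hw]
    ext1 J
    rw [kcomp, Pi.smul_apply, Pi.smul_apply, smul_eq_mul, smul_eq_mul, mul_comm s]
    have := (isBihom_bcomp (e - ∑ j ∈ J, (d j : ℤ)) (τ - J.card) (z J)).bcomp_mul 0 0 s
    rw [zero_add, zero_add, bcomp_zero_zero] at this
    rw [kcomp, this, mul_comm]
  refine ⟨(MvPolynomial.C (MvPolynomial.C s0⁻¹) : RingB k n) • kcomp d e τ w, ?_⟩
  rw [map_smul, h1, smul_smul, ← map_mul, ← map_mul, inv_mul_cancel₀ hs0', map_one, map_one,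
    one_smul]

end Acyclic

/-! ### Homogeneous elements of S -/

section DegS

variable {k : Type*} [Field k] {n : ℕ}

lemma mem_degS_iff {j : ℤ} {p : RingS k n} :
    p ∈ degS k n j ↔ ∀ m, p.coeff m ≠ 0 → (m.degree : ℤ) = j := by
  simp only [degS, Set.mem_ofPred_eq, MvPolynomial.mem_support_iff]

lemma zero_mem_degS (j : ℤ) : (0 : RingS k n) ∈ degS k n j :=
  mem_degS_iff.mpr fun m h => absurd (MvPolynomial.coeff_zero m) h

lemma add_mem_degS {j : ℤ} {p q : RingS k n} (hp : p ∈ degS k n j) (hq : q ∈ degS k n j) :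
    p + q ∈ degS k n j := by
  rw [mem_degS_iff] at *
  intro m h
  by_cases h1 : p.coeff m = 0
  · by_cases h2 : q.coeff m = 0
    · rw [MvPolynomial.coeff_add, h1, h2, add_zero] at h
      exact absurd rfl h
    · exact hq m h2
  · exact hp m h1

lemma neg_mem_degS {j : ℤ} {p : RingS k n} (hp : p ∈ degS k n j) : -p ∈ degS k n j := by
  rw [mem_degS_iff] at *
  intro m h
  exact hp m fun h1 => h (by rw [MvPolynomial.coeff_neg, h1, neg_zero])

lemma sum_mem_degS {ι : Type*} {s : Finset ι} {j : ℤ} {p : ι → RingS k n}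
    (hp : ∀ i ∈ s, p i ∈ degS k n j) : ∑ i ∈ s, p i ∈ degS k n j := by
  classical
  induction s using Finset.induction_on with
  | empty => exact zero_mem_degS j
  | insert a s ha ih =>
    rw [Finset.sum_insert ha]
    exact add_mem_degS (hp a (Finset.mem_insert_self _ _))
      (ih fun i hi => hp i (Finset.mem_insert_of_mem hi))

lemma mul_mem_degS {i j : ℤ} {p q : RingS k n} (hp : p ∈ degS k n i) (hq : q ∈ degS k n j) :
    p * q ∈ degS k n (i + j) := by
  classical
  rw [mem_degS_iff] at *
  intro m h
  rw [MvPolynomial.coeff_mul] at h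
  obtain ⟨x, hx, h1⟩ := Finset.exists_ne_zero_of_sum_ne_zero h
  rw [Finset.HasAntidiagonal.mem_antidiagonal] at hx
  rw [← hx, map_add, Nat.cast_add, hp _ (left_ne_zero_of_mul h1), hq _ (right_ne_zero_of_mul h1)]

lemma C_mem_degS (a : k) : (MvPolynomial.C a : RingS k n) ∈ degS k n 0 := by
  classical
  rw [mem_degS_iff]
  intro m h
  rw [MvPolynomial.coeff_C] at h
  split_ifs at h with h1
  · rw [← h1]; simp
  · exact absurd rfl h

lemma one_mem_degS : (1 : RingS k n) ∈ degS k n 0 := by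
  rw [← map_one MvPolynomial.C]; exact C_mem_degS 1

lemma neg_one_pow_mul_mem_degS {j : ℤ} {p : RingS k n} (e : ℕ) (hp : p ∈ degS k n j) :
    (-1) ^ e * p ∈ degS k n j := by
  rcases neg_one_pow_eq_or (RingS k n) e with h | h
  · rwa [h, one_mul]
  · rw [h, neg_one_mul]; exact neg_mem_degS hp

lemma IsBihom.coeff_mem_degS {e τ : ℤ} {b : RingB k n} (h : IsBihom e τ b) (m : Fin n →₀ ℕ) :
    b.coeff m ∈ degS k n τ :=
  mem_degS_iff.mpr fun m' h' => (h m m' h').2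

lemma IsBihom.degree_eq {e τ : ℤ} {b : RingB k n} (h : IsBihom e τ b) {m : Fin n →₀ ℕ}
    (hm : b.coeff m ≠ 0) : (m.degree : ℤ) = e := by
  obtain ⟨m', hm'⟩ := MvPolynomial.ne_zero_iff.mp hm
  exact (h m m' hm').1

lemma isHomogeneous_of_coeff {σ A : Type*} [CommRing A] {b : MvPolynomial σ A} {e : ℕ}
    (h : ∀ m, b.coeff m ≠ 0 → m.degree = e) : b.IsHomogeneous e := by
  intro m hm
  rw [← h m hm, Finsupp.degree_eq_weight_one]
  rfl

lemma degree_eq_of_isHomogeneous {σ A : Type*} [CommRing A] {b : MvPolynomial σ A} {e : ℕ}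
    (h : b.IsHomogeneous e) {m : σ →₀ ℕ} (hm : b.coeff m ≠ 0) : m.degree = e := by
  have := h hm
  rw [← this, Finsupp.degree_eq_weight_one]
  rfl

end DegS

/-! ### The symmetric algebra as the quotient of B by the Koszul forms -/

section Presentation

variable {k : Type*} [Field k] {n : ℕ} (f : Fin (n + 1) → RingR k n)
  (φ : Matrix (Fin (n + 1)) (Fin n) (RingR k n))

lemma coordHom_X (i : Fin (n + 1)) : coordHom f (MvPolynomial.X i) = symGen f i := by
  simp [coordHom]

lemma coordHom_C (a : k) :
    coordHom f (MvPolynomial.C a) = algebraMap (RingR k n) (SymI f) (MvPolynomial.C a) := by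
  simp [coordHom]

lemma presMap_X (j : Fin n) :
    presMap f (MvPolynomial.X j) = algebraMap (RingR k n) (SymI f) (MvPolynomial.X j) := by
  simp [presMap]

lemma presMap_C (s : RingS k n) : presMap f (MvPolynomial.C s) = coordHom f s :=
  MvPolynomial.aeval_C _ _

lemma presMap_map_C (r : RingR k n) :
    presMap f (MvPolynomial.map MvPolynomial.C r) = algebraMap (RingR k n) (SymI f) r := by
  have : ((presMap f : RingB k n →+* SymI f).comp (MvPolynomial.map MvPolynomial.C)) =
      algebraMap (RingR k n) (SymI f) := by
    refine MvPolynomial.ringHom_ext ?_ ?_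
    · intro a
      simp only [RingHom.comp_apply, MvPolynomial.map_C]
      exact (presMap_C f _).trans (coordHom_C f a)
    · intro j
      simp only [RingHom.comp_apply, MvPolynomial.map_X]
      exact presMap_X f j
  exact congrArg (fun g => g r) this

lemma presMap_koszulForm
    (hpres : ∀ v : Fin (n + 1) → RingR k n,
      ∑ i, v i * f i = 0 ↔ ∃ w : Fin n → RingR k n, φ.mulVec w = v) (j : Fin n) :
    presMap f (koszulForm φ j) = 0 := by
  rw [koszulForm, map_sum]
  have h1 : ∀ i, presMap f (MvPolynomial.C (MvPolynomial.X i) *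
      MvPolynomial.map MvPolynomial.C (φ i j)) = SymmetricAlgebra.ι (RingR k n) (idealI f)
        (φ i j • ⟨f i, Ideal.subset_span ⟨i, rfl⟩⟩) := fun i => by
    rw [map_mul, presMap_C, coordHom_X, presMap_map_C, map_smul, Algebra.smul_def, mul_comm]
    rfl
  rw [Finset.sum_congr rfl fun i _ => h1 i]
  refine (map_sum (SymmetricAlgebra.ι (RingR k n) (idealI f)) _ _).symm.trans ?_
  have h2 : ∑ i, φ i j • (⟨f i, Ideal.subset_span ⟨i, rfl⟩⟩ : idealI f) = 0 := by
    refine Subtype.ext ?_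
    rw [AddSubmonoidClass.coe_finsetSum]
    exact (hpres fun i => φ i j).mpr ⟨Pi.single j 1, by ext1 i; simp⟩
  rw [h2]
  exact map_zero (SymmetricAlgebra.ι (RingR k n) (idealI f))

/-- On forms linear in T, π descends to I, since the relations among the f_i are combinations of the
columns of φ and those go to π(l_j) = 0. The universal property of the symmetric algebra then
factors π through `presMap`. -/
lemma eq_zero_of_presMap_eq_zero
    (hpres : ∀ v : Fin (n + 1) → RingR k n,
      ∑ i, v i * f i = 0 ↔ ∃ w : Fin n → RingR k n, φ.mulVec w = v)
    {Q : Type*} [CommRing Q] (π : RingB k n →+* Q) (hπ : ∀ j, π (koszulForm φ j) = 0)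
    {b : RingB k n} (hb : presMap f b = 0) : π b = 0 := by
  let θ : RingR k n →+* Q := π.comp (MvPolynomial.map MvPolynomial.C)
  let _ : Algebra (RingR k n) Q := θ.toAlgebra
  let p : (Fin (n + 1) → RingR k n) →ₗ[RingR k n] idealI f :=
    Fintype.linearCombination (RingR k n)
      (fun i => (⟨f i, Ideal.subset_span ⟨i, rfl⟩⟩ : idealI f))
  let q : (Fin (n + 1) → RingR k n) →ₗ[RingR k n] Q :=
    Fintype.linearCombination (RingR k n)
      (fun i => π (MvPolynomial.C (MvPolynomial.X i)))
  have hp : ∀ v, (p v : RingR k n) = ∑ i, v i * f i := fun v => by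
    change ((∑ i, v i • (⟨f i, _⟩ : idealI f) : idealI f) : RingR k n) = _
    rw [AddSubmonoidClass.coe_finsetSum]
    rfl
  have hq : ∀ v, q v = π
      (∑ i, MvPolynomial.map MvPolynomial.C (v i) * MvPolynomial.C (MvPolynomial.X i)) := fun v => by
    simp only [map_sum, map_mul]
    rfl
  have hpsurj : Function.Surjective p := by
    rintro ⟨r, hr⟩
    obtain ⟨v, hv⟩ := (Ideal.mem_span_range_iff_exists_fun).mp hr
    exact ⟨v, Subtype.ext ((hp v).trans hv)⟩
  have hker : LinearMap.ker p ≤ LinearMap.ker q := by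
    intro v hv
    have h0 : ∑ i, v i * f i = 0 := by
      rw [← hp, LinearMap.mem_ker.mp hv]; rfl
    obtain ⟨w, rfl⟩ := (hpres v).mp h0
    rw [LinearMap.mem_ker, hq]
    have : ∑ i, MvPolynomial.map MvPolynomial.C (φ.mulVec w i) *
        (MvPolynomial.C (MvPolynomial.X i) : RingB k n) =
        ∑ j, MvPolynomial.map MvPolynomial.C (w j) * koszulForm φ j := by
      simp only [Matrix.mulVec, dotProduct, koszulForm, map_sum, map_mul, Finset.mul_sum,
        Finset.sum_mul]
      rw [Finset.sum_comm]
      refine Finset.sum_congr rfl fun j _ => Finset.sum_congr rfl fun i _ => ?_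
      ring
    rw [this, map_sum]
    exact Finset.sum_eq_zero fun j _ => by rw [map_mul, hπ, mul_zero]
  let h : idealI f →ₗ[RingR k n] Q :=
    (Submodule.liftQ _ q hker) ∘ₗ (p.quotKerEquivOfSurjective hpsurj).symm.toLinearMap
  have hh : ∀ v, h (p v) = q v := fun v => by
    have : (p.quotKerEquivOfSurjective hpsurj).symm (p v) = Submodule.Quotient.mk v := by
      rw [LinearEquiv.symm_apply_eq]; rfl
    change (Submodule.liftQ _ q hker) ((p.quotKerEquivOfSurjective hpsurj).symm (p v)) = q v
    rw [this]
    rfl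
  let ψ : SymI f →+* Q :=
    (SymmetricAlgebra.lift h : SymmetricAlgebra (RingR k n) (idealI f) →ₐ[RingR k n] _).toRingHom
  have hψ1 : ∀ r, ψ (algebraMap (RingR k n) (SymI f) r) = θ r := fun r =>
    (SymmetricAlgebra.lift h).commutes r
  have hψ2 : ∀ i, ψ (symGen f i) = π (MvPolynomial.C (MvPolynomial.X i)) :=
    fun i => by
      have h1 : ψ (symGen f i) = h ⟨f i, Ideal.subset_span ⟨i, rfl⟩⟩ :=
        SymmetricAlgebra.lift_ι_apply h _
      have h2 : p (Pi.single i 1) = ⟨f i, Ideal.subset_span ⟨i, rfl⟩⟩ := by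
        refine Subtype.ext ((hp _).trans ?_)
        simp [Pi.single_apply]
      rw [h1, ← h2, hh, hq]
      congr 1
      rw [Finset.sum_eq_single i]
      · simp
      · intro j _ hj; simp [hj]
      · simp
  have hcomp : ψ.comp (presMap f : RingB k n →+* SymI f) = π := by
    refine MvPolynomial.ringHom_ext (fun s => ?_) (fun j => ?_)
    · have : (ψ.comp (presMap f : RingB k n →+* SymI f)).comp MvPolynomial.C =
          (π).comp MvPolynomial.C := by
        refine MvPolynomial.ringHom_ext (fun a => ?_) (fun i => ?_)
        · change ψ (presMap f (MvPolynomial.C (MvPolynomial.C a))) = _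
          rw [presMap_C, coordHom_C, hψ1]
          simp [θ]
        · change ψ (presMap f (MvPolynomial.C (MvPolynomial.X i))) = _
          rw [presMap_C, coordHom_X, hψ2]
          rfl
      exact congrArg (fun g => g s) this
    · change ψ (presMap f (MvPolynomial.X j)) = _
      rw [presMap_X, hψ1]
      simp [θ]
  rw [← hcomp]
  change ψ (presMap f b) = 0
  rw [hb, map_zero]

-- The quotient map with an abstract target: the factorization lemma puts its own R-algebra
-- structure on Q, and an abstract Q carries no competing one.
universe u in
lemma exists_ringHom_eq_zero_iff {A : Type u} [CommRing A] (L : Ideal A) :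
    ∃ (Q : Type u) (_ : CommRing Q) (π : A →+* Q), ∀ x, π x = 0 ↔ x ∈ L :=
  ⟨A ⧸ L, inferInstance, Ideal.Quotient.mk L, fun _ => Ideal.Quotient.eq_zero_iff_mem⟩

/-- `Sym_R(I) = B / (l_1, …, l_n)`. -/
lemma presMap_eq_zero_iff
    (hpres : ∀ v : Fin (n + 1) → RingR k n,
      ∑ i, v i * f i = 0 ↔ ∃ w : Fin n → RingR k n, φ.mulVec w = v) (b : RingB k n) :
    presMap f b = 0 ↔ b ∈ Ideal.span (Set.range (koszulForm φ)) := by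
  constructor
  · intro hb
    obtain ⟨Q, _, π, hπ⟩ := exists_ringHom_eq_zero_iff (Ideal.span (Set.range (koszulForm φ)))
    exact (hπ b).mp (eq_zero_of_presMap_eq_zero f φ hpres π
      (fun j => (hπ _).mpr (Ideal.subset_span ⟨j, rfl⟩)) hb)
  · intro hb
    have : Ideal.span (Set.range (koszulForm φ)) ≤ RingHom.ker (presMap f) := by
      rw [Ideal.span_le]
      rintro _ ⟨j, rfl⟩
      exact presMap_koszulForm f φ hpres j
    exact this hb

lemma presMap_eq_zero_iff_mem_kimg
    (hpres : ∀ v : Fin (n + 1) → RingR k n,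
      ∑ i, v i * f i = 0 ↔ ∃ w : Fin n → RingR k n, φ.mulVec w = v) (b : RingB k n) :
    presMap f b = 0 ↔ b ∈ kimg (koszulForm φ) (RingB k n) := by
  rw [presMap_eq_zero_iff f φ hpres, mem_kimg, Ideal.mem_span_range_iff_exists_fun]
  simp only [smul_eq_mul, mul_comm]

end Presentation

/-! ### Strands of the Koszul complex and the linear resolution -/

section Strand

variable {k : Type*} [Field k] {n : ℕ} (d : Fin n → ℕ) (c : ℕ)

/-- An element of `F_t`, as an element of the Koszul complex over `B`. -/
def toKoszul (t : ℕ) (z : StrandMod k d c t) : Finset (Fin n) → RingB k n :=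
  fun J => ∑ p : StrandIdx d c t, if p.1.1 = J then MvPolynomial.monomial p.1.2 (z p) else 0

/-- The component in `F_t` of an element of the Koszul complex over `B`. -/
def ofKoszul (t : ℕ) (w : Finset (Fin n) → RingB k n) : StrandMod k d c t :=
  fun p => (w p.1.1).coeff p.1.2

variable {d c}

lemma coeff_toKoszul {t : ℕ} (z : StrandMod k d c t) (p : StrandIdx d c t) :
    (toKoszul d c t z p.1.1).coeff p.1.2 = z p := by
  classical
  rw [toKoszul, MvPolynomial.coeff_sum, Finset.sum_eq_single p]
  · rw [if_pos rfl, MvPolynomial.coeff_monomial, if_pos rfl]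
  · intro q _ hq
    split_ifs with h
    · rw [MvPolynomial.coeff_monomial, if_neg]
      intro h'
      exact hq (Subtype.ext (Prod.ext h h'))
    · rw [MvPolynomial.coeff_zero]
  · exact fun h => absurd (Finset.mem_univ _) h

lemma coeff_toKoszul_eq_zero {t : ℕ} (z : StrandMod k d c t) {J : Finset (Fin n)}
    {m : Fin n →₀ ℕ} (h : ¬(J.card = t ∧ m.degree + ∑ j ∈ J, d j = c)) :
    (toKoszul d c t z J).coeff m = 0 := by
  classical
  rw [toKoszul, MvPolynomial.coeff_sum]
  refine Finset.sum_eq_zero fun q _ => ?_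
  split_ifs with h1
  · rw [MvPolynomial.coeff_monomial, if_neg]
    rintro rfl
    exact h (h1 ▸ q.2)
  · rw [MvPolynomial.coeff_zero]

lemma ofKoszul_toKoszul {t : ℕ} (z : StrandMod k d c t) :
    ofKoszul d c t (toKoszul d c t z) = z := funext fun p => coeff_toKoszul z p

lemma toKoszul_ofKoszul {t : ℕ} {w : Finset (Fin n) → RingB k n}
    (hw : ∀ J m, (w J).coeff m ≠ 0 → J.card = t ∧ m.degree + ∑ j ∈ J, d j = c) :
    toKoszul d c t (ofKoszul d c t w) = w := by
  ext1 J
  ext1 m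
  by_cases h : J.card = t ∧ m.degree + ∑ j ∈ J, d j = c
  · exact coeff_toKoszul _ (⟨(J, m), h⟩ : StrandIdx d c t)
  · rw [coeff_toKoszul_eq_zero _ h]
    by_contra h0
    exact h (hw J m (Ne.symm h0))

lemma toKoszul_eq_zero {t : ℕ} (z : StrandMod k d c t) {J : Finset (Fin n)} (h : J.card ≠ t) :
    toKoszul d c t z J = 0 := by
  ext1 m
  rw [coeff_toKoszul_eq_zero z (fun h' => h h'.1), MvPolynomial.coeff_zero]

lemma isHomogeneous_koszulForm {φ : Matrix (Fin (n + 1)) (Fin n) (RingR k n)}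
    (hφ : ∀ i j, (φ i j).IsHomogeneous (d j)) (j : Fin n) :
    (koszulForm φ j).IsHomogeneous (d j) :=
  isHomogeneous_of_coeff fun _ hm => by
    exact_mod_cast (isBihom_koszulForm hφ j).degree_eq hm

/-- By homogeneity of l only those monomials of b that belong to the strand of degree c contribute
to this coefficient, so the product can be computed on the finite basis of the strand. -/
lemma coeff_mul_eq_sum_strandIdx {t : ℕ} {e : ℕ} {l : RingB k n} (hl : l.IsHomogeneous e)
    {J : Finset (Fin n)} (hJ : J.card = t) {m : Fin n →₀ ℕ}
    (hm : m.degree + ∑ j ∈ J, d j = c + e) (b : RingB k n) :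
    (l * b).coeff m = ∑ p : StrandIdx d c t, if p.1.1 = J then
      (l * MvPolynomial.monomial p.1.2 1).coeff m * b.coeff p.1.2 else 0 := by
  classical
  induction b using MvPolynomial.induction_on' with
  | add p q hp hq =>
    rw [mul_add, MvPolynomial.coeff_add, hp, hq, ← Finset.sum_add_distrib]
    refine Finset.sum_congr rfl fun p _ => ?_
    split_ifs
    · rw [MvPolynomial.coeff_add, mul_add]
    · rw [add_zero]
  | monomial m' s =>
    have hs : (MvPolynomial.monomial m' s : RingB k n) =
        MvPolynomial.C s * MvPolynomial.monomial m' 1 := by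
      rw [MvPolynomial.C_mul_monomial, mul_one]
    by_cases h : m'.degree + ∑ j ∈ J, d j = c
    · refine Eq.trans ?_ (Finset.sum_eq_single (⟨(J, m'), hJ, h⟩ : StrandIdx d c t) ?_ ?_).symm
      · rw [if_pos rfl, MvPolynomial.coeff_monomial, if_pos rfl, hs, mul_left_comm,
          MvPolynomial.coeff_C_mul, mul_comm]
      · intro q _ hq
        split_ifs with h1
        · rw [MvPolynomial.coeff_monomial, if_neg, mul_zero]
          intro h'
          exact hq (Subtype.ext (Prod.ext h1 h'.symm))
        · rfl
      · exact fun h => (h (Finset.mem_univ (α := StrandIdx d c t) _)).elim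
    · rw [Finset.sum_eq_zero]
      · rw [hs, mul_left_comm, MvPolynomial.coeff_C_mul]
        by_contra h0
        have := degree_eq_of_isHomogeneous
          (hl.mul (MvPolynomial.isHomogeneous_monomial (1 : RingS k n) (rfl : m'.degree = _)))
          (right_ne_zero_of_mul h0)
        omega
      · intro q _
        split_ifs with h1
        · rw [MvPolynomial.coeff_monomial, if_neg, mul_zero]
          rintro rfl
          exact h (h1 ▸ q.2.2)
        · rfl

variable {φ : Matrix (Fin (n + 1)) (Fin n) (RingR k n)}

/-- Extraction of a strand is a chain map. Together with its section `toKoszul` it transports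
exactness from B to every strand. -/
lemma strandDiff_ofKoszul (hφ : ∀ i j, (φ i j).IsHomogeneous (d j)) (t : ℕ)
    (w : Finset (Fin n) → RingB k n) :
    strandDiff φ d c t (ofKoszul d c (t + 1) w) = ofKoszul d c t (koszulD (koszulForm φ) w) := by
  classical
  ext1 q
  have h1 : strandDiff φ d c t (ofKoszul d c (t + 1) w) q =
      ∑ p, strandMatrix φ d c t q p * (w p.1.1).coeff p.1.2 := rfl
  -- Summation over j ∈ J with J \ j = q is rewritten as summation over j ∉ q with J = q ∪ {j}, the
  -- form in which `koszulD` is expressed.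
  have h2 : ∀ p : StrandIdx d c (t + 1), strandMatrix φ d c t q p * (w p.1.1).coeff p.1.2 =
      ∑ j, if j ∈ q.1.1 then 0 else if p.1.1 = insert j q.1.1 then
        ksign (RingS k n) j q.1.1 * ((koszulForm φ j * MvPolynomial.monomial p.1.2 1).coeff q.1.2 *
          (w p.1.1).coeff p.1.2) else 0 := by
    intro p
    rw [strandMatrix, Finset.sum_mul, ← Finset.sum_subset (Finset.subset_univ p.1.1)]
    · refine Finset.sum_congr rfl fun j hj => ?_
      by_cases h : q.1.1 = p.1.1.erase j
      · have h3 : j ∉ q.1.1 := by rw [h]; exact Finset.notMem_erase j _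
        have h4 : p.1.1 = insert j q.1.1 := by rw [h, Finset.insert_erase hj]
        rw [if_pos h, if_neg h3, if_pos h4, mul_assoc]
        congr 1
        rw [h, ksign_erase]
        rfl
      · rw [if_neg h, zero_mul]
        split_ifs with h3 h4
        · rfl
        · exact absurd (by rw [h4, Finset.erase_insert h3]) h
        · rfl
    · intro j _ hj
      split_ifs with h3 h4
      · rfl
      · exact absurd (h4 ▸ Finset.mem_insert_self j _) hj
      · rfl
  rw [h1, Finset.sum_congr rfl fun p _ => h2 p, Finset.sum_comm, ofKoszul, koszulD_apply,
    MvPolynomial.coeff_sum]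
  refine Finset.sum_congr rfl fun j _ => ?_
  by_cases hj : j ∈ q.1.1
  · simp [hj]
  · simp only [if_neg hj]
    have h5 : koszulForm φ j * ksign (RingB k n) j q.1.1 * w (insert j q.1.1) =
        MvPolynomial.C (ksign (RingS k n) j q.1.1) * (koszulForm φ j * w (insert j q.1.1)) := by
      have : (MvPolynomial.C (ksign (RingS k n) j q.1.1) : RingB k n) =
          ksign (RingB k n) j q.1.1 := by
        simp [ksign]
      rw [this]; ring
    rw [smul_eq_mul, h5, MvPolynomial.coeff_C_mul,
      coeff_mul_eq_sum_strandIdx (d := d) (c := c) (t := t + 1) (isHomogeneous_koszulForm hφ j)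
        (J := insert j q.1.1) (by rw [Finset.card_insert_of_notMem hj, q.2.1])
        (by have := q.2.2; rw [Finset.sum_insert hj]; omega), Finset.mul_sum]
    refine Finset.sum_congr rfl fun p _ => ?_
    split_ifs with h6
    · rw [h6]
    · rw [mul_zero]

lemma toKoszul_strandDiff (hφ : ∀ i j, (φ i j).IsHomogeneous (d j)) (t : ℕ)
    (z : StrandMod k d c (t + 1)) :
    toKoszul d c t (strandDiff φ d c t z) = koszulD (koszulForm φ) (toKoszul d c (t + 1) z) := by
  classical
  rw [← ofKoszul_toKoszul z, strandDiff_ofKoszul hφ, ofKoszul_toKoszul, toKoszul_ofKoszul]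
  intro J m h
  rw [koszulD_apply, MvPolynomial.coeff_sum] at h
  obtain ⟨j, _, h1⟩ := Finset.exists_ne_zero_of_sum_ne_zero h
  split_ifs at h1 with hj
  · simp at h1
  have h2 : (koszulForm φ j * toKoszul d c (t + 1) z (insert j J)).coeff m ≠ 0 := by
    intro h0
    apply h1
    rw [smul_eq_mul, ksign]
    rcases neg_one_pow_eq_or (RingB k n) (J.filter (· < j)).card with h3 | h3
    · rw [h3, mul_one, h0]
    · rw [h3, mul_neg_one, neg_mul, MvPolynomial.coeff_neg, h0, neg_zero]
  rw [MvPolynomial.coeff_mul] at h2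
  obtain ⟨x, hx, h3⟩ := Finset.exists_ne_zero_of_sum_ne_zero h2
  rw [Finset.HasAntidiagonal.mem_antidiagonal] at hx
  have h4 := degree_eq_of_isHomogeneous (isHomogeneous_koszulForm hφ j) (left_ne_zero_of_mul h3)
  have h5 : (insert j J).card = t + 1 ∧ x.2.degree + ∑ i ∈ insert j J, d i = c := by
    by_contra h5
    exact right_ne_zero_of_mul h3 (coeff_toKoszul_eq_zero z h5)
  rw [Finset.card_insert_of_notMem hj, Finset.sum_insert hj] at h5
  refine ⟨by omega, ?_⟩
  rw [← hx, map_add]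
  omega

lemma strandAug_eq (f : Fin (n + 1) → RingR k n) (z : StrandMod k d c 0) :
    strandAug f d c z = presMap f (toKoszul d c 0 z ∅) := by
  change ∑ p, z p • presMap f (MvPolynomial.monomial p.1.2 1) = _
  rw [toKoszul, map_sum]
  refine Finset.sum_congr rfl fun p _ => ?_
  rw [if_pos (Finset.card_eq_zero.mp p.2.1), ← map_smul, MvPolynomial.smul_monomial, smul_eq_mul,
    mul_one]

lemma isHomogeneous_toKoszul (z : StrandMod k d c 0) :
    (toKoszul d c 0 z ∅).IsHomogeneous c := by
  refine isHomogeneous_of_coeff fun m hm => ?_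
  by_contra h
  refine hm (coeff_toKoszul_eq_zero z ?_)
  simpa using h

lemma coeff_toKoszul_mem_degS {t : ℕ} {j : ℤ} {z : StrandMod k d c t}
    (hz : ∀ p, z p ∈ degS k n j) (J : Finset (Fin n)) (m : Fin n →₀ ℕ) :
    (toKoszul d c t z J).coeff m ∈ degS k n j := by
  by_cases h : J.card = t ∧ m.degree + ∑ j ∈ J, d j = c
  · exact (coeff_toKoszul z (⟨(J, m), h⟩ : StrandIdx d c t)) ▸ hz _
  · rw [coeff_toKoszul_eq_zero _ h]; exact zero_mem_degS j

lemma strandMatrix_mem_degS (hφ : ∀ i j, (φ i j).IsHomogeneous (d j)) (t : ℕ)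
    (q : StrandIdx d c t) (p : StrandIdx d c (t + 1)) :
    strandMatrix φ d c t q p ∈ degS k n 1 := by
  refine sum_mem_degS fun j _ => ?_
  split_ifs
  · refine neg_one_pow_mul_mem_degS _ ?_
    have := (isBihom_koszulForm hφ j).mul (isBihom_monomial p.1.2 0 (1 : k))
    rw [map_zero, Nat.cast_zero, add_zero] at this
    exact this.coeff_mem_degS _
  · exact zero_mem_degS 1

/-- Exactness at F_0 only uses Sym(I) = B/(l); acyclicity enters at the later spots. In both cases a
preimage over B is found first and then cut down to the strand. -/
theorem isStrandResolution (f : Fin (n + 1) → RingR k n)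
    (hφ : ∀ i j, (φ i j).IsHomogeneous (d j))
    (hpres : ∀ v : Fin (n + 1) → RingR k n,
      ∑ i, v i * f i = 0 ↔ ∃ w : Fin n → RingR k n, φ.mulVec w = v)
    (hl : ∀ t, 1 ≤ t → KoszulExact (koszulForm φ) (RingB k n) t) (c : ℕ) :
    IsStrandResolution f φ d c where
  diff_graded t j z hz q := by
    refine sum_mem_degS fun p _ => ?_
    have := mul_mem_degS (strandMatrix_mem_degS hφ t q p) (hz p)
    have h : 1 + (j - ((t + 1 : ℕ) : ℤ)) = j - t := by push_cast; ring
    rwa [h] at this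
  aug_graded j z hz := by
    rw [strandAug_eq]
    refine ⟨_, ⟨isHomogeneous_toKoszul z, fun m => ?_⟩, rfl⟩
    exact coeff_toKoszul_mem_degS (fun p => by have := hz p; rwa [sub_zero] at this) _ _
  aug_range := by
    ext x
    constructor
    · rintro ⟨z, rfl⟩
      rw [strandAug_eq]
      exact ⟨_, (MvPolynomial.mem_homogeneousSubmodule _ _).mpr (isHomogeneous_toKoszul z), rfl⟩
    · rintro ⟨b, hb, rfl⟩
      have hb' := (MvPolynomial.mem_homogeneousSubmodule _ _).mp hb
      refine ⟨ofKoszul d c 0 (fun _ => b), ?_⟩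
      rw [strandAug_eq]
      refine congrArg (presMap f) (MvPolynomial.ext _ _ fun m => ?_)
      by_cases h : (∅ : Finset (Fin n)).card = 0 ∧ m.degree + ∑ j ∈ (∅ : Finset (Fin n)), d j = c
      · exact coeff_toKoszul _ (⟨(∅, m), h⟩ : StrandIdx d c 0)
      · rw [coeff_toKoszul_eq_zero _ h]
        by_contra h0
        exact h ⟨rfl, by simpa using degree_eq_of_isHomogeneous hb' (Ne.symm h0)⟩
  aug_exact := by
    ext z
    rw [LinearMap.mem_ker, strandAug_eq, presMap_eq_zero_iff_mem_kimg f φ hpres]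
    constructor
    · intro h
      obtain ⟨w, -, hw⟩ := exists_koszulD_of_mem_kimg (koszulForm φ)
        (fun J hJ => toKoszul_eq_zero z hJ) h
      refine ⟨ofKoszul d c 1 w, ?_⟩
      rw [strandDiff_ofKoszul hφ, hw, ofKoszul_toKoszul]
    · rintro ⟨w, rfl⟩
      rw [toKoszul_strandDiff hφ]
      exact koszulD_empty_mem _ _
  exact t := by
    ext z
    rw [LinearMap.mem_ker]
    constructor
    · intro h
      have h1 : koszulD (koszulForm φ) (toKoszul d c (t + 1) z) = 0 := by
        rw [← toKoszul_strandDiff hφ, h]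
        exact funext fun J => Finset.sum_eq_zero fun p _ => by
          rw [Pi.zero_apply, map_zero, ite_self]
      obtain ⟨w, -, hw⟩ := hl (t + 1) (by omega) _ (fun J hJ => toKoszul_eq_zero z hJ) h1
      refine ⟨ofKoszul d c (t + 2) w, ?_⟩
      rw [strandDiff_ofKoszul hφ, hw, ofKoszul_toKoszul]
    · rintro ⟨w, rfl⟩
      rw [← ofKoszul_toKoszul (strandDiff φ d c t _), toKoszul_strandDiff hφ,
        toKoszul_strandDiff hφ, koszulD_koszulD]
      rfl

end Strand

/-! ### Projections of zigzags to graded components -/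

section Components

variable {k : Type*} [Field k] {n : ℕ}

/-- A family of projections to components which is compatible with multiplication by bihomogeneous
elements. -/
def IsComponentSystem (γ : ℤ → ℤ → RingB k n →+ RingB k n) : Prop :=
  ∀ (e' τ' : ℤ) (l : RingB k n), IsBihom e' τ' l → ∀ (e τ : ℤ) (b : RingB k n),
    γ (e + e') (τ + τ') (l * b) = l * γ e τ b

/-- The components of `B` with respect to the bigrading. -/
def bcompHom (e τ : ℤ) : RingB k n →+ RingB k n := AddMonoidHom.mk' (bcomp e τ) (bcomp_add e τ)

lemma isComponentSystem_bcompHom : IsComponentSystem (bcompHom (k := k) (n := n)) :=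
  fun _ _ _ hl e τ b => hl.bcomp_mul e τ b

/-- The component of `x`-degree `e`. -/
def xcompHom (e : ℤ) : RingB k n →+ RingB k n where
  toFun b := if 0 ≤ e then MvPolynomial.homogeneousComponent e.toNat b else 0
  map_zero' := by simp
  map_add' a b := by split_ifs <;> simp

lemma coeff_xcompHom (e : ℤ) (b : RingB k n) (m : Fin n →₀ ℕ) :
    (xcompHom e b).coeff m = if (m.degree : ℤ) = e then b.coeff m else 0 := by
  change MvPolynomial.coeff m (if 0 ≤ e then MvPolynomial.homogeneousComponent e.toNat b else 0) = _
  split_ifs with h1 h2 h2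
  · rw [MvPolynomial.coeff_homogeneousComponent, if_pos (by omega)]
  · rw [MvPolynomial.coeff_homogeneousComponent, if_neg (by omega)]
  · omega
  · rw [MvPolynomial.coeff_zero]

lemma xcompHom_eq_self {e : ℤ} {b : RingB k n} (h : ∀ m, b.coeff m ≠ 0 → (m.degree : ℤ) = e) :
    xcompHom e b = b := by
  ext1 m
  rw [coeff_xcompHom]
  split_ifs with hc
  · rfl
  · by_contra h0
    exact hc (h m (Ne.symm h0))

lemma xcompHom_eq_zero {e e' : ℤ} {b : RingB k n} (h : ∀ m, b.coeff m ≠ 0 → (m.degree : ℤ) = e)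
    (hne : e ≠ e') : xcompHom e' b = 0 := by
  ext1 m
  rw [coeff_xcompHom, MvPolynomial.coeff_zero]
  split_ifs with hc
  · by_contra h0
    exact hne ((h m h0).symm.trans hc)
  · rfl

/-- This system ignores the T-degree. It is needed because elements of 𝒜_i and functionals on F_0
are homogeneous in x only, while the bigraded system serves to compare gradings. -/
lemma isComponentSystem_xcompHom : IsComponentSystem fun e _ => xcompHom (k := k) (n := n) e := by
  intro d t l hl e _ b
  change xcompHom (e + d) (l * b) = l * xcompHom e b
  induction b using ringB_induction with
  | hadd b b' h h' => rw [mul_add, map_add, map_add, h, h', mul_add]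
  | hmon m m' c =>
    have h1 := isBihom_monomial m m' c
    have h2 := hl.mul h1
    by_cases hc : (m.degree : ℤ) = e
    · subst hc
      rw [xcompHom_eq_self fun m h => h1.degree_eq h, xcompHom_eq_self fun m h => ?_]
      rw [h2.degree_eq h, add_comm]
    · rw [xcompHom_eq_zero (fun m h => h1.degree_eq h) hc, mul_zero,
        xcompHom_eq_zero (fun m h => h2.degree_eq h) (by omega)]

variable {γ : ℤ → ℤ → RingB k n →+ RingB k n} {l g : Fin n → RingB k n} {d d' : Fin n → ℕ}
  {t t' : ℤ}

lemma IsComponentSystem.mem_kimg (hγ : IsComponentSystem γ) (hl : ∀ j, IsBihom (d j) t (l j))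
    {b : RingB k n} (hb : b ∈ kimg l (RingB k n)) (e τ : ℤ) : γ e τ b ∈ kimg l (RingB k n) := by
  obtain ⟨c, rfl⟩ := BEMult.mem_kimg.mp hb
  refine BEMult.mem_kimg.mpr ⟨fun j => γ (e - d j) (τ - t) (c j), ?_⟩
  rw [map_sum]
  refine Finset.sum_congr rfl fun j _ => ?_
  have := hγ _ _ _ (hl j) (e - d j) (τ - t) (c j)
  rw [sub_add_cancel, sub_add_cancel] at this
  exact this.symm

/-- The component of a zigzag. -/
def zcomp (γ : ℤ → ℤ → RingB k n →+ RingB k n) (d d' : Fin n → ℕ) (t t' e τ : ℤ)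
    (x : Finset (Fin n) → Finset (Fin n) → RingB k n) :
    Finset (Fin n) → Finset (Fin n) → RingB k n :=
  fun J L => γ (e - ∑ j ∈ J, (d j : ℤ) - ∑ j ∈ L, (d' j : ℤ)) (τ - J.card * t - L.card * t') (x J L)

/-- With e_J and e_L carrying the degrees of the forms, both differentials commute with the
projections, so the zigzag condition holds component by component. -/
lemma IsComponentSystem.zcomp_mem_zigzag (hγ : IsComponentSystem γ)
    (hl : ∀ j, IsBihom (d j) t (l j)) (hg : ∀ j, IsBihom (d' j) t' (g j)) (e τ : ℤ)
    {x : Finset (Fin n) → Finset (Fin n) → RingB k n} (hx : x ∈ zigzag l g (RingB k n)) :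
    zcomp γ d d' t t' e τ x ∈ zigzag l g (RingB k n) := by
  rw [mem_zigzag] at hx ⊢
  refine ⟨fun J L h => by rw [zcomp, hx.1 J L h, map_zero], fun J => ?_⟩
  ext1 L
  have h0 := congrArg (γ (e - ∑ j ∈ J, (d j : ℤ) - ∑ j ∈ L, (d' j : ℤ))
    (τ - J.card * t - L.card * t')) (congrFun (hx.2 J) L)
  rw [koszulD_swap, koszulD_apply, koszulD_apply, map_sum, map_sum] at h0
  rw [koszulD_swap, koszulD_apply, koszulD_apply]
  convert h0 using 1
  · refine Finset.sum_congr rfl fun j _ => ?_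
    split_ifs with hj
    · rw [map_zero]
    · have h1 := hγ _ _ _ ((hl j).mul_ksign j J)
        (e - ∑ i ∈ insert j J, (d i : ℤ) - ∑ j ∈ L, (d' j : ℤ))
        (τ - (insert j J).card * t - L.card * t') (x (insert j J) L)
      rw [smul_eq_mul, zcomp, ← h1, smul_eq_mul]
      congr 2
      · rw [Finset.sum_insert hj]; ring
      · rw [Finset.card_insert_of_notMem hj]; push_cast; ring
  · refine Finset.sum_congr rfl fun j _ => ?_
    split_ifs with hj
    · rw [map_zero]
    · have h1 := hγ _ _ _ ((hg j).mul_ksign j L)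
        (e - ∑ i ∈ J, (d i : ℤ) - ∑ j ∈ insert j L, (d' j : ℤ))
        (τ - J.card * t - (insert j L).card * t') (x J (insert j L))
      rw [smul_eq_mul, zcomp, ← h1, smul_eq_mul]
      congr 2
      · rw [Finset.sum_insert hj]; ring
      · rw [Finset.card_insert_of_notMem hj]; push_cast; ring

end Components

/-! ### The Koszul complex of the powers of the variables -/

section Powers

variable {k : Type*} [Field k] {n : ℕ}

/-- The forms `x_1^N, …, x_n^N`. -/
def powerForm (k : Type*) [Field k] (n N : ℕ) (j : Fin n) : RingB k n := MvPolynomial.X j ^ N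

lemma isBihom_powerForm (N : ℕ) (j : Fin n) : IsBihom N 0 (powerForm k n N j) := by
  have := isBihom_monomial (Finsupp.single j N) (0 : Fin (n + 1) →₀ ℕ) (1 : k)
  rw [Finsupp.degree_single, map_zero] at this
  rw [powerForm, MvPolynomial.X_pow_eq_monomial]
  exact this

lemma koszulExact_powerForm (N : ℕ) (t : ℕ) (ht : 1 ≤ t) :
    KoszulExact (powerForm k n N) (RingB k n) t := by
  refine koszulExact_of_isWeaklyRegular (powerForm k n N)
    ((List.finRange n).map (powerForm k n N)) (fun b hb => ?_) (RingB k n)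
    (isWeaklyRegular_X_pow (List.finRange n) (List.nodup_finRange n) N) t ?_
  · obtain ⟨i, -, rfl⟩ := List.mem_map.mp hb
    exact Ideal.subset_span ⟨i, rfl⟩
  · rw [Fintype.card_fin, List.length_map, List.length_finRange]; omega

lemma mem_kimg_powerForm {N : ℕ} {b : RingB k n} :
    b ∈ kimg (powerForm k n N) (RingB k n) ↔ ∀ m, b.coeff m ≠ 0 → ∃ j, N ≤ m j := by
  have h1 : b ∈ kimg (powerForm k n N) (RingB k n) ↔
      b ∈ Ideal.span (Set.range (powerForm k n N)) := by
    rw [mem_kimg, Ideal.mem_span_range_iff_exists_fun]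
    simp only [smul_eq_mul, mul_comm]
  have h2 : Set.range (powerForm k n N) = (fun s => MvPolynomial.monomial s (1 : RingS k n)) ''
      Set.range (fun j : Fin n => Finsupp.single j N) := by
    rw [← Set.range_comp]
    congr 1
    ext1 j
    exact MvPolynomial.X_pow_eq_monomial
  rw [h1, h2, MvPolynomial.mem_ideal_span_monomial_image]
  simp only [MvPolynomial.mem_support_iff, Set.mem_range, exists_exists_eq_and,
    Finsupp.single_le_iff]

end Powers

/-! ### The duality between B/(x_1^N, …, x_n^N) and F_0 -/

section Pairing

variable {k : Type*} [Field k] {n : ℕ} (d : Fin n → ℕ) (c : ℕ)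

/-- The embedding of `F_0` into `B`. -/
def zeroEmb : StrandMod k d c 0 →ₗ[RingS k n] RingB k n :=
  Fintype.linearCombination (RingS k n) (fun p => MvPolynomial.monomial p.1.2 1)

lemma zeroEmb_single (p : StrandIdx d c 0) :
    zeroEmb (k := k) d c (Pi.single p 1) = MvPolynomial.monomial p.1.2 1 := by
  rw [zeroEmb, Fintype.linearCombination_apply_single, one_smul]

lemma toKoszul_empty (z : StrandMod k d c 0) : toKoszul d c 0 z ∅ = zeroEmb d c z := by
  change _ = ∑ p, z p • MvPolynomial.monomial p.1.2 1
  rw [toKoszul]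
  refine Finset.sum_congr rfl fun p _ => ?_
  rw [if_pos (Finset.card_eq_zero.mp p.2.1), MvPolynomial.smul_monomial, smul_eq_mul, mul_one]

/-- The exponent `(N - 1, …, N - 1)`. -/
def topExp (n N : ℕ) : Fin n →₀ ℕ := Finsupp.equivFunOnFinite.symm fun _ => N - 1

lemma topExp_apply (N : ℕ) (j : Fin n) : topExp n N j = N - 1 := rfl

lemma degree_topExp (N : ℕ) : (topExp n N).degree = n * (N - 1) := by
  rw [Finsupp.degree_eq_sum]
  simp [topExp_apply]

/-- The pairing of `F_0` with `B / (x_1^N, …, x_n^N)`. -/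
def pairing (N : ℕ) : RingB k n →ₗ[RingS k n] Module.Dual (RingS k n) (StrandMod k d c 0) :=
  ((LinearMap.mul (RingS k n) (RingB k n)).compr₂
    (MvPolynomial.lcoeff (RingS k n) (topExp n N))).compl₂ (zeroEmb d c)

lemma pairing_apply (N : ℕ) (b : RingB k n) (z : StrandMod k d c 0) :
    pairing d c N b z = (b * zeroEmb d c z).coeff (topExp n N) := rfl

lemma pairing_single (N : ℕ) (b : RingB k n) (p : StrandIdx d c 0) :
    pairing d c N b (Pi.single p 1) =
      if p.1.2 ≤ topExp n N then b.coeff (topExp n N - p.1.2) else 0 := by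
  rw [pairing_apply, zeroEmb_single, MvPolynomial.coeff_mul_monomial']
  simp

lemma coeff_topExp_of_mem {N : ℕ} (hN : 0 < N) {b : RingB k n}
    (hb : b ∈ kimg (powerForm k n N) (RingB k n)) : b.coeff (topExp n N) = 0 := by
  by_contra h
  obtain ⟨j, hj⟩ := mem_kimg_powerForm.mp hb _ h
  rw [topExp_apply] at hj
  omega

lemma mul_mem_kimg {a : Fin n → RingB k n} {b : RingB k n} (hb : b ∈ kimg a (RingB k n))
    (b' : RingB k n) : b * b' ∈ kimg a (RingB k n) := by
  rw [mul_comm]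
  exact Submodule.smul_mem _ b' hb

/-- Monomials detect membership in `(x_1^N, …, x_n^N)`. -/
lemma mem_kimg_powerForm_of_coeff {N e c : ℕ} (hN : 0 < N) {b : RingB k n}
    (hb : ∀ m, b.coeff m ≠ 0 → m.degree = e) (hc : e + c = n * (N - 1))
    (h : ∀ m : Fin n →₀ ℕ, m.degree = c →
      (b * MvPolynomial.monomial m 1).coeff (topExp n N) = 0) :
    b ∈ kimg (powerForm k n N) (RingB k n) := by
  refine mem_kimg_powerForm.mpr fun m hm => ?_
  by_contra h0
  push Not at h0
  have hle : m ≤ topExp n N := fun j => by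
    have := h0 j
    rw [topExp_apply]; omega
  -- If x^m is not in the ideal, it divides the socle monomial, and pairing with the complementary
  -- monomial reads off its coefficient.
  have hsub : topExp n N - m ≤ topExp n N := tsub_le_self
  have h1 := h (topExp n N - m) (by
    have h2 : m.degree + (topExp n N - m).degree = (topExp n N).degree := by
      rw [← map_add, add_tsub_cancel_of_le hle]
    rw [degree_topExp, hb m hm] at h2
    omega)
  rw [MvPolynomial.coeff_mul_monomial', if_pos hsub, mul_one, tsub_tsub_cancel_of_le hle] at h1
  exact hm h1

variable {d c}

lemma pairing_eq_zero_iff {N : ℕ} (hN : 0 < N) {e : ℕ} {b : RingB k n}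
    (hb : ∀ m, b.coeff m ≠ 0 → m.degree = e) (hc : e + c = n * (N - 1)) :
    pairing d c N b = 0 ↔ b ∈ kimg (powerForm k n N) (RingB k n) := by
  constructor
  · intro h
    refine mem_kimg_powerForm_of_coeff hN hb hc fun m hm => ?_
    let p : StrandIdx d c 0 := ⟨(∅, m), Finset.card_empty, by simpa using hm⟩
    have := LinearMap.congr_fun h (Pi.single p 1)
    rw [pairing_apply, zeroEmb_single] at this
    exact this
  · intro h
    refine LinearMap.ext fun z => ?_
    exact coeff_topExp_of_mem hN (mul_mem_kimg h _)

/-- Every functional on `F_0` is given by the pairing. -/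
lemma exists_pairing_eq {N : ℕ} (hN : c < N) (v : Module.Dual (RingS k n) (StrandMod k d c 0)) :
    ∃ b : RingB k n, (∀ m, b.coeff m ≠ 0 → m.degree + c = n * (N - 1)) ∧ pairing d c N b = v := by
  classical
  -- The bound c < N makes every monomial of degree c divide the socle monomial, so a dual basis of
  -- F_0 is given by the complementary monomials.
  have hle : ∀ p : StrandIdx d c 0, p.1.2 ≤ topExp n N := fun p j => by
    have h1 := p.2.2
    have h2 : p.1.2 j ≤ p.1.2.degree := Finsupp.le_degree j p.1.2
    rw [topExp_apply]; omega
  have hdeg : ∀ p : StrandIdx d c 0, p.1.2.degree = c := fun p => by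
    have h1 := p.2.2
    rw [Finset.card_eq_zero.mp p.2.1, Finset.sum_empty, add_zero] at h1
    exact h1
  refine ⟨∑ p : StrandIdx d c 0, MvPolynomial.monomial (topExp n N - p.1.2) (v (Pi.single p 1)),
    fun m hm => ?_, ?_⟩
  · rw [MvPolynomial.coeff_sum] at hm
    obtain ⟨p, _, hp⟩ := Finset.exists_ne_zero_of_sum_ne_zero hm
    rw [MvPolynomial.coeff_monomial] at hp
    split_ifs at hp with h
    · have h1 : (topExp n N - p.1.2).degree + p.1.2.degree = (topExp n N).degree := by
        rw [← map_add, tsub_add_cancel_of_le (hle p)]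
      rw [hdeg p, degree_topExp] at h1
      rw [← h, h1]
    · exact absurd rfl hp
  · refine (Pi.basisFun (RingS k n) (StrandIdx d c 0)).ext fun q => ?_
    rw [Pi.basisFun_apply, pairing_single, if_pos (hle q), MvPolynomial.coeff_sum,
      Finset.sum_eq_single q]
    · rw [MvPolynomial.coeff_monomial, if_pos rfl]
    · intro p _ hp
      rw [MvPolynomial.coeff_monomial, if_neg]
      intro h
      refine hp (Subtype.ext (Prod.ext ?_ ?_))
      · rw [Finset.card_eq_zero.mp p.2.1, Finset.card_eq_zero.mp q.2.1]
      · have h3 := tsub_tsub_cancel_of_le (hle p)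
        rw [h, tsub_tsub_cancel_of_le (hle q)] at h3
        exact h3.symm
    · exact fun h => (h (Finset.mem_univ q)).elim

variable {φ : Matrix (Fin (n + 1)) (Fin n) (RingR k n)}

lemma zeroEmb_strandDiff (hφ : ∀ i j, (φ i j).IsHomogeneous (d j)) (z : StrandMod k d c 1) :
    zeroEmb d c (strandDiff φ d c 0 z) = ∑ j, koszulForm φ j * toKoszul d c 1 z {j} := by
  rw [← toKoszul_empty, toKoszul_strandDiff hφ, koszulD_empty]
  rfl

/-- The pairing turns the cocycle condition into an annihilator condition. -/
lemma pairing_mem_ker_iff (hφ : ∀ i j, (φ i j).IsHomogeneous (d j)) {N : ℕ} (hN : 0 < N)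
    {b : RingB k n} (hb : ∀ m, b.coeff m ≠ 0 → m.degree + c = n * (N - 1)) :
    pairing d c N b ∈ LinearMap.ker (strandDual φ d c) ↔
      ∀ j, koszulForm φ j • b ∈ kimg (powerForm k n N) (RingB k n) := by
  classical
  rw [LinearMap.mem_ker]
  constructor
  · intro h j
    by_cases hb0 : b = 0
    · rw [hb0, smul_zero]; exact Submodule.zero_mem _
    rw [smul_eq_mul]
    -- The elements x^m e_j of F_1 exist only for d_j ≤ c; evaluating on them shows that l_j b pairs
    -- to zero with all monomials of the complementary degree c - d_j.
    by_cases hjc : d j ≤ c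
    · refine mem_kimg_powerForm_of_coeff (e := n * (N - 1) - c + d j) (c := c - d j) hN
        (fun m hm => ?_) ?_ fun m hm => ?_
      · rw [MvPolynomial.coeff_mul] at hm
        obtain ⟨x, hx, h1⟩ := Finset.exists_ne_zero_of_sum_ne_zero hm
        rw [Finset.HasAntidiagonal.mem_antidiagonal] at hx
        have h2 := degree_eq_of_isHomogeneous (isHomogeneous_koszulForm hφ j)
          (left_ne_zero_of_mul h1)
        have h3 := hb _ (right_ne_zero_of_mul h1)
        rw [← hx, map_add]
        omega
      · obtain ⟨m, hm⟩ := MvPolynomial.ne_zero_iff.mp hb0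
        have := hb m hm
        omega
      · let p : StrandIdx d c 1 := ⟨({j}, m), Finset.card_singleton j, by
          rw [Finset.sum_singleton]; dsimp only; omega⟩
        have h1 := LinearMap.congr_fun h (Pi.single p 1)
        rw [LinearMap.dualMap_apply, pairing_apply, zeroEmb_strandDiff hφ, Finset.mul_sum,
          Finset.sum_eq_single j] at h1
        · have h2 : toKoszul (k := k) d c 1 (Pi.single p 1) {j} = MvPolynomial.monomial m 1 := by
            rw [toKoszul, Finset.sum_eq_single p]
            · rw [if_pos rfl, Pi.single_eq_same]
            · intro q _ hq
              rw [Pi.single_eq_of_ne hq, map_zero, ite_self]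
            · exact fun h => (h (Finset.mem_univ p)).elim
          rw [h2] at h1
          rw [mul_comm (koszulForm φ j), mul_assoc]
          exact h1
        · intro i _ hi
          have h2 : toKoszul (k := k) d c 1 (Pi.single p 1) {i} = 0 := by
            refine Finset.sum_eq_zero fun q _ => ?_
            split_ifs with h3
            · rw [Pi.single_eq_of_ne, map_zero]
              rintro rfl
              exact hi (Finset.singleton_injective h3).symm
            · rfl
          rw [h2, mul_zero, mul_zero]
        · exact fun h => (h (Finset.mem_univ j)).elim
    -- For d_j > c the product l_j b has x-degree above n(N-1), and every monomial of such degree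
    -- lies in (x_1^N, …, x_n^N).
    · refine mem_kimg_powerForm.mpr fun m hm => ?_
      by_contra h0
      push Not at h0
      rw [MvPolynomial.coeff_mul] at hm
      obtain ⟨x, hx, h1⟩ := Finset.exists_ne_zero_of_sum_ne_zero hm
      rw [Finset.HasAntidiagonal.mem_antidiagonal] at hx
      have h2 := degree_eq_of_isHomogeneous (isHomogeneous_koszulForm hφ j)
        (left_ne_zero_of_mul h1)
      have h3 := hb _ (right_ne_zero_of_mul h1)
      have h4 : m.degree ≤ n * (N - 1) := by
        rw [← degree_topExp]
        refine Finsupp.degree_mono fun i => ?_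
        have := h0 i
        rw [topExp_apply]; omega
      rw [← hx, map_add] at h4
      omega
  · intro h
    refine LinearMap.ext fun z => ?_
    rw [LinearMap.dualMap_apply, pairing_apply, zeroEmb_strandDiff hφ, Finset.mul_sum,
      MvPolynomial.coeff_sum]
    refine Finset.sum_eq_zero fun j _ => coeff_topExp_of_mem hN ?_
    rw [← mul_assoc, mul_comm b]
    exact mul_mem_kimg (h j) _

end Pairing

/-! ### The isomorphism between the kernel of the dual differential and 𝒜_i -/

section Duality

variable {k : Type*} [Field k] {n : ℕ} {f : Fin (n + 1) → RingR k n} {d : Fin n → ℕ}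
  {φ : Matrix (Fin (n + 1)) (Fin n) (RingR k n)}

/-- The elements of `𝒜_i` are killed by a common power of each variable. -/
lemma exists_pow_mul_eq_zero (f : Fin (n + 1) → RingR k n) (i : ℕ)
    (hfg : (symPiece f i).FG) :
    ∃ N : ℕ, ∀ y ∈ locCohPiece f i, ∀ j,
      algebraMap (RingR k n) (SymI f) (MvPolynomial.X j ^ N) * y = 0 := by
  have hfg' : (locCohPiece f i).FG := by
    have : IsNoetherian (RingS k n) (symPiece f i) :=
      isNoetherian_of_fg_of_noetherian _ hfg
    exact Submodule.FG.of_le hfg inf_le_right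
  obtain ⟨s, hs⟩ := hfg'
  have h1 : ∀ y ∈ s, ∃ N : ℕ, ∀ r ∈ maxIdeal k n ^ N,
      algebraMap (RingR k n) (SymI f) r * y = 0 := fun y hy => by
    have : y ∈ locCohPiece f i := hs ▸ Submodule.subset_span hy
    exact this.1
  choose! M hM using h1
  refine ⟨s.sup M, fun y hy j => ?_⟩
  rw [← hs] at hy
  induction hy using Submodule.span_induction with
  | mem y hy =>
    have hX : (MvPolynomial.X j : RingR k n) ∈ maxIdeal k n := Ideal.subset_span ⟨j, rfl⟩
    exact hM y hy _ (Ideal.pow_le_pow_right (Finset.le_sup hy) (Ideal.pow_mem_pow hX _))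
  | zero => exact mul_zero _
  | add x y _ _ hx hy => rw [mul_add, hx, hy, add_zero]
  | smul a x _ hx => rw [mul_smul_comm, hx, smul_zero]

/-- The ideal (x_1^N, …, x_n^N) has radical containing 𝔪, so it contains a power of 𝔪. -/
lemma mem_locCoh_of_pow_mul {y : SymI f} {N : ℕ}
    (h : ∀ j, algebraMap (RingR k n) (SymI f) (MvPolynomial.X j ^ N) * y = 0) :
    y ∈ locCoh f := by
  let J : Ideal (RingR k n) :=
    Ideal.span (Set.range fun j : Fin n => (MvPolynomial.X j ^ N : RingR k n))
  have h1 : maxIdeal k n ≤ J.radical := by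
    rw [maxIdeal, Ideal.span_le]
    rintro _ ⟨j, rfl⟩
    exact ⟨N, Ideal.subset_span ⟨j, rfl⟩⟩
  obtain ⟨M, hM⟩ := Ideal.exists_pow_le_of_le_radical_of_fg h1 (IsNoetherian.noetherian _)
  refine ⟨M, fun r hr => ?_⟩
  obtain ⟨a, rfl⟩ := (Ideal.mem_span_range_iff_exists_fun).mp (hM hr)
  rw [map_sum, Finset.sum_mul]
  exact Finset.sum_eq_zero fun j _ => by rw [map_mul, mul_assoc, h j, mul_zero]

/-- Converse of `exists_zigzag`: the zigzag condition in row ∅ at the complement of j says that ±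
g_j times the start is an l-combination. -/
lemma zigzag_smul_mem {l g : Fin n → RingB k n} {x : Finset (Fin n) → Finset (Fin n) → RingB k n}
    (hx : x ∈ zigzag l g (RingB k n)) (j : Fin n) :
    g j • x ∅ Finset.univ ∈ kimg l (RingB k n) := by
  have h1 : koszulD g (x ∅) (Finset.univ.erase j) =
      (g j * ksign (RingB k n) j Finset.univ) • x ∅ Finset.univ := by
    rw [koszulD_apply, Finset.sum_eq_single j, if_neg (Finset.notMem_erase j _),
      Finset.insert_erase (Finset.mem_univ j), ksign_erase]
    · intro i _ hi
      rw [if_pos (Finset.mem_erase.mpr ⟨hi, Finset.mem_univ i⟩)]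
    · exact fun h => (h (Finset.mem_univ j)).elim
  rw [← hx.2 ∅, koszulD_swap] at h1
  have h2 : (g j * ksign (RingB k n) j Finset.univ) • x ∅ Finset.univ ∈ kimg l (RingB k n) :=
    h1 ▸ koszulD_empty_mem _ _
  have h3 := Submodule.smul_mem _ (ksign (RingB k n) j Finset.univ) h2
  rw [smul_smul, mul_left_comm, ksign_mul_self, mul_one] at h3
  exact h3

lemma pairing_end_eq_zero_iff {c N : ℕ} (hN : 0 < N) {b : RingB k n}
    (hb : ∀ m, b.coeff m ≠ 0 → m.degree + c = n * (N - 1)) :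
    pairing d c N b = 0 ↔ b ∈ kimg (powerForm k n N) (RingB k n) := by
  by_cases h0 : b = 0
  · rw [h0, map_zero]
    exact iff_of_true rfl (Submodule.zero_mem _)
  · obtain ⟨m, hm⟩ := MvPolynomial.ne_zero_iff.mp h0
    refine pairing_eq_zero_iff (e := m.degree) hN (fun m' hm' => ?_) (hb m hm)
    have := hb m hm
    have := hb m' hm'
    omega

/-- The zigzags between `𝒜_i` and `F_0^*`. -/
def strandZigzag (φ : Matrix (Fin (n + 1)) (Fin n) (RingR k n)) (d : Fin n → ℕ) (i N : ℕ) :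
    Submodule (RingS k n) (Finset (Fin n) → Finset (Fin n) → RingB k n) where
  carrier := {x | x ∈ zigzag (koszulForm φ) (powerForm k n N) (RingB k n) ∧
    ∀ J L m, (x J L).coeff m ≠ 0 → m.degree + ∑ j ∈ J, d j + L.card * N = i + n * N}
  zero_mem' := ⟨zero_mem _, fun J L m h => absurd (MvPolynomial.coeff_zero m) h⟩
  add_mem' := by
    rintro x y ⟨hx, hx'⟩ ⟨hy, hy'⟩
    refine ⟨add_mem hx hy, fun J L m h => ?_⟩
    by_cases h1 : (x J L).coeff m = 0
    · by_cases h2 : (y J L).coeff m = 0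
      · refine absurd ?_ h
        change (x J L + y J L).coeff m = 0
        rw [MvPolynomial.coeff_add, h1, h2, add_zero]
      · exact hy' J L m h2
    · exact hx' J L m h1
  smul_mem' := by
    rintro a x ⟨hx, hx'⟩
    refine ⟨?_, fun J L m h => hx' J L m fun h0 => h ?_⟩
    · have : a • x = (MvPolynomial.C a : RingB k n) • x := by
        ext1 J; ext1 L
        change a • x J L = MvPolynomial.C a * x J L
        rw [MvPolynomial.C_mul']
      rw [this]
      exact Submodule.smul_mem _ _ hx
    · change (a • x J L).coeff m = 0
      rw [MvPolynomial.coeff_smul, h0, smul_zero]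

/-- The start of a zigzag, in `Sym_R(I)`. -/
def zigzagStart (f : Fin (n + 1) → RingR k n) (φ : Matrix (Fin (n + 1)) (Fin n) (RingR k n))
    (d : Fin n → ℕ) (i N : ℕ) : strandZigzag φ d i N →ₗ[RingS k n] SymI f :=
  (presMap f).toLinearMap ∘ₗ LinearMap.proj Finset.univ ∘ₗ LinearMap.proj ∅ ∘ₗ
    (strandZigzag φ d i N).subtype

/-- The end of a zigzag, as a functional on `F_0`. -/
def zigzagEnd (φ : Matrix (Fin (n + 1)) (Fin n) (RingR k n))
    (d : Fin n → ℕ) (c i N : ℕ) :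
    strandZigzag φ d i N →ₗ[RingS k n] Module.Dual (RingS k n) (StrandMod k d c 0) :=
  pairing d c N ∘ₗ LinearMap.proj ∅ ∘ₗ LinearMap.proj Finset.univ ∘ₗ
    (strandZigzag φ d i N).subtype

lemma zigzagStart_apply {i N : ℕ} (x : strandZigzag φ d i N) :
    zigzagStart f φ d i N x = presMap f (x.1 ∅ Finset.univ) := rfl

lemma zigzagEnd_apply {c i N : ℕ} (x : strandZigzag φ d i N) :
    zigzagEnd φ d c i N x = pairing d c N (x.1 Finset.univ ∅) := rfl

lemma degree_start {i N : ℕ} (x : strandZigzag φ d i N) (m : Fin n →₀ ℕ)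
    (hm : (x.1 ∅ Finset.univ).coeff m ≠ 0) : m.degree = i := by
  have := x.2.2 _ _ m hm
  rw [Finset.sum_empty, Finset.card_univ, Fintype.card_fin] at this
  omega

lemma degree_end {c i N : ℕ} (hic : i + c + n = ∑ j, d j) (hN : 0 < N) (x : strandZigzag φ d i N)
    (m : Fin n →₀ ℕ) (hm : (x.1 Finset.univ ∅).coeff m ≠ 0) : m.degree + c = n * (N - 1) := by
  have := x.2.2 _ _ m hm
  rw [Finset.card_empty, zero_mul, ← hic] at this
  obtain ⟨M, rfl⟩ : ∃ M, N = M + 1 := ⟨N - 1, by omega⟩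
  rw [Nat.add_sub_cancel]
  rw [mul_add] at this
  omega

lemma zcomp_mem_strandZigzag {γ : ℤ → ℤ → RingB k n →+ RingB k n} (hγ : IsComponentSystem γ)
    (hγ' : ∀ e τ b m, (γ e τ b).coeff m ≠ 0 → (m.degree : ℤ) = e)
    (hφ : ∀ i j, (φ i j).IsHomogeneous (d j)) (i N : ℕ) (τ : ℤ)
    {x : Finset (Fin n) → Finset (Fin n) → RingB k n}
    (hx : x ∈ zigzag (koszulForm φ) (powerForm k n N) (RingB k n)) :
    zcomp γ d (fun _ => N) 1 0 ((i + n * N : ℕ) : ℤ) τ x ∈ strandZigzag φ d i N := by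
  refine ⟨hγ.zcomp_mem_zigzag (isBihom_koszulForm hφ) (isBihom_powerForm N) _ _ hx,
    fun J L m hm => ?_⟩
  have := hγ' _ _ _ _ hm
  rw [Finset.sum_const, nsmul_eq_mul] at this
  zify
  push_cast at this
  linarith

lemma isBihom_coeff_bcompHom (e τ : ℤ) (b : RingB k n) (m : Fin n →₀ ℕ)
    (h : (bcompHom e τ b).coeff m ≠ 0) : (m.degree : ℤ) = e :=
  (isBihom_bcomp e τ b).degree_eq h

lemma coeff_xcompHom_ne_zero (e : ℤ) (b : RingB k n) (m : Fin n →₀ ℕ)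
    (h : (xcompHom e b).coeff m ≠ 0) : (m.degree : ℤ) = e := by
  rw [coeff_xcompHom] at h
  by_contra hc
  exact h (if_neg hc)

/-- The chase is symmetric in the two Koszul complexes: the start vanishes in B/(l) exactly when the
end vanishes in B/(x^N). -/
lemma ker_zigzagStart_eq
    (hpres : ∀ v : Fin (n + 1) → RingR k n,
      ∑ i, v i * f i = 0 ↔ ∃ w : Fin n → RingR k n, φ.mulVec w = v)
    (hl : ∀ t, 1 ≤ t → KoszulExact (koszulForm φ) (RingB k n) t)
    {c i N : ℕ} (hic : i + c + n = ∑ j, d j) (hN : c < N) :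
    LinearMap.ker (zigzagEnd φ d c i N) = LinearMap.ker (zigzagStart f φ d i N) := by
  ext x
  rw [LinearMap.mem_ker, LinearMap.mem_ker, zigzagStart_apply, zigzagEnd_apply,
    presMap_eq_zero_iff_mem_kimg f φ hpres]
  rw [pairing_end_eq_zero_iff (by omega) (degree_end hic (by omega) x)]
  exact ⟨zigzag_end_mem (fun t ht => koszulExact_powerForm N t ht) (swap_mem_zigzag x.2.1),
    zigzag_end_mem hl x.2.1⟩

/-- A functional in the kernel is represented by some b with l_j b ∈ (x^N) for all j, and such a b
is the end of a zigzag; its x-homogeneous component keeps the end b and has the required degrees. -/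
lemma range_zigzagEnd
    (hφ : ∀ i j, (φ i j).IsHomogeneous (d j))
    {c i N : ℕ} (hic : i + c + n = ∑ j, d j) (hN : c < N) :
    LinearMap.range (zigzagEnd φ d c i N) = LinearMap.ker (strandDual φ d c) := by
  have hN0 : 0 < N := by omega
  ext v
  constructor
  · rintro ⟨x, rfl⟩
    rw [zigzagEnd_apply, pairing_mem_ker_iff hφ hN0 (degree_end hic hN0 x)]
    exact fun j => zigzag_smul_mem (l := powerForm k n N) (g := koszulForm φ)
      (x := fun L J => x.1 J L) (swap_mem_zigzag x.2.1) j
  · intro hv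
    obtain ⟨b, hb, rfl⟩ := exists_pairing_eq hN v
    rw [pairing_mem_ker_iff hφ hN0 hb] at hv
    obtain ⟨x, hx, rfl⟩ := exists_zigzag (fun t ht => koszulExact_powerForm N t ht) hv
    refine ⟨⟨_, zcomp_mem_strandZigzag isComponentSystem_xcompHom
      (fun e _ b m h => coeff_xcompHom_ne_zero e b m h) hφ i N 0 (swap_mem_zigzag hx)⟩, ?_⟩
    rw [zigzagEnd_apply]
    refine congrArg _ ?_
    refine xcompHom_eq_self fun m hm => ?_
    have h1 := hb m hm
    obtain ⟨M, rfl⟩ : ∃ M, N = M + 1 := ⟨N - 1, by omega⟩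
    rw [Nat.add_sub_cancel] at h1
    rw [Finset.sum_empty, ← Nat.cast_sum, ← hic]
    push_cast
    zify at h1
    linarith

/-- The choice of N makes 𝒜_i exactly the set of elements of Sym(I)_i killed by all x_j^N, that is,
the classes from which a zigzag can start. -/
lemma range_zigzagStart
    (hφ : ∀ i j, (φ i j).IsHomogeneous (d j))
    (hpres : ∀ v : Fin (n + 1) → RingR k n,
      ∑ i, v i * f i = 0 ↔ ∃ w : Fin n → RingR k n, φ.mulVec w = v)
    (hl : ∀ t, 1 ≤ t → KoszulExact (koszulForm φ) (RingB k n) t)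
    {i N : ℕ} (hN : ∀ y ∈ locCohPiece f i, ∀ j,
      algebraMap (RingR k n) (SymI f) (MvPolynomial.X j ^ N) * y = 0) :
    LinearMap.range (zigzagStart f φ d i N) = locCohPiece f i := by
  have hpow : ∀ j b, presMap f (powerForm k n N j • b) =
      algebraMap (RingR k n) (SymI f) (MvPolynomial.X j ^ N) * presMap f b := fun j b => by
    rw [smul_eq_mul, map_mul, powerForm, map_pow, presMap_X, map_pow]
  ext y
  constructor
  · rintro ⟨x, rfl⟩
    rw [zigzagStart_apply]
    refine ⟨mem_locCoh_of_pow_mul (N := N) fun j => ?_, ⟨_, (MvPolynomial.mem_homogeneousSubmodule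
      _ _).mpr (isHomogeneous_of_coeff (degree_start x)), rfl⟩⟩
    rw [← hpow, presMap_eq_zero_iff_mem_kimg f φ hpres]
    exact zigzag_smul_mem x.2.1 j
  · intro hy
    obtain ⟨b, hb, rfl⟩ := hy.2
    have hu : ∀ j, powerForm k n N j • b ∈ kimg (koszulForm φ) (RingB k n) := fun j => by
      rw [← presMap_eq_zero_iff_mem_kimg f φ hpres, hpow]
      exact hN _ hy j
    obtain ⟨x, hx, rfl⟩ := exists_zigzag hl hu
    refine ⟨⟨_, zcomp_mem_strandZigzag isComponentSystem_xcompHom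
      (fun e _ b m h => coeff_xcompHom_ne_zero e b m h) hφ i N 0 hx⟩, ?_⟩
    rw [zigzagStart_apply]
    refine congrArg (presMap f) (xcompHom_eq_self fun m hm => ?_)
    have := degree_eq_of_isHomogeneous ((MvPolynomial.mem_homogeneousSubmodule _ _).mp hb) hm
    rw [this, Finset.sum_const, Finset.sum_empty, Finset.card_univ, Fintype.card_fin]
    simp

/-- Two linear maps with the same kernel have isomorphic ranges. -/
lemma exists_rangeEquiv {A Z P Q : Type*} [CommRing A] [AddCommGroup Z] [Module A Z]
    [AddCommGroup P] [Module A P] [AddCommGroup Q] [Module A Q] (α : Z →ₗ[A] P) (β : Z →ₗ[A] Q)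
    (h : LinearMap.ker β = LinearMap.ker α) {P' : Submodule A P} {Q' : Submodule A Q}
    (hP : LinearMap.range α = P') (hQ : LinearMap.range β = Q') :
    ∃ e : Q' ≃ₗ[A] P', ∀ (z : Z) (q : Q'), q.1 = β z → (e q).1 = α z := by
  subst hP hQ
  refine ⟨β.quotKerEquivRange.symm ≪≫ₗ Submodule.quotEquivOfEq _ _ h ≪≫ₗ α.quotKerEquivRange,
    fun z q hq => ?_⟩
  have h1 : q = β.quotKerEquivRange (Submodule.Quotient.mk z) := Subtype.ext hq
  rw [h1, LinearEquiv.trans_apply, LinearEquiv.trans_apply, LinearEquiv.symm_apply_apply]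
  rfl

lemma single_mem_degFree {ι : Type*} [DecidableEq ι] (t : ℤ) (p : ι) :
    (Pi.single p 1 : ι → RingS k n) ∈ degFree (k := k) (n := n) t t := by
  intro q
  rw [sub_self]
  by_cases h : q = p
  · subst h; rw [Pi.single_eq_same]; exact one_mem_degS
  · rw [Pi.single_eq_of_ne h]; exact zero_mem_degS 0

lemma coeff_mul_mem_degS {b b' : RingB k n} {s t : ℤ} (hb : ∀ m, b.coeff m ∈ degS k n s)
    (hb' : ∀ m, b'.coeff m ∈ degS k n t) (m : Fin n →₀ ℕ) : (b * b').coeff m ∈ degS k n (s + t) := by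
  classical
  rw [MvPolynomial.coeff_mul]
  exact sum_mem_degS fun x _ => mul_mem_degS (hb _) (hb' _)

lemma tcomp_eq_self {j : ℤ} {p : RingS k n} (hp : p ∈ degS k n j) : tcomp j p = p := by
  ext m
  rw [coeff_tcomp]
  split_ifs with h
  · rfl
  · by_contra h0
    exact h (mem_degS_iff.mp hp m (Ne.symm h0))

lemma pairing_mem_degDual {c N : ℕ} {b : RingB k n} {j : ℤ} (hb : ∀ m, b.coeff m ∈ degS k n j) :
    pairing d c N b ∈ degDual (degFree 0) j := by
  intro m z hz
  rw [pairing_apply, ← toKoszul_empty]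
  exact coeff_mul_mem_degS hb
    (coeff_toKoszul_mem_degS (fun p => by have := hz p; rwa [sub_zero] at this) _) _

/-- The duality between the strand of degree `c = δ - i` and `𝒜_i`. -/
theorem exists_ker_strandDual_equiv (hφ : ∀ i j, (φ i j).IsHomogeneous (d j))
    (hpres : ∀ v : Fin (n + 1) → RingR k n,
      ∑ i, v i * f i = 0 ↔ ∃ w : Fin n → RingR k n, φ.mulVec w = v)
    (hl : ∀ t, 1 ≤ t → KoszulExact (koszulForm φ) (RingB k n) t)
    {i c : ℕ} (hic : i + c + n = ∑ j, d j) :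
    ∃ e : LinearMap.ker (strandDual φ d c) ≃ₗ[RingS k n] locCohPiece f i,
      ∀ (j : ℤ) (x : LinearMap.ker (strandDual φ d c)),
        x.1 ∈ degDual (degFree 0) j ↔ (e x).1 ∈ shift (degSym f i) n j := by
  obtain ⟨N', hN'⟩ := exists_pow_mul_eq_zero f i (by
    rw [← (isStrandResolution f hφ hpres hl i).aug_range]
    exact Module.Finite.iff_fg.mp (Module.Finite.range (strandAug f d i)))
  -- N is large enough both to kill 𝒜_i and to make every monomial of degree c survive modulo the
  -- powers.
  obtain ⟨N, hNdef⟩ : ∃ N, N = N' + c + 1 := ⟨_, rfl⟩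
  have hcN : c < N := by omega
  have hN : ∀ y ∈ locCohPiece f i, ∀ j,
      algebraMap (RingR k n) (SymI f) (MvPolynomial.X j ^ N) * y = 0 := fun y hy j => by
    have : (MvPolynomial.X j : RingR k n) ^ N = MvPolynomial.X j ^ (c + 1) * MvPolynomial.X j ^ N' := by
      rw [← pow_add]; congr 1; omega
    rw [this, map_mul, mul_assoc, hN' y hy j, mul_zero]
  have hker := ker_zigzagStart_eq hpres hl hic hcN
  have hrange := range_zigzagEnd hφ hic hcN
  obtain ⟨e, he⟩ := exists_rangeEquiv (A := RingS k n) (Z := strandZigzag φ d i N)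
    (P := SymI f) (Q := Module.Dual (RingS k n) (StrandMod k d c 0)) (zigzagStart f φ d i N) (zigzagEnd φ d c i N) hker
    (range_zigzagStart hφ hpres hl hN) hrange
  -- Equal kernels mean that start and end determine each other, so a change of zigzag can be tested
  -- at either side.
  have hcongr : ∀ x y : strandZigzag φ d i N,
      zigzagEnd φ d c i N x = zigzagEnd φ d c i N y ↔
        zigzagStart f φ d i N x = zigzagStart f φ d i N y := fun x y => by
    rw [← sub_eq_zero, ← map_sub, ← LinearMap.mem_ker, hker, LinearMap.mem_ker, map_sub,
      sub_eq_zero]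
  refine ⟨e, fun j v => ?_⟩
  obtain ⟨x, hx⟩ : v.1 ∈ LinearMap.range (zigzagEnd φ d c i N) := by
    rw [hrange]; exact v.2
  rw [he x v hx.symm, ← hx]
  -- The bihomogeneous component of x. Its T-degree is n + j at the start, where J = ∅, and j at the
  -- end, where J = univ has used up n forms of T-degree one.
  obtain ⟨x', hx'⟩ : ∃ x' : strandZigzag φ d i N, x'.1 =
      zcomp bcompHom d (fun _ => N) 1 0 ((i + n * N : ℕ) : ℤ) (n + j) x.1 :=
    ⟨⟨_, zcomp_mem_strandZigzag isComponentSystem_bcompHom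
      isBihom_coeff_bcompHom hφ i N (n + j) x.2.1⟩, rfl⟩
  have hstart : x'.1 ∅ Finset.univ = bcomp i (n + j) (x.1 ∅ Finset.univ) := by
    rw [hx']
    change bcomp _ _ _ = _
    congr 1
    · rw [Finset.sum_empty, Finset.sum_const, Finset.card_univ, Fintype.card_fin, nsmul_eq_mul]
      push_cast; ring
    · rw [Finset.card_empty]; push_cast; ring
  have hend : x'.1 Finset.univ ∅ = bcomp (n * (N - 1 : ℕ) - c) j (x.1 Finset.univ ∅) := by
    rw [hx']
    change bcomp _ _ _ = _
    congr 1
    · rw [Finset.sum_empty, ← Nat.cast_sum, ← hic]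
      have : N - 1 = N' + c := by omega
      rw [this]
      rw [hNdef]
      push_cast; ring
    · rw [Finset.card_univ, Fintype.card_fin, Finset.card_empty]; push_cast; ring
  have hend' : zigzagEnd φ d c i N x' ∈ degDual (degFree 0) j := by
    rw [zigzagEnd_apply, hend]
    exact pairing_mem_degDual fun m => (isBihom_bcomp _ _ _).coeff_mem_degS m
  have hstart' : zigzagStart f φ d i N x' ∈ shift (degSym f i) n j := by
    rw [zigzagStart_apply, hstart]
    exact ⟨_, ⟨isHomogeneous_of_coeff fun m hm => by
      exact_mod_cast (isBihom_bcomp _ _ _).degree_eq hm,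
      fun m => (isBihom_bcomp _ _ _).coeff_mem_degS m⟩, rfl⟩
  constructor
  · intro hj
    -- Values on basis vectors are coefficients of the end entry; if they have T-degree j, passing
    -- to the component does not change them.
    have : zigzagEnd φ d c i N x = zigzagEnd φ d c i N x' := by
      refine (Pi.basisFun (RingS k n) (StrandIdx d c 0)).ext fun p => ?_
      have h1 := hj 0 _ (single_mem_degFree 0 p)
      rw [add_zero, zigzagEnd_apply] at h1
      rw [Pi.basisFun_apply, zigzagEnd_apply, zigzagEnd_apply, hend]
      rw [pairing_single] at h1 ⊢
      rw [pairing_single]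
      split_ifs at h1 ⊢ with h2
      · by_cases h3 : (x.1 Finset.univ ∅).coeff (topExp n N - p.1.2) = 0
        · rw [h3, coeff_bcomp, h3]
          have : tcomp j (0 : RingS k n) = 0 := tcomp_eq_self (zero_mem_degS j)
          rw [this, ite_self]
        · have h4 := degree_end hic (by omega) x _ h3
          rw [coeff_bcomp, tcomp_eq_self h1, if_pos (by zify at h4; linarith)]
      · rfl
    rw [(hcongr x x').mp this]
    exact hstart'
  · rintro ⟨b, ⟨hb1, hb2⟩, hb⟩
    -- The start differs from the bihomogeneous representative b by an element of (l); components of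
    -- that ideal stay in it, and b is its own component.
    have : zigzagStart f φ d i N x = zigzagStart f φ d i N x' := by
      have h1 : x.1 ∅ Finset.univ - b ∈ kimg (koszulForm φ) (RingB k n) := by
        rw [← presMap_eq_zero_iff_mem_kimg f φ hpres, map_sub, hb, ← zigzagStart_apply, sub_self]
      have h2 := isComponentSystem_bcompHom.mem_kimg (isBihom_koszulForm hφ) h1 i (n + j)
      rw [map_sub, ← presMap_eq_zero_iff_mem_kimg f φ hpres, map_sub, sub_eq_zero] at h2
      have h3 : bcompHom i (n + j) b = b := IsBihom.bcomp_eq fun m m' hm => by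
        refine ⟨?_, mem_degS_iff.mp (hb2 m) m' hm⟩
        have := degree_eq_of_isHomogeneous hb1 (m := m) fun h => hm (by rw [h]; exact MvPolynomial.coeff_zero _)
        rw [this]
      rw [h3, hb] at h2
      rw [zigzagStart_apply x', hstart]
      exact h2.symm
    rw [(hcongr x x').mpr this]
    exact hend'

end Duality

/-! ### Volume forms and saturated submodules -/

section Orientation

variable {S F : Type*} [CommRing S] [AddCommGroup F] [Module S F]

lemma topForm_of_mem (η : TopOrientation S F) (x : ⋀[S]^(Module.finrank S F) F) :
    topForm η (x : ExteriorAlgebra S F) = η x := by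
  change η _ = η x
  congr 1
  exact Subtype.ext (DirectSum.decompose_of_mem_same (fun i : ℕ => ⋀[S]^i F) x.2)

lemma topForm_of_mem_ne (η : TopOrientation S F) {p : ℕ} {x : ExteriorAlgebra S F}
    (hx : x ∈ ⋀[S]^p F) (hp : p ≠ Module.finrank S F) : topForm η x = 0 := by
  change η _ = 0
  rw [← map_zero η]
  congr 1
  exact Subtype.ext (DirectSum.decompose_of_mem_ne (fun i : ℕ => ⋀[S]^i F) hx hp)

/-- The volume form of an orientation. -/
def volForm (η : TopOrientation S F) (m : ℕ) : F [⋀^Fin m]→ₗ[S] S :=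
  (topForm η).compAlternatingMap (ExteriorAlgebra.ιMulti S m)

lemma volForm_apply (η : TopOrientation S F) {m : ℕ} (u : Fin m → F) :
    volForm η m u = topForm η (ExteriorAlgebra.ιMulti S m u) := rfl

lemma ιMulti_append {p q : ℕ} (v : Fin p → F) (w : Fin q → F) :
    ExteriorAlgebra.ιMulti S (p + q) (Fin.append v w) =
      ExteriorAlgebra.ιMulti S p v * ExteriorAlgebra.ιMulti S q w := by
  rw [ExteriorAlgebra.ιMulti_apply, ExteriorAlgebra.ιMulti_apply, ExteriorAlgebra.ιMulti_apply,
    ← List.prod_append, ← List.ofFn_fin_append]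
  congr 2
  funext i
  refine Fin.addCases (fun j => ?_) (fun j => ?_) i
  · simp
  · simp

lemma ιMulti_one_eq (x : F) : ExteriorAlgebra.ιMulti S 1 (fun _ => x) = ExteriorAlgebra.ι S x := by
  rw [ExteriorAlgebra.ιMulti_apply]
  simp

/-- The volume form is a unit multiple of the determinant. -/
lemma exists_isUnit_volForm [Nontrivial S] [Module.Free S F] [Module.Finite S F]
    (η : TopOrientation S F) {m : ℕ} (b : Module.Basis (Fin m) S F) :
    IsUnit (volForm η m b) ∧ ∀ u, volForm η m u = volForm η m b * b.det u := by
  have hm : Module.finrank S F = m := by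
    rw [Module.finrank_eq_card_basis b, Fintype.card_fin]
  subst hm
  have h1 := (volForm η (Module.finrank S F)).eq_smul_basis_det b
  refine ⟨?_, fun u => (congrArg (fun M => M u) h1).trans rfl⟩
  have h2 : (η : ⋀[S]^(Module.finrank S F) F →ₗ[S] S) =
      exteriorPower.alternatingMapLinearEquiv (volForm η (Module.finrank S F)) := by
    refine exteriorPower.linearMap_ext ?_
    ext u
    rw [LinearMap.compAlternatingMap_apply, LinearMap.compAlternatingMap_apply,
      exteriorPower.alternatingMapLinearEquiv_apply_ιMulti, volForm_apply]
    exact (topForm_of_mem η (exteriorPower.ιMulti S _ u)).symm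
  obtain ⟨x, hx⟩ := η.surjective 1
  have h3 : volForm η (Module.finrank S F) b *
      exteriorPower.alternatingMapLinearEquiv b.det x = 1 := by
    rw [← hx]
    change _ = (η : ⋀[S]^(Module.finrank S F) F →ₗ[S] S) x
    rw [h2]
    conv_rhs => rw [h1]
    rw [map_smul]
    rfl
  exact IsUnit.of_mul_eq_one _ h3

variable [IsDomain S]

/-- A family of vectors whose volume lies in a prime ideal is dependent modulo this ideal. -/
lemma exists_sum_smul_mem [Module.Free S F] [Module.Finite S F]
    (η : TopOrientation S F) {m : ℕ} (b : Module.Basis (Fin m) S F) (P : Ideal S) [P.IsPrime]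
    {u : Fin m → F} (h : volForm η m u ∈ P) :
    ∃ c : Fin m → S, (∃ i, c i ∉ P) ∧ ∀ j, b.repr (∑ i, c i • u i) j ∈ P := by
  obtain ⟨h1, h2⟩ := exists_isUnit_volForm η b
  rw [h2, Ideal.unit_mul_mem_iff_mem P h1, Module.Basis.det_apply] at h
  have h3 : ((b.toMatrix u).map (Ideal.Quotient.mk P)).det = 0 := by
    rw [← RingHom.mapMatrix_apply, ← RingHom.map_det]
    exact Ideal.Quotient.eq_zero_iff_mem.mpr h
  obtain ⟨v, hv, hv'⟩ := Matrix.exists_mulVec_eq_zero_iff.mpr h3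
  choose c hc using fun i => Ideal.Quotient.mk_surjective (v i)
  refine ⟨c, ?_, fun j => ?_⟩
  · obtain ⟨i, hi⟩ := Function.ne_iff.mp hv
    exact ⟨i, fun h => hi (by rw [← hc]; exact Ideal.Quotient.eq_zero_iff_mem.mpr h)⟩
  · have h4 := congrFun hv' j
    rw [Matrix.mulVec, dotProduct] at h4
    rw [← Ideal.Quotient.eq_zero_iff_mem, map_sum, Finsupp.finsetSum_apply, map_sum]
    refine Eq.trans (Finset.sum_congr rfl fun i _ => ?_) h4
    rw [map_smul, Finsupp.smul_apply, smul_eq_mul, map_mul, hc, mul_comm]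
    rfl

lemma volForm_ne_zero [Module.Free S F] [Module.Finite S F] (η : TopOrientation S F) {m : ℕ}
    (hm : Module.finrank S F = m) {u : Fin m → F} (hu : LinearIndependent S u) :
    volForm η m u ≠ 0 := by
  intro h
  let b := Module.finBasisOfFinrankEq S F hm
  obtain ⟨c, ⟨i, hi⟩, hc⟩ := exists_sum_smul_mem η b ⊥ (u := u) (h ▸ Submodule.zero_mem _)
  refine hi ?_
  have h1 : ∑ i, c i • u i = 0 := by
    refine b.repr.injective (Finsupp.ext fun j => ?_)
    rw [map_zero]
    exact hc j
  exact Fintype.linearIndependent_iff.mp hu c h1 i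

lemma exists_linearIndependent_append [Module.Finite S F] {p : ℕ} {v : Fin p → F}
    (hv : LinearIndependent S v) (q : ℕ) (hq : p + q ≤ Module.finrank S F) :
    ∃ w : Fin q → F, LinearIndependent S (Fin.append v w) := by
  induction q with
  | zero =>
    refine ⟨Fin.elim0, ?_⟩
    have : Fin.append v (Fin.elim0 : Fin 0 → F) = v := by
      funext i
      exact Fin.append_left v Fin.elim0 i
    rwa [this]
  | succ q ih =>
    obtain ⟨w, hw⟩ := ih (by omega)
    obtain ⟨x, hx⟩ := exists_linearIndependent_snoc_of_lt_finrank hw (by omega)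
    exact ⟨Fin.snoc w x, by rw [Fin.append_snoc]; exact hx⟩

/-- A maximal independent family of a submodule. -/
lemma exists_linearIndependent_mem (K : Submodule S F) :
    ∃ v : Fin (Module.finrank S K) → F, LinearIndependent S v ∧ ∀ i, v i ∈ K := by
  obtain ⟨v, hv⟩ := exists_linearIndependent_of_le_finrank (R := S) (M := K) le_rfl
  exact ⟨fun i => v i, hv.map' K.subtype K.ker_subtype, fun i => (v i).2⟩

/-- A saturated submodule of a free module is not degenerate modulo any prime. -/
lemma exists_not_dvd_volForm [UniqueFactorizationMonoid S] [Module.Free S F] [Module.Finite S F]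
    (η : TopOrientation S F) (K : Submodule S F)
    (hK : ∀ s : S, s ≠ 0 → ∀ x, s • x ∈ K → x ∈ K) {p q : ℕ} (hp : Module.finrank S K = p)
    (hpq : p + q = Module.finrank S F) {π : S} (hπ : Prime π) :
    ∃ (v : Fin p → F) (w : Fin q → F), (∀ i, v i ∈ K) ∧
      ¬π ∣ topForm η (ExteriorAlgebra.ιMulti S p v * ExteriorAlgebra.ιMulti S q w) := by
  classical
  let b := Module.finBasisOfFinrankEq S F hpq.symm
  have hP : (Ideal.span {π}).IsPrime := (Ideal.span_singleton_prime hπ.ne_zero).mpr hπ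
  -- Descent on the power of π dividing the volume: as long as π divides it, one vector is replaced
  -- so that the volume loses a factor π, with the first p vectors kept in K.
  have key : ∀ (e : ℕ) (u : Fin (p + q) → F), (∀ i, u (Fin.castAdd q i) ∈ K) →
      ¬π ^ e ∣ volForm η (p + q) u →
      ∃ u' : Fin (p + q) → F, (∀ i, u' (Fin.castAdd q i) ∈ K) ∧ ¬π ∣ volForm η (p + q) u' := by
    intro e
    induction e with
    | zero => exact fun u _ h => absurd (by rw [pow_zero]; exact one_dvd _) h
    | succ e ih =>
      intro u hu hdvd
      by_cases hd : π ∣ volForm η (p + q) u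
      swap
      · exact ⟨u, hu, hd⟩
      obtain ⟨c, ⟨i, hi⟩, hc⟩ := exists_sum_smul_mem η b (Ideal.span {π})
        (Ideal.mem_span_singleton.mpr hd)
      simp only [Ideal.mem_span_singleton] at hi hc
      have h1 : ∃ z, ∑ i, c i • u i = π • z := by
        choose c' hc' using hc
        refine ⟨∑ j, c' j • b j, ?_⟩
        rw [← b.sum_repr (∑ i, c i • u i), Finset.smul_sum]
        exact Finset.sum_congr rfl fun j _ => by rw [hc', mul_smul]
      -- A relation modulo π has a coefficient prime to π. If it occurs among the last q vectors,
      -- the replacement z may be arbitrary. Otherwise the last q terms are absorbed into πz, and πz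
      -- ∈ K forces z ∈ K by saturation.
      have h2 : ∃ (c : Fin (p + q) → S) (i : Fin (p + q)) (z : F), ¬π ∣ c i ∧
          ∑ i, c i • u i = π • z ∧ ∀ i', Fin.castAdd q i' = i → z ∈ K := by
        obtain ⟨z, hz⟩ := h1
        by_cases hj : ∃ j : Fin q, ¬π ∣ c (Fin.natAdd p j)
        · obtain ⟨j, hj⟩ := hj
          refine ⟨c, Fin.natAdd p j, z, hj, hz, fun i' h => ?_⟩
          exact absurd (congrArg Fin.val h) (by simp; omega)
        · push Not at hj
          choose c' hc' using hj
          have h3 : ∑ j, c (Fin.castAdd q j) • u (Fin.castAdd q j) =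
              π • (z - ∑ j, c' j • u (Fin.natAdd p j)) := by
            rw [smul_sub, ← hz, Fin.sum_univ_add, Finset.smul_sum, eq_sub_iff_add_eq]
            congr 1
            exact Finset.sum_congr rfl fun j _ => by rw [hc', mul_smul]
          refine ⟨Fin.append (fun j => c (Fin.castAdd q j)) 0, i,
            z - ∑ j, c' j • u (Fin.natAdd p j), ?_, ?_, fun _ _ => ?_⟩
          · revert hi
            refine Fin.addCases (fun j => ?_) (fun j => ?_) i
            · rw [Fin.append_left]; exact id
            · exact fun h => absurd (hc' j ▸ dvd_mul_right π _) h
          · rw [Fin.sum_univ_add, ← h3]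
            simp
          · refine hK π hπ.ne_zero _ ?_
            rw [← h3]
            exact Submodule.sum_mem _ fun j _ => Submodule.smul_mem _ _ (hu j)
      obtain ⟨c, i, z, hci, hz, hzK⟩ := h2
      -- Cramer's rule: replacing u_i by z multiplies the volume by c_i/π, with c_i prime to π.
      have h3 : π * volForm η (p + q) (Function.update u i z) = c i * volForm η (p + q) u := by
        rw [← smul_eq_mul, ← AlternatingMap.map_update_smul, ← hz, AlternatingMap.map_update_sum,
          Finset.sum_eq_single i]
        · rw [AlternatingMap.map_update_smul, Function.update_eq_self, smul_eq_mul]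
        · intro j _ hj
          rw [AlternatingMap.map_update_smul, AlternatingMap.map_update_self _ _ hj.symm, smul_zero]
        · exact fun h => absurd (Finset.mem_univ i) h
      refine ih (Function.update u i z) (fun j => ?_) fun hdvd' => hdvd ?_
      · by_cases hji : Fin.castAdd q j = i
        · rw [hji, Function.update_self]
          exact hzK j hji
        · rw [Function.update_of_ne hji]
          exact hu j
      · refine hπ.pow_dvd_of_dvd_mul_left (e + 1) hci ?_
        rw [← h3, pow_succ']
        exact mul_dvd_mul_left π hdvd'
  obtain ⟨v, hv, hvK⟩ := exists_linearIndependent_mem K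
  subst hp
  obtain ⟨w, hw⟩ := exists_linearIndependent_append hv q hpq.le
  have h0 := volForm_ne_zero η hpq.symm hw
  obtain ⟨e, he⟩ := FiniteMultiplicity.of_prime_left hπ h0
  obtain ⟨u, hu, hu'⟩ := key _ _ (fun i => by rw [Fin.append_left]; exact hvK i) he
  refine ⟨fun i => u (Fin.castAdd q i), fun j => u (Fin.natAdd _ j), hu, ?_⟩
  rwa [← ιMulti_append, ← volForm_apply, Fin.append_castAdd_natAdd]

end Orientation

/-! ### Proportional alternating maps and the construction of one multiplier -/

section Proportional

variable {S G F : Type*} [CommRing S] [IsDomain S] [AddCommGroup G] [Module S G]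
  [AddCommGroup F] [Module S F]

instance {M : Type*} [AddCommGroup M] [Module S M] [Module.Free S M] :
    Module.Free S (ExteriorAlgebra S M) := by
  classical
  have ⟨I, b⟩ := Module.Free.exists_basis S M
  let : LinearOrder I := linearOrderOfSTO WellOrderingRel
  exact Module.Free.of_basis b.ExteriorAlgebra

/-- Relations modulo the kernel of a linear map. -/
lemma exists_smul_eq_sum_add [Module.Finite S F] [IsNoetherianRing S] {α : G →ₗ[S] F} {r : ℕ}
    (hr : rk α = r) {y : Fin r → G} (hy : LinearIndependent S (fun i => α (y i))) (g : G) :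
    ∃ (D : S) (c : Fin r → S), D ≠ 0 ∧ D • g - ∑ j, c j • y j ∈ LinearMap.ker α := by
  let Y : Fin (r + 1) → LinearMap.range α :=
    Fin.snoc (fun i => ⟨α (y i), y i, rfl⟩) ⟨α g, g, rfl⟩
  have h1 : ¬LinearIndependent S Y := fun h => by
    have := h.fintype_card_le_finrank
    rw [Fintype.card_fin] at this
    have : r + 1 ≤ rk α := this
    omega
  obtain ⟨c, hc, i, hi⟩ := Fintype.not_linearIndependent_iff.mp h1
  have h2 := congrArg (LinearMap.range α).subtype hc
  rw [map_sum, Fin.sum_univ_castSucc] at h2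
  simp only [map_smul, Y, Fin.snoc_castSucc, Fin.snoc_last, Submodule.subtype_apply,
    map_zero] at h2
  refine ⟨c (Fin.last r), fun j => -c j.castSucc, fun h0 => ?_, ?_⟩
  · rw [h0, zero_smul, add_zero] at h2
    have h3 := Fintype.linearIndependent_iff.mp hy _ h2
    refine hi ?_
    refine Fin.lastCases h0 (fun j => h3 j) i
  · rw [LinearMap.mem_ker, map_sub, map_sum, map_smul]
    simp only [neg_smul, map_neg, map_smul, Finset.sum_neg_distrib, sub_neg_eq_add]
    rw [add_comm]
    exact h2

/-- The value of an alternating map on linear combinations of `r` vectors. -/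
lemma alternatingMap_sum_smul {N : Type*} [AddCommGroup N] [Module S N] {r : ℕ}
    (M : G [⋀^Fin r]→ₗ[S] N) (y : Fin r → G) (c : Fin r → Fin r → S) :
    M (fun i => ∑ j, c i j • y j) = (Matrix.of c).det • M y := by
  let T : (Fin r → S) →ₗ[S] G := Fintype.linearCombination S y
  have h : M.compLinearMap T =
      (LinearMap.toSpanSingleton S N (M y)).compAlternatingMap (Pi.basisFun S (Fin r)).det := by
    refine Module.Basis.ext_alternating (Pi.basisFun S (Fin r)) fun v hv => ?_
    obtain ⟨σ, rfl⟩ : ∃ σ : Equiv.Perm (Fin r), v = σ :=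
      ⟨Equiv.ofBijective v (Finite.injective_iff_bijective.mp hv), rfl⟩
    have h1 := (M.compLinearMap T).map_perm (Pi.basisFun S (Fin r)) σ
    have h2 := ((LinearMap.toSpanSingleton S N (M y)).compAlternatingMap
      (Pi.basisFun S (Fin r)).det).map_perm (Pi.basisFun S (Fin r)) σ
    refine h1.trans (Eq.trans ?_ h2.symm)
    congr 1
    rw [LinearMap.compAlternatingMap_apply, Module.Basis.det_self, LinearMap.toSpanSingleton_apply,
      one_smul, AlternatingMap.compLinearMap_apply]
    congr 1
    funext i
    change Fintype.linearCombination S y _ = _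
    rw [Pi.basisFun_apply, Fintype.linearCombination_apply_single, one_smul]
  have h3 := congrArg (fun A => A c) h
  simp only [AlternatingMap.compLinearMap_apply, LinearMap.compAlternatingMap_apply,
    LinearMap.toSpanSingleton_apply, Pi.basisFun_det_apply] at h3
  exact h3

/-- An alternating map which vanishes when an argument lies in a submodule only depends on the
arguments modulo the submodule. -/
lemma alternatingMap_add_mem {N : Type*} [AddCommGroup N] [Module S N] {r : ℕ}
    (M : G [⋀^Fin r]→ₗ[S] N) (K : Submodule S G) (hM : ∀ g i, g i ∈ K → M g = 0)
    (g z : Fin r → G) (hz : ∀ i, z i ∈ K) : M (g + z) = M g := by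
  classical
  have h := M.toMultilinearMap.map_add_univ g z
  refine h.trans ?_
  rw [Finset.sum_eq_single Finset.univ]
  · rw [Finset.piecewise_univ]; rfl
  · intro s _ hs
    obtain ⟨i, hi⟩ : ∃ i, i ∉ s := by
      by_contra hc
      push Not at hc
      exact hs (Finset.eq_univ_iff_forall.mpr hc)
    refine hM _ i ?_
    rw [Finset.piecewise_eq_of_notMem _ _ _ hi]
    exact hz i
  · exact fun h => absurd (Finset.mem_univ _) h

/-- Up to the denominators D_i the vectors g_i are combinations of the y_j modulo K, so M(g) is a
determinant times M(y). The determinant does not depend on M, which is the source of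
proportionality. -/
lemma alternatingMap_prod_smul {N : Type*} [AddCommGroup N] [Module S N] {r : ℕ} {K : Submodule S G}
    (M : G [⋀^Fin r]→ₗ[S] N) (hM : ∀ g i, g i ∈ K → M g = 0) {g y : Fin r → G}
    {D : Fin r → S} {e : Fin r → Fin r → S} (he : ∀ i, D i • g i - ∑ j, e i j • y j ∈ K) :
    (∏ i, D i) • M g = (Matrix.of e).det • M y := by
  rw [← alternatingMap_sum_smul]
  refine (M.toMultilinearMap.map_smul_univ D g).symm.trans ?_
  rw [← alternatingMap_add_mem M K hM (fun i => ∑ j, e i j • y j)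
    (fun i => D i • g i - ∑ j, e i j • y j) he]
  change M _ = M _
  congr 1
  funext i
  simp

/-- Two alternating maps in `rk α` variables which factor through the image of `α` are
proportional. -/
lemma alternatingMap_proportional [Module.Finite S F] [IsNoetherianRing S] {α : G →ₗ[S] F} {r : ℕ}
    (hr : rk α = r) {y : Fin r → G} (hy : LinearIndependent S (fun i => α (y i)))
    {N : Type*} [AddCommGroup N] [Module S N] [Module.IsTorsionFree S N]
    (M : G [⋀^Fin r]→ₗ[S] N) (hM : ∀ g i, g i ∈ LinearMap.ker α → M g = 0)
    (c : G [⋀^Fin r]→ₗ[S] S) (hc : ∀ g i, g i ∈ LinearMap.ker α → c g = 0) (g : Fin r → G) :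
    c g • M y = c y • M g := by
  choose D e hD he using fun i => exists_smul_eq_sum_add hr hy (g i)
  have h1 := alternatingMap_prod_smul M hM he
  have h2 := alternatingMap_prod_smul c hc he
  have h3 : (∏ i, D i) ≠ 0 := Finset.prod_ne_zero_iff.mpr fun i _ => hD i
  refine smul_right_injective N h3 ?_
  change (∏ i, D i) • c g • M y = (∏ i, D i) • c y • M g
  rw [smul_comm _ (c y), h1, smul_smul, ← smul_eq_mul, h2, smul_smul, smul_eq_mul, mul_comm]

/-- In a free module over a UFD, an element which becomes divisible by `p` after multiplication
with elements without common prime factor is divisible by `p`. -/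
lemma exists_eq_smul_of_forall [UniqueFactorizationMonoid S] {N : Type*} [AddCommGroup N]
    [Module S N] [Module.Free S N] (C : Set S) (hC : ∀ π, Prime π → ∃ c ∈ C, ¬π ∣ c) (p : S)
    (hp : p ≠ 0) (m : N) (h : ∀ c ∈ C, ∃ m', c • m = p • m') : ∃ m', m = p • m' := by
  induction p using UniqueFactorizationMonoid.induction_on_prime generalizing m with
  | h₁ => exact absurd rfl hp
  | h₂ x hx =>
    obtain ⟨u, rfl⟩ := hx
    exact ⟨(u⁻¹ : Sˣ) • m, by rw [← Units.smul_def, smul_inv_smul]⟩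
  | h₃ a π ha hπ ih =>
    obtain ⟨c, hc, hcπ⟩ := hC π hπ
    have h1 : ∃ m', m = π • m' := by
      obtain ⟨m', hm'⟩ := h c hc
      let b := Module.Free.chooseBasis S N
      have h2 : ∀ j, π ∣ b.repr m j := fun j => by
        have h3 := congrArg (fun x => b.repr x j) hm'
        simp only [map_smul, Finsupp.smul_apply, smul_eq_mul, mul_assoc] at h3
        exact (hπ.dvd_or_dvd (Dvd.intro _ h3.symm)).resolve_left hcπ
      choose q hq using h2
      refine ⟨b.repr.symm (Finsupp.onFinset (b.repr m).support q fun j hj => ?_), ?_⟩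
      · rw [Finsupp.mem_support_iff, hq]
        exact mul_ne_zero hπ.ne_zero hj
      · refine b.repr.injective (Finsupp.ext fun j => ?_)
        rw [map_smul, LinearEquiv.apply_symm_apply, Finsupp.smul_apply, Finsupp.onFinset_apply,
          hq, smul_eq_mul]
    obtain ⟨m1, rfl⟩ := h1
    obtain ⟨m2, rfl⟩ := ih ha m1 fun c hc => by
      obtain ⟨m', hm'⟩ := h c hc
      refine ⟨m', smul_right_injective N hπ.ne_zero ?_⟩
      change π • c • m1 = π • a • m'
      rw [smul_comm, hm', mul_smul]
    exact ⟨m2, by rw [mul_smul]⟩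

lemma mul_ιMulti_eq_zero {a : ExteriorAlgebra S G} {K : Submodule S G}
    (ha : ∀ x ∈ K, a * ExteriorAlgebra.ι S x = 0) {r : ℕ} (g : Fin r → G) (i : Fin r)
    (hi : g i ∈ K) : a * ExteriorAlgebra.ιMulti S r g = 0 := by
  obtain _ | r := r
  · exact i.elim0
  have h0 : ∀ g : Fin (r + 1) → G, g 0 ∈ K → a * ExteriorAlgebra.ιMulti S (r + 1) g = 0 := by
    intro g hg
    rw [ExteriorAlgebra.ιMulti_succ_apply, ← mul_assoc, ha _ hg, zero_mul]
  by_cases h : i = 0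
  · exact h0 g (h ▸ hi)
  · have h1 := (ExteriorAlgebra.ιMulti S (r + 1)).map_swap g h
    have h2 := h0 (g ∘ Equiv.swap i 0) (by rw [Function.comp_apply, Equiv.swap_apply_right]; exact hi)
    rw [h1, mul_neg, neg_eq_zero] at h2
    exact h2

/-- The multiplier attached to a map `α` and an annihilator of the kernel of `α`. -/
theorem exists_multiplier [IsNoetherianRing S] [UniqueFactorizationMonoid S] [Module.Finite S F]
    [Module.Free S F] (ηG : TopOrientation S G) (α : G →ₗ[S] F) {a' : ExteriorAlgebra S G}
    (hker : ∀ x ∈ LinearMap.ker α, a' * ExteriorAlgebra.ι S x = 0)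
    (hne : ∃ w : Fin (rk α) → G, topForm ηG (a' * ExteriorAlgebra.ιMulti S (rk α) w) ≠ 0)
    (hprime : ∀ π : S, Prime π → ∃ w : Fin (rk α) → G,
      ¬π ∣ topForm ηG (a' * ExteriorAlgebra.ιMulti S (rk α) w)) :
    ∃ a : ⋀[S]^(rk α) F,
      (∀ x : ⋀[S]^(rk α) G, exteriorPower.map (rk α) α x =
        topForm ηG (a' * (x : ExteriorAlgebra S G)) • a) ∧
      (∀ b : ⋀[S]^(rk α) F, (∀ x : ⋀[S]^(rk α) G, exteriorPower.map (rk α) α x =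
        topForm ηG (a' * (x : ExteriorAlgebra S G)) • b) → b = a) ∧
      ∀ x, (a : ExteriorAlgebra S F) * ExteriorAlgebra.ι S (α x) = 0 := by
  let c : G [⋀^Fin (rk α)]→ₗ[S] S :=
    (topForm ηG ∘ₗ LinearMap.mulLeft S a').compAlternatingMap (ExteriorAlgebra.ιMulti S (rk α))
  have hcapp : ∀ g, c g = topForm ηG (a' * ExteriorAlgebra.ιMulti S (rk α) g) := fun _ => rfl
  let M : G [⋀^Fin (rk α)]→ₗ[S] ⋀[S]^(rk α) F := (exteriorPower.ιMulti S (rk α)).compLinearMap α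
  have hMapp : ∀ g, M g = exteriorPower.map (rk α) α (exteriorPower.ιMulti S (rk α) g) := fun g => by
    rw [exteriorPower.map_apply_ιMulti]; rfl
  have hc : ∀ g i, g i ∈ LinearMap.ker α → c g = 0 := fun g i hi => by
    rw [hcapp, mul_ιMulti_eq_zero hker g i hi, map_zero]
  have hM : ∀ g i, g i ∈ LinearMap.ker α → M g = 0 := fun g i hi =>
    (exteriorPower.ιMulti S (rk α)).map_coord_zero i (LinearMap.mem_ker.mp hi)
  obtain ⟨y, hy0⟩ := hne
  rw [← hcapp] at hy0
  -- If ∑ e_j α(y_j) = 0 with e_i ≠ 0, replacing y_i by ∑ e_j y_j ∈ ker α gives e_i c(y) = 0.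
  have hy : LinearIndependent S (fun i => α (y i)) := by
    by_contra hdep
    obtain ⟨e, he, i, hi⟩ := Fintype.not_linearIndependent_iff.mp hdep
    have h1 : e i * c y = 0 := by
      have h2 : c (Function.update y i (∑ j, e j • y j)) = 0 := by
        refine hc _ i ?_
        rw [Function.update_self, LinearMap.mem_ker, map_sum]
        simpa using he
      rw [AlternatingMap.map_update_sum, Finset.sum_eq_single i] at h2
      · rw [AlternatingMap.map_update_smul, Function.update_eq_self] at h2
        exact h2
      · intro j _ hj
        rw [AlternatingMap.map_update_smul, AlternatingMap.map_update_self _ _ hj.symm, smul_zero]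
      · exact fun h => absurd (Finset.mem_univ i) h
    exact (mul_ne_zero hi hy0) h1
  have hprop := alternatingMap_proportional rfl hy M hM c hc
  -- From c(g) M(y) = c(y) M(g) and the absence of a common prime factor of the values of c, the
  -- element M(y) is divisible by c(y); a is the quotient.
  obtain ⟨a, ha⟩ := exists_eq_smul_of_forall (Set.range c) (fun π hπ => by
    obtain ⟨w, hw⟩ := hprime π hπ
    exact ⟨c w, ⟨w, rfl⟩, hw⟩) (c y) hy0 (M y) (by
    rintro _ ⟨g, rfl⟩
    exact ⟨M g, hprop g⟩)
  have hMa : ∀ g, M g = c g • a := fun g => by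
    refine smul_right_injective _ hy0 ?_
    change c y • M g = c y • c g • a
    rw [← hprop g, ha, smul_comm]
  refine ⟨a, fun x => ?_, fun b hb => ?_, fun x => ?_⟩
  · have h1 : exteriorPower.map (rk α) α = (LinearMap.toSpanSingleton S _ a) ∘ₗ
        topForm ηG ∘ₗ LinearMap.mulLeft S a' ∘ₗ (⋀[S]^(rk α) G).subtype := by
      refine exteriorPower.linearMap_ext ?_
      ext1 g
      rw [LinearMap.compAlternatingMap_apply, ← hMapp, hMa]
      rfl
    rw [h1]
    rfl
  · refine smul_right_injective _ hy0 ?_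
    change c y • b = c y • a
    have := hb (exteriorPower.ιMulti S (rk α) y)
    rw [← ha, hMapp, this]
    rfl
  -- A wedge of rk α + 1 vectors in the image of α vanishes. As c(y) a is the wedge of the α(y_i),
  -- cancelling c(y) gives a ∧ α(x) = 0.
  · have h1 : ExteriorAlgebra.ιMulti S (rk α + 1) (Fin.append (fun i => α (y i)) fun _ => α x) = 0 := by
      refine AlternatingMap.map_linearDependent _ _ fun hli => ?_
      have h2 : LinearIndependent S fun i : Fin (rk α + 1) =>
        (⟨Fin.append (fun i => α (y i)) (fun _ => α x) i,
          Fin.addCases (fun j => by rw [Fin.append_left]; exact ⟨y j, rfl⟩)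
            (fun j => by rw [Fin.append_right]; exact ⟨x, rfl⟩) i⟩ : LinearMap.range α) :=
        LinearIndependent.of_comp (LinearMap.range α).subtype hli
      have := h2.fintype_card_le_finrank
      rw [Fintype.card_fin] at this
      have : rk α + 1 ≤ rk α := this
      omega
    rw [ιMulti_append, ιMulti_one_eq] at h1
    have h3 : (ExteriorAlgebra.ιMulti S (rk α) fun i => α (y i)) = c y • (a : ExteriorAlgebra S F) :=
      congrArg Subtype.val (hMa y)
    rw [h3, smul_mul_assoc] at h1
    exact (smul_eq_zero.mp h1).resolve_left hy0

/-- The multiplier of a map with saturated image is primitive. -/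
theorem multiplier_primitive [IsNoetherianRing S] [UniqueFactorizationMonoid S] [Module.Finite S F]
    [Module.Free S F] {ηG : TopOrientation S G} (ηF : TopOrientation S F) {α : G →ₗ[S] F}
    {a' : ExteriorAlgebra S G} {a : ⋀[S]^(rk α) F}
    (ha : ∀ x : ⋀[S]^(rk α) G, exteriorPower.map (rk α) α x =
        topForm ηG (a' * (x : ExteriorAlgebra S G)) • a)
    {q : ℕ} (hq : rk α + q = Module.finrank S F) :
    (∃ w : Fin q → F, topForm ηF (a * ExteriorAlgebra.ιMulti S q w) ≠ 0) ∧
      ((∀ s : S, s ≠ 0 → ∀ x, s • x ∈ LinearMap.range α → x ∈ LinearMap.range α) →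
        ∀ π : S, Prime π → ∃ w : Fin q → F,
          ¬π ∣ topForm ηF (a * ExteriorAlgebra.ιMulti S q w)) := by
  -- A wedge of rk α vectors of the image is a multiple of a, so any volume computed with it bounds
  -- the divisibility of the volumes computed with a.
  have key : ∀ (v : Fin (rk α) → F) (w : Fin q → F), (∀ i, v i ∈ LinearMap.range α) →
      topForm ηF (a * ExteriorAlgebra.ιMulti S q w) ∣
        topForm ηF (ExteriorAlgebra.ιMulti S (rk α) v * ExteriorAlgebra.ιMulti S q w) := by
    intro v w hv
    choose g hg using hv
    have h1 := congrArg Subtype.val (ha (exteriorPower.ιMulti S (rk α) g))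
    rw [exteriorPower.map_apply_ιMulti] at h1
    have h2 : ExteriorAlgebra.ιMulti S (rk α) v =
        topForm ηG (a' * ExteriorAlgebra.ιMulti S (rk α) g) • (a : ExteriorAlgebra S F) := by
      refine Eq.trans ?_ h1
      change _ = ExteriorAlgebra.ιMulti S (rk α) (α ∘ g)
      congr 1
      exact funext fun i => (hg i).symm
    rw [h2, smul_mul_assoc, map_smul]
    exact Dvd.intro_left _ rfl
  constructor
  · obtain ⟨v, hv, hvK⟩ := exists_linearIndependent_mem (LinearMap.range α)
    obtain ⟨w, hw⟩ := exists_linearIndependent_append hv q hq.le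
    refine ⟨w, fun h0 => volForm_ne_zero ηF hq.symm hw ?_⟩
    rw [volForm_apply, ιMulti_append]
    exact eq_zero_of_zero_dvd (h0 ▸ key v w hvK)
  · intro hsat π hπ
    obtain ⟨v, w, hv, hvw⟩ := exists_not_dvd_volForm ηF (LinearMap.range α) hsat rfl hq hπ
    exact ⟨w, fun h => hvw (h.trans (key v w hv))⟩

end Proportional

/-! ### Homogeneity of volumes and multipliers -/

section HomogeneousForms

variable {k : Type*} [Field k] {n : ℕ}

lemma tcomp_mul {e : ℤ} {p : RingS k n} (hp : p ∈ degS k n e) (j : ℤ) (q : RingS k n) :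
    tcomp (e + j) (p * q) = p * tcomp j q := by
  classical
  rw [mem_degS_iff] at hp
  ext m
  rw [coeff_tcomp, MvPolynomial.coeff_mul, MvPolynomial.coeff_mul]
  by_cases hm : (m.degree : ℤ) = e + j
  · rw [if_pos hm]
    refine Finset.sum_congr rfl fun x hx => ?_
    rw [Finset.HasAntidiagonal.mem_antidiagonal] at hx
    by_cases h0 : p.coeff x.1 = 0
    · rw [h0, zero_mul, zero_mul]
    · have := hp _ h0
      rw [coeff_tcomp, if_pos]
      rw [← hx, map_add] at hm
      push_cast at hm
      linarith
  · rw [if_neg hm]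
    refine (Finset.sum_eq_zero fun x hx => ?_).symm
    rw [Finset.HasAntidiagonal.mem_antidiagonal] at hx
    by_cases h0 : p.coeff x.1 = 0
    · rw [h0, zero_mul]
    · have := hp _ h0
      rw [coeff_tcomp, if_neg, mul_zero]
      intro h
      rw [← hx, map_add] at hm
      push_cast at hm
      exact hm (by linarith)

/-- If p has degree e, then p times the degree j component of q is the degree e + j component of pq.
It vanishes for e + j ≠ r, and S is a domain. -/
lemma mem_degS_of_mul_mem {e r : ℤ} {p q : RingS k n} (hp : p ∈ degS k n e) (hp0 : p ≠ 0)
    (h : p * q ∈ degS k n r) : q ∈ degS k n (r - e) := by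
  rw [mem_degS_iff]
  intro m hm
  by_contra hne
  have h1 : p * tcomp (m.degree : ℤ) q = 0 := by
    rw [← tcomp_mul hp]
    ext m'
    rw [coeff_tcomp, MvPolynomial.coeff_zero]
    split_ifs with h2
    · by_contra h3
      have := mem_degS_iff.mp h m' h3
      exact hne (by linarith)
    · rfl
  have h2 := congrArg (MvPolynomial.coeff m) ((mul_eq_zero.mp h1).resolve_left hp0)
  rw [coeff_tcomp, if_pos rfl, MvPolynomial.coeff_zero] at h2
  exact hm h2

lemma prod_mem_degS {ι : Type*} (s : Finset ι) {t : ℤ} {p : ι → RingS k n}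
    (hp : ∀ i ∈ s, p i ∈ degS k n t) : ∏ i ∈ s, p i ∈ degS k n (s.card * t) := by
  classical
  induction s using Finset.induction_on with
  | empty => simpa using one_mem_degS
  | insert a s ha ih =>
    rw [Finset.prod_insert ha, Finset.card_insert_of_notMem ha]
    have := mul_mem_degS (hp a (Finset.mem_insert_self _ _))
      (ih fun i hi => hp i (Finset.mem_insert_of_mem hi))
    have h2 : ((s.card + 1 : ℕ) : ℤ) * t = t + s.card * t := by push_cast; ring
    rwa [h2]

lemma units_smul_mem_degS (u : ℤˣ) {t : ℤ} {p : RingS k n} (hp : p ∈ degS k n t) :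
    u • p ∈ degS k n t := by
  rcases Int.units_eq_one_or u with h | h
  · rwa [h, one_smul]
  · rw [h, Units.neg_smul, one_smul]; exact neg_mem_degS hp

lemma det_mem_degS {r : ℕ} {t : ℤ} {M : Matrix (Fin r) (Fin r) (RingS k n)}
    (hM : ∀ i j, M i j ∈ degS k n t) : M.det ∈ degS k n (r * t) := by
  rw [Matrix.det_apply]
  refine sum_mem_degS fun σ _ => units_smul_mem_degS _ ?_
  have := prod_mem_degS Finset.univ (fun i _ => hM (σ i) i)
  rwa [Finset.card_univ, Fintype.card_fin] at this

/-- Units of a polynomial ring over a field are constants; hence an arbitrary orientation is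
homogeneous of degree zero. -/
lemma isUnit_mem_degS {p : RingS k n} (hp : IsUnit p) : p ∈ degS k n 0 := by
  obtain ⟨a, -, rfl⟩ := MvPolynomial.isUnit_iff_eq_C_of_isReduced.mp hp
  exact C_mem_degS a

lemma single_apply_mem_degS {ι : Type*} [DecidableEq ι] (i j : ι) :
    (Pi.single i 1 : ι → RingS k n) j ∈ degS k n 0 := by
  have := single_mem_degFree (k := k) (n := n) 0 i j
  rwa [sub_zero] at this

variable {ι κ : Type*} [Fintype ι] [DecidableEq ι] [Fintype κ] [DecidableEq κ]

/-- An element of an exterior power is homogeneous if its coordinates are. -/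
lemma mem_degExt_of_coord [LinearOrder ι] {p : ℕ} {e : ℤ} {x : ⋀[RingS k n]^p (ι → RingS k n)}
    (h : ∀ s, exteriorPower.ιMultiDual (RingS k n) p (Pi.basisFun (RingS k n) ι) s x ∈
      degS k n e) : x ∈ degExt p 0 e := by
  have h1 := ((Pi.basisFun (RingS k n) ι).exteriorPower p).sum_repr x
  rw [← h1]
  change _ ∈ AddSubgroup.closure _
  refine AddSubgroup.sum_mem _ fun s _ => ?_
  refine AddSubgroup.subset_closure ?_
  refine ⟨((Pi.basisFun (RingS k n) ι).exteriorPower p).repr x s, ?_,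
      fun q => Set.powersetCard.ofFinEmbEquiv.symm s q, ?_⟩
  · have := h s
    rw [mul_zero, sub_zero, exteriorPower.basis_repr_apply]
    exact this
  · rw [exteriorPower.basis_repr_apply, exteriorPower.basis_apply, exteriorPower.ιMulti_family]
    congr 2
    funext q
    exact Pi.basisFun_apply _ _ _

/-- The volume of a family of standard basis vectors is a constant. -/
lemma volForm_single_mem_degS (η : TopOrientation (RingS k n) (ι → RingS k n)) {m : ℕ}
    (i : Fin m → ι) : volForm η m (fun q => Pi.single (i q) 1) ∈ degS k n 0 := by
  by_cases hm : m = Module.finrank (RingS k n) (ι → RingS k n)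
  · have hm' : Fintype.card ι = m := by rw [hm, Module.finrank_fintype_fun_eq_card]
    let b := (Pi.basisFun (RingS k n) ι).reindex (Fintype.equivFinOfCardEq hm')
    obtain ⟨h1, h2⟩ := exists_isUnit_volForm η b
    rw [h2]
    have h3 : b.det (fun q => Pi.single (i q) 1) ∈ degS k n (m * 0) := by
      rw [Module.Basis.det_apply]
      refine det_mem_degS fun p q => ?_
      rw [Module.Basis.toMatrix_apply]
      have : b.repr (Pi.single (i q) 1) p =
          (Pi.single (i q) 1 : ι → RingS k n) ((Fintype.equivFinOfCardEq hm').symm p) := by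
        simp [b]
      rw [this]
      exact single_apply_mem_degS _ _
    have := mul_mem_degS (isUnit_mem_degS h1) h3
    rwa [mul_zero, add_zero] at this
  · rw [volForm_apply, topForm_of_mem_ne η (ExteriorAlgebra.ιMulti_range (RingS k n) m ⟨_, rfl⟩) hm]
    exact zero_mem_degS 0

lemma topForm_mul_mem_degS (η : TopOrientation (RingS k n) (ι → RingS k n)) {p : ℕ} {e : ℤ}
    {a : ⋀[RingS k n]^p (ι → RingS k n)} (ha : a ∈ degExt p 0 e) {q : ℕ} (i : Fin q → ι) :
    topForm η ((a : ExteriorAlgebra (RingS k n) (ι → RingS k n)) *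
      ExteriorAlgebra.ιMulti (RingS k n) q (fun j => Pi.single (i j) 1)) ∈
      degS k n e := by
  change a ∈ AddSubgroup.closure _ at ha
  induction ha using AddSubgroup.closure_induction with
  | mem x hx =>
    obtain ⟨c, hc, i', rfl⟩ := hx
    rw [mul_zero, sub_zero] at hc
    have h1 := volForm_single_mem_degS η (Fin.append i' i)
    have h2 := mul_mem_degS hc h1
    rw [add_zero] at h2
    convert h2 using 1
    have h3 : (fun q => Pi.single (Fin.append i' i q) 1 : Fin (p + q) → ι → RingS k n) =
        Fin.append (fun q => Pi.single (i' q) 1) (fun q => Pi.single (i q) 1) := by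
      funext q
      refine Fin.addCases (fun j => ?_) (fun j => ?_) q
      · simp only [Fin.append_left]
      · simp only [Fin.append_right]
    rw [volForm_apply, h3, ιMulti_append]
    change topForm η (c • ExteriorAlgebra.ιMulti _ p _ * _) = _
    rw [smul_mul_assoc, map_smul, smul_eq_mul]
  | zero =>
    rw [ZeroMemClass.coe_zero, zero_mul, map_zero]
    exact zero_mem_degS e
  | add x y _ _ hx hy =>
    rw [AddMemClass.coe_add, add_mul, map_add]
    exact add_mem_degS hx hy
  | neg x _ hx =>
    rw [NegMemClass.coe_neg, neg_mul, map_neg]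
    exact neg_mem_degS hx

/-- The multiplier attached to a linear map with linear entries is homogeneous. -/
lemma multiplier_mem_degExt (ηG : TopOrientation (RingS k n) (κ → RingS k n))
    {α : (κ → RingS k n) →ₗ[RingS k n] ι → RingS k n}
    (hα : ∀ p q, α (Pi.single p 1) q ∈ degS k n 1)
    {a' : ExteriorAlgebra (RingS k n) (κ → RingS k n)} {e : ℤ}
    (ha' : ∀ i : Fin (rk α) → κ, topForm ηG (a' * ExteriorAlgebra.ιMulti (RingS k n) (rk α)
      (fun j => Pi.single (i j) 1)) ∈ degS k n e)
    (hne : ∃ w : Fin (rk α) → (κ → RingS k n),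
      topForm ηG (a' * ExteriorAlgebra.ιMulti (RingS k n) (rk α) w) ≠ 0)
    {a : ⋀[RingS k n]^(rk α) (ι → RingS k n)}
    (ha : ∀ x : ⋀[RingS k n]^(rk α) (κ → RingS k n), exteriorPower.map (rk α) α x =
        topForm ηG (a' * (x : ExteriorAlgebra (RingS k n) (κ → RingS k n))) • a) :
    a ∈ degExt (rk α) 0 (rk α - e) := by
  classical
  let _ : LinearOrder ι := linearOrderOfSTO WellOrderingRel
  -- An alternating map that is nonzero somewhere is nonzero on some family of basis vectors, where
  -- its value is homogeneous.
  obtain ⟨i, hi⟩ : ∃ i : Fin (rk α) → κ, topForm ηG (a' * ExteriorAlgebra.ιMulti (RingS k n) (rk α)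
      (fun j => Pi.single (i j) 1)) ≠ 0 := by
    by_contra hc
    push Not at hc
    obtain ⟨w, hw⟩ := hne
    have : (topForm ηG ∘ₗ LinearMap.mulLeft (RingS k n) a').compAlternatingMap
        (ExteriorAlgebra.ιMulti (RingS k n) (rk α)) = 0 := by
      refine Module.Basis.ext_alternating (Pi.basisFun (RingS k n) κ) fun v _ => ?_
      simp only [Pi.basisFun_apply]
      exact hc v
    exact hw (congrArg (fun A => A w) this)
  have h1 := ha (exteriorPower.ιMulti (RingS k n) (rk α) fun j => Pi.single (i j) 1)
  rw [exteriorPower.map_apply_ιMulti] at h1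
  have h2 : a ∈ degExt (rk α) 0 (rk α - e) := by
    -- The coordinates of ⋀^r α on basis vectors are r-minors of a linear matrix, of degree r. They
    -- equal a nonzero form of degree e times the coordinates of a.
    refine mem_degExt_of_coord fun s => mem_degS_of_mul_mem (ha' i) hi ?_
    have h3 := congrArg (exteriorPower.ιMultiDual (RingS k n) (rk α)
      (Pi.basisFun (RingS k n) ι) s) h1
    rw [map_smul, smul_eq_mul, exteriorPower.ιMultiDual_apply_ιMulti] at h3
    refine Eq.mp (congrArg (· ∈ degS k n (rk α)) h3) ?_
    have h4 := det_mem_degS (k := k) (n := n) (r := rk α) (t := 1)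
      (M := Matrix.of fun p q => (Pi.basisFun (RingS k n) ι).coord
        (Set.powersetCard.ofFinEmbEquiv.symm s q) (α (Pi.single (i p) 1))) fun p q => by
        rw [Matrix.of_apply, Module.Basis.coord_apply, Pi.basisFun_repr]
        exact hα _ _
    rw [mul_one] at h4
    exact h4
  exact h2

end HomogeneousForms

/-! ### Downward construction of the multipliers of a linear resolution -/

section Chain

lemma rk_add_rk {S E F G : Type*} [CommRing S] [IsDomain S] [AddCommGroup E] [Module S E]
    [AddCommGroup F] [Module S F] [AddCommGroup G] [Module S G] [Module.Finite S F]
    {α : F →ₗ[S] E} {β : G →ₗ[S] F} (h : LinearMap.ker α = LinearMap.range β) :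
    rk β + rk α = Module.finrank S F := by
  have h1 : rk α + Module.finrank S (LinearMap.ker α) = Module.finrank S F := by
    rw [rk, ← α.quotKerEquivRange.finrank_eq]
    exact (LinearMap.ker α).finrank_quotient_add_finrank
  have h2 : Module.finrank S (LinearMap.ker α) = rk β := by rw [h]
  omega

lemma mem_range_of_smul_mem {S E F G : Type*} [CommRing S] [IsDomain S] [AddCommGroup E]
    [Module S E] [Module.IsTorsionFree S E] [AddCommGroup F] [Module S F] [AddCommGroup G]
    [Module S G] {α : F →ₗ[S] E} {β : G →ₗ[S] F} (h : LinearMap.ker α = LinearMap.range β)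
    (s : S) (hs : s ≠ 0) (x : F) (hx : s • x ∈ LinearMap.range β) : x ∈ LinearMap.range β := by
  rw [← h, LinearMap.mem_ker, map_smul] at hx
  rw [← h, LinearMap.mem_ker]
  exact (smul_eq_zero.mp hx).resolve_left hs

variable {k : Type*} [Field k] {n : ℕ} {ι : ℕ → Type*} [∀ t, Fintype (ι t)]
  [∀ t, DecidableEq (ι t)] (α : ∀ t, (ι (t + 1) → RingS k n) →ₗ[RingS k n] (ι t → RingS k n))
  (η : ∀ t, TopOrientation (RingS k n) (ι t → RingS k n))

/-- The degree of the multiplier `a_{t+1}` of a complex of length `N`. -/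
def multDeg (N t : ℕ) : ℤ := ∑ s ∈ Finset.range (N - t), (-1) ^ s * (rk (α (t + s)) : ℤ)

lemma multDeg_self (N : ℕ) : multDeg α N N = 0 := by
  rw [multDeg, Nat.sub_self, Finset.sum_range_zero]

/-- The recursion s_t = r_t - s_{t+1}, matching the degree of a quotient of minors of order r_t by
values of degree s_{t+1}. -/
lemma multDeg_of_lt {N t : ℕ} (h : t < N) : multDeg α N t = rk (α t) - multDeg α N (t + 1) := by
  have h1 : N - t = N - (t + 1) + 1 := by omega
  rw [multDeg, h1, Finset.sum_range_succ', multDeg, pow_zero, one_mul, add_zero, add_comm,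
    sub_eq_add_neg, ← Finset.sum_neg_distrib]
  congr 1
  refine Finset.sum_congr rfl fun s _ => ?_
  rw [pow_succ, show t + (s + 1) = t + 1 + s by ring]
  ring

/-- The properties of multipliers which are used for the construction of the next one. -/
structure IsGoodMultiplier (N t : ℕ) (A : ExteriorAlgebra (RingS k n) (ι t → RingS k n)) :
    Prop where
  ann : ∀ x, A * ExteriorAlgebra.ι (RingS k n) (α t x) = 0
  homog : ∀ (q : ℕ) (i : Fin q → ι t), topForm (η t)
    (A * ExteriorAlgebra.ιMulti (RingS k n) q (fun j => Pi.single (i j) 1)) ∈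
      degS k n (multDeg α N t)
  ne : ∀ q, rk (α t) + q = Module.finrank (RingS k n) (ι t → RingS k n) →
    ∃ w : Fin q → (ι t → RingS k n),
      topForm (η t) (A * ExteriorAlgebra.ιMulti (RingS k n) q w) ≠ 0
  -- Index 0 is excluded: the image in F_0 is not the kernel of a map of the complex. Its cokernel
  -- may have torsion, so the image need not be saturated.
  prime : 0 < t → ∀ q, rk (α t) + q = Module.finrank (RingS k n) (ι t → RingS k n) →
    ∀ π : RingS k n, Prime π → ∃ w : Fin q → (ι t → RingS k n),
      ¬π ∣ topForm (η t) (A * ExteriorAlgebra.ιMulti (RingS k n) q w)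

/-- The relation between consecutive multipliers. -/
def MultiplierRel (t : ℕ) (A' : ExteriorAlgebra (RingS k n) (ι (t + 1) → RingS k n))
    (a : ⋀[RingS k n]^(rk (α t)) (ι t → RingS k n)) : Prop :=
  ∀ x : ⋀[RingS k n]^(rk (α t)) (ι (t + 1) → RingS k n), exteriorPower.map (rk (α t)) (α t) x =
    topForm (η (t + 1)) (A' * (x : ExteriorAlgebra (RingS k n) (ι (t + 1) → RingS k n))) • a

variable {α}

/-- The modules beyond N vanish, so the map into F_N has rank zero and 1 ∈ ⋀^0 F_N is its
multiplier. Its volumes take unit values, which no prime divides. -/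
lemma isGoodMultiplier_one {N : ℕ} (hN : ∀ t, N < t → IsEmpty (ι t)) :
    IsGoodMultiplier α η N N 1 where
  ann x := by
    have : IsEmpty (ι (N + 1)) := hN (N + 1) (by omega)
    rw [Subsingleton.elim x 0, map_zero, map_zero, mul_zero]
  homog q i := by
    rw [one_mul, ← volForm_apply, multDeg_self]
    exact volForm_single_mem_degS (η N) i
  ne q hq := by
    have : IsEmpty (ι (N + 1)) := hN (N + 1) (by omega)
    have h0 : rk (α N) = 0 := by
      have : LinearMap.range (α N) = ⊥ := by
        rw [eq_bot_iff]
        rintro _ ⟨x, rfl⟩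
        rw [Subsingleton.elim x 0, map_zero]
        exact Submodule.zero_mem _
      rw [rk, this, finrank_bot]
    rw [h0, zero_add] at hq
    have h1 := (exists_isUnit_volForm (η N) (Module.finBasisOfFinrankEq _ _ hq.symm)).1
    exact ⟨_, by rw [one_mul, ← volForm_apply]; exact h1.ne_zero⟩
  prime _ q hq π hπ := by
    have : IsEmpty (ι (N + 1)) := hN (N + 1) (by omega)
    have h0 : rk (α N) = 0 := by
      have : LinearMap.range (α N) = ⊥ := by
        rw [eq_bot_iff]
        rintro _ ⟨x, rfl⟩
        rw [Subsingleton.elim x 0, map_zero]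
        exact Submodule.zero_mem _
      rw [rk, this, finrank_bot]
    rw [h0, zero_add] at hq
    have h1 := (exists_isUnit_volForm (η N) (Module.finBasisOfFinrankEq _ _ hq.symm)).1
    exact ⟨_, by
      rw [one_mul, ← volForm_apply]
      exact fun h => hπ.not_isUnit (isUnit_of_dvd_unit h h1)⟩

/-- Exactness is used three times: ker α_t is the image of the next map, hence annihilated by A';
the ranks are complementary; and for t > 0 the image of α_t is a kernel, hence saturated, so a is
again primitive. -/
lemma IsGoodMultiplier.exists_rel
    (hα : ∀ t p q, α t (Pi.single p 1) q ∈ degS k n 1)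
    (hexact : ∀ t, LinearMap.ker (α t) = LinearMap.range (α (t + 1)))
    {N t : ℕ} (ht : t < N)
    {A' : ExteriorAlgebra (RingS k n) (ι (t + 1) → RingS k n)}
    (hA' : IsGoodMultiplier α η N (t + 1) A') :
    ∃ a : ⋀[RingS k n]^(rk (α t)) (ι t → RingS k n), MultiplierRel α η t A' a ∧
      (∀ b, MultiplierRel α η t A' b → b = a) ∧ IsGoodMultiplier α η N t a ∧
      a ∈ degExt (rk (α t)) 0 (multDeg α N t) := by
  have hrk := rk_add_rk (hexact t)
  have hne := hA'.ne _ hrk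
  obtain ⟨a, ha, huniq, hann⟩ := exists_multiplier (η (t + 1)) (α t) (a' := A') (fun x hx => by
    rw [hexact] at hx
    obtain ⟨y, rfl⟩ := hx
    exact hA'.ann y) hne (hA'.prime (Nat.succ_pos t) _ hrk)
  have hdeg : a ∈ degExt (rk (α t)) 0 (multDeg α N t) := by
    rw [multDeg_of_lt α ht]
    exact multiplier_mem_degExt (η (t + 1)) (hα t) (fun i => hA'.homog _ i) hne ha
  refine ⟨a, ha, huniq, ⟨hann, fun q i => topForm_mul_mem_degS (η t) hdeg i,
    fun q hq => (multiplier_primitive (η t) ha hq).1, fun h0 q hq =>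
      (multiplier_primitive (η t) ha hq).2 ?_⟩, hdeg⟩
  obtain ⟨t, rfl⟩ := Nat.exists_eq_succ_of_ne_zero h0.ne'
  exact mem_range_of_smul_mem (hexact t)

/-- Existence, uniqueness and homogeneity of the multipliers of a linear free resolution. -/
theorem exists_isMultiplierSystem
    (hα : ∀ t p q, α t (Pi.single p 1) q ∈ degS k n 1)
    (hexact : ∀ t, LinearMap.ker (α t) = LinearMap.range (α (t + 1)))
    {N : ℕ} (hN0 : 0 < N) (hN : ∀ t, N < t → IsEmpty (ι t)) :
    ∃ a : ∀ t : Fin N, ⋀[RingS k n]^(rk (α t)) (ι t → RingS k n),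
      IsMultiplierSystem (F := fun t => ι t → RingS k n) N α η a ∧
      (∀ b : ∀ t : Fin N, ⋀[RingS k n]^(rk (α t)) (ι t → RingS k n),
        IsMultiplierSystem (F := fun t => ι t → RingS k n) N α η b → b = a) ∧
      a ⟨0, hN0⟩ ∈ degExt (rk (α 0)) 0 (multDeg α N 0) ∧
      ∀ x, (a ⟨0, hN0⟩ : ExteriorAlgebra (RingS k n) (ι 0 → RingS k n)) *
        ExteriorAlgebra.ι (RingS k n) (α 0 x) = 0 := by
  -- The family A takes values in the full exterior algebras, which avoids transporting along ranks.
  -- With A N = 1 the defining relation of the last multiplier has the same form as the others.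
  have key : ∀ s, s ≤ N → ∃ A : ∀ t, ExteriorAlgebra (RingS k n) (ι t → RingS k n),
      A N = 1 ∧ (∀ t, N ≤ t + s → t ≤ N → IsGoodMultiplier α η N t (A t)) ∧
      ∀ t, N ≤ t + s → t < N → ∃ a : ⋀[RingS k n]^(rk (α t)) (ι t → RingS k n),
        (a : ExteriorAlgebra (RingS k n) (ι t → RingS k n)) = A t ∧
        MultiplierRel α η t (A (t + 1)) a ∧
        (∀ b, MultiplierRel α η t (A (t + 1)) b → b = a) ∧
        a ∈ degExt (rk (α t)) 0 (multDeg α N t) := by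
    intro s
    induction s with
    | zero =>
      refine fun _ => ⟨fun _ => 1, rfl, fun t h1 h2 => ?_, fun t h1 h2 => by omega⟩
      obtain rfl : t = N := by omega
      exact isGoodMultiplier_one η hN
    | succ s ih =>
      intro hs
      obtain ⟨A, hA1, hA2, hA3⟩ := ih (by omega)
      obtain ⟨m, hm⟩ : ∃ m, m + s + 1 = N := ⟨N - s - 1, by omega⟩
      obtain ⟨a, ha1, ha2, ha3, ha4⟩ := (hA2 (m + 1) (by omega) (by omega)).exists_rel η hα hexact
        (by omega)
      have hself : Function.update A m (a : ExteriorAlgebra (RingS k n) (ι m → RingS k n)) m = a :=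
        Function.update_self _ _ _
      have hne : ∀ t, t ≠ m →
          Function.update A m (a : ExteriorAlgebra (RingS k n) (ι m → RingS k n)) t = A t :=
        fun t ht => Function.update_of_ne ht _ _
      refine ⟨Function.update A m a, ?_, fun t h1 h2 => ?_, fun t h1 h2 => ?_⟩
      · rw [hne N (by omega), hA1]
      · by_cases htm : t = m
        · subst htm
          rw [hself]
          exact ha3
        · rw [hne t htm]
          exact hA2 t (by omega) h2
      · rw [hne (t + 1) (by omega)]
        by_cases htm : t = m
        · subst htm
          exact ⟨a, hself.symm, ha1, ha2, ha4⟩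
        · rw [hne t htm]
          exact hA3 t (by omega) h2
  obtain ⟨A, hA1, hA2, hA3⟩ := key N le_rfl
  choose a haA harel hauniq hadeg using fun t : Fin N => hA3 t (by omega) t.2
  refine ⟨a, ⟨fun t h x => ?_, fun t h x => ?_⟩, fun b hb => ?_, hadeg ⟨0, hN0⟩, ?_⟩
  · have := harel ⟨t, by omega⟩ x
    subst h
    rw [hA1, one_mul] at this
    exact this
  · have := harel ⟨t, by omega⟩ x
    rw [haA ⟨t + 1, h⟩]
    exact this
  · have hb' : ∀ s t : ℕ, ∀ h : t < N, t + s + 1 = N → b ⟨t, h⟩ = a ⟨t, h⟩ := by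
      intro s
      induction s with
      | zero =>
        intro t h hts
        refine hauniq ⟨t, h⟩ _ fun x => ?_
        have := hb.last t hts x
        subst hts
        change _ = topForm _ (A (t + 1) * _) • _
        rw [hA1, one_mul]
        exact this
      | succ s ih =>
        intro t h hts
        refine hauniq ⟨t, h⟩ _ fun x => ?_
        have := hb.step t (by omega) x
        rw [ih (t + 1) (by omega) (by omega), haA] at this
        exact this
    funext t
    exact hb' (N - t - 1) t t.2 (by omega)
  · intro x
    rw [haA]
    exact (hA2 0 (by omega) (by omega)).ann x

end Chain

/-! ### Vanishing of the composites -/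

section Annihilation

variable {S F G : Type*} [CommRing S] [AddCommGroup F] [Module S F] [AddCommGroup G] [Module S G]

lemma ι_mul_eq_neg_one_pow (y : F) {m : ℕ} {z : ExteriorAlgebra S F} (hz : z ∈ ⋀[S]^m F) :
    ExteriorAlgebra.ι S y * z = (-1) ^ m * (z * ExteriorAlgebra.ι S y) := by
  have h : ∀ (m : ℕ) (v : Fin m → F), ExteriorAlgebra.ι S y * ExteriorAlgebra.ιMulti S m v =
      (-1) ^ m * (ExteriorAlgebra.ιMulti S m v * ExteriorAlgebra.ι S y) := by
    intro m
    induction m with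
    | zero => intro v; simp
    | succ m ih =>
      intro v
      rw [ExteriorAlgebra.ιMulti_succ_apply, ← mul_assoc,
        eq_neg_of_add_eq_zero_left (ExteriorAlgebra.ι_add_mul_swap y (v 0)), neg_mul, mul_assoc, ih,
        pow_succ, mul_assoc, mul_assoc, neg_one_mul, ← mul_neg_one, ← mul_assoc, ← mul_assoc,
        ← mul_assoc, (Commute.neg_one_right _).pow_right m |>.eq, mul_neg_one]
      simp only [mul_assoc, mul_neg]
  rw [← ExteriorAlgebra.ιMulti_span_fixedDegree] at hz
  induction hz using Submodule.span_induction with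
  | mem z hz => obtain ⟨v, rfl⟩ := hz; exact h m v
  | zero => simp
  | add a b _ _ ha hb => rw [mul_add, ha, hb, add_mul, mul_add]
  | smul c a _ ha => rw [mul_smul_comm, ha, smul_mul_assoc, mul_smul_comm]

/-- An element annihilated on one side by a vector is annihilated by it on both sides. -/
lemma ι_mul_mul_eq_zero {y : F} {p r : ℕ} {z a : ExteriorAlgebra S F} (hz : z ∈ ⋀[S]^p F)
    (ha : a ∈ ⋀[S]^r F) (h : a * ExteriorAlgebra.ι S y = 0) :
    ExteriorAlgebra.ι S y * (z * a) = 0 := by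
  have h1 : z * a ∈ ⋀[S]^(p + r) F := SetLike.mul_mem_graded hz ha
  rw [ι_mul_eq_neg_one_pow y h1, mul_assoc, h, mul_zero, mul_zero]

lemma toDual_apply (η : TopOrientation S F) (y : ExteriorAlgebra S F) (v : F) :
    toDual η y v = topForm η (ExteriorAlgebra.ι S v * y) := rfl

lemma multMap_apply (η : TopOrientation S F) {r : ℕ} (a : ⋀[S]^r F) (p : ℕ) (ω : ⋀[S]^p F) (v : F) :
    multMap η a p ω v = topForm η (ExteriorAlgebra.ι S v * (ω * a)) := rfl

variable {α : G →ₗ[S] F} {r : ℕ} {a : ⋀[S]^r F} (η : TopOrientation S F)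

/-- The composite sends ω to the functional x ↦ η(α(x) ∧ ω ∧ a), which vanishes since α(x)
annihilates a. -/
lemma dualMap_comp_multMap (ha : ∀ x, (a : ExteriorAlgebra S F) * ExteriorAlgebra.ι S (α x) = 0)
    (p : ℕ) : α.dualMap ∘ₗ multMap η a p = 0 := by
  refine LinearMap.ext fun ω => LinearMap.ext fun x => ?_
  rw [LinearMap.comp_apply, LinearMap.dualMap_apply, multMap_apply,
    ι_mul_mul_eq_zero ω.2 a.2 (ha x), map_zero]
  rfl

lemma toDual_mem_ker (ha : ∀ x, (a : ExteriorAlgebra S F) * ExteriorAlgebra.ι S (α x) = 0) :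
    toDual η a ∈ LinearMap.ker α.dualMap := by
  rw [LinearMap.mem_ker]
  refine LinearMap.ext fun x => ?_
  have h : (1 : ExteriorAlgebra S F) ∈ ⋀[S]^0 F := SetLike.one_mem_graded _
  have h1 := ι_mul_mul_eq_zero h a.2 (ha x)
  rw [one_mul] at h1
  rw [LinearMap.dualMap_apply, toDual_apply, h1, map_zero]
  rfl

/-- A wedge of images contains some α(g_0) as soon as p > 0, and that factor annihilates a. For p =
0 there is no such factor, hence the restriction. -/
lemma multMap_comp_map (ha : ∀ x, (a : ExteriorAlgebra S F) * ExteriorAlgebra.ι S (α x) = 0)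
    {p : ℕ} (hp : 0 < p) : multMap η a p ∘ₗ exteriorPower.map p α = 0 := by
  obtain ⟨p, rfl⟩ := Nat.exists_eq_succ_of_ne_zero hp.ne'
  refine exteriorPower.linearMap_ext ?_
  ext1 g
  refine LinearMap.ext fun v => ?_
  rw [LinearMap.compAlternatingMap_apply, LinearMap.comp_apply, exteriorPower.map_apply_ιMulti,
    multMap_apply, exteriorPower.ιMulti_apply_coe, ExteriorAlgebra.ιMulti_succ_apply, mul_assoc,
    Function.comp_apply,
    ι_mul_mul_eq_zero (ExteriorAlgebra.ιMulti_range S p ⟨_, rfl⟩) a.2 (ha (g 0)), mul_zero,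
    map_zero]
  rfl

end Annihilation

/-! ### The maps of the complexes are graded -/

section Graded

variable {k : Type*} [Field k] {n : ℕ} {ι κ : Type*} [Fintype ι] [DecidableEq ι] [Fintype κ]
  [DecidableEq κ]

lemma topForm_ιMulti_mul_mem_degS (η : TopOrientation (RingS k n) (ι → RingS k n)) {p : ℕ} {e : ℤ}
    {a : ⋀[RingS k n]^p (ι → RingS k n)} (ha : a ∈ degExt p 0 e) {q : ℕ} (i : Fin q → ι) :
    topForm η (ExteriorAlgebra.ιMulti (RingS k n) q (fun j => Pi.single (i j) 1) *
      (a : ExteriorAlgebra (RingS k n) (ι → RingS k n))) ∈ degS k n e := by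
  change a ∈ AddSubgroup.closure _ at ha
  induction ha using AddSubgroup.closure_induction with
  | mem x hx =>
    obtain ⟨c, hc, i', rfl⟩ := hx
    rw [mul_zero, sub_zero] at hc
    have h2 := mul_mem_degS hc (volForm_single_mem_degS η (Fin.append i i'))
    rw [add_zero] at h2
    convert h2 using 1
    have h3 : (fun q => Pi.single (Fin.append i i' q) 1 : Fin (q + p) → ι → RingS k n) =
        Fin.append (fun q => Pi.single (i q) 1) (fun q => Pi.single (i' q) 1) := by
      funext q
      refine Fin.addCases (fun j => ?_) (fun j => ?_) q
      · simp only [Fin.append_left]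
      · simp only [Fin.append_right]
    rw [volForm_apply, h3, ιMulti_append]
    change topForm η (_ * c • ExteriorAlgebra.ιMulti _ p _) = _
    rw [mul_smul_comm, map_smul, smul_eq_mul]
  | zero =>
    rw [ZeroMemClass.coe_zero, mul_zero, map_zero]
    exact zero_mem_degS e
  | add x y _ _ hx hy =>
    rw [AddMemClass.coe_add, mul_add, map_add]
    exact add_mem_degS hx hy
  | neg x _ hx =>
    rw [NegMemClass.coe_neg, mul_neg, map_neg]
    exact neg_mem_degS hx

/-- Volumes of basis vectors are constants, so all degrees come from the coefficients: a contributes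
e, which the shift by -e compensates. -/
lemma isGradedMap_multMap (η : TopOrientation (RingS k n) (ι → RingS k n)) {r : ℕ} {e : ℤ}
    {a : ⋀[RingS k n]^r (ι → RingS k n)} (ha : a ∈ degExt r 0 e) (p : ℕ) :
    IsGradedMap (shift (degExt p 0) (-e)) (degDual (degFree 0)) (multMap η a p) := by
  intro j x hx m v hv
  have hv' : v = ∑ q, v q • (Pi.single q 1 : ι → RingS k n) := by
    funext q
    simp [Finset.sum_apply, Pi.single_apply]
  rw [hv', map_sum]
  refine sum_mem_degS fun q _ => ?_
  rw [map_smul, smul_eq_mul, add_comm]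
  refine mul_mem_degS (by have := hv q; rwa [sub_zero] at this) ?_
  change x ∈ AddSubgroup.closure _ at hx
  induction hx using AddSubgroup.closure_induction with
  | mem x hx =>
    obtain ⟨c, hc, i, rfl⟩ := hx
    rw [mul_zero, sub_zero] at hc
    have h1 := mul_mem_degS hc (topForm_ιMulti_mul_mem_degS η ha (Fin.append (fun _ : Fin 1 => q) i))
    have h3 : (fun j => Pi.single (Fin.append (fun _ : Fin 1 => q) i j) 1 :
        Fin (1 + p) → ι → RingS k n) =
        Fin.append (fun _ => Pi.single q 1) (fun q => Pi.single (i q) 1) := by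
      funext j
      refine Fin.addCases (fun j => ?_) (fun j => ?_) j
      · simp only [Fin.append_left]
      · simp only [Fin.append_right]
    rw [h3, ιMulti_append, ιMulti_one_eq, mul_assoc, neg_add_eq_sub, sub_add_cancel] at h1
    rw [map_smul, LinearMap.smul_apply, multMap_apply, smul_eq_mul]
    exact h1
  | zero => rw [map_zero]; exact zero_mem_degS j
  | add x y _ _ hx hy => rw [map_add]; exact add_mem_degS hx hy
  | neg x _ hx => rw [map_neg]; exact neg_mem_degS hx

/-- The p-minors of a linear matrix have degree p, which is the difference between the gradings of
⋀^p of S(-1)^κ and ⋀^p of S^ι. -/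
lemma isGradedMap_map {α : (κ → RingS k n) →ₗ[RingS k n] ι → RingS k n}
    (hα : ∀ p q, α (Pi.single p 1) q ∈ degS k n 1) (p : ℕ) (e : ℤ) :
    IsGradedMap (shift (degExt p 1) e) (shift (degExt p 0) e) (exteriorPower.map p α) := by
  classical
  let _ : LinearOrder ι := linearOrderOfSTO WellOrderingRel
  intro j x hx
  change x ∈ AddSubgroup.closure _ at hx
  refine mem_degExt_of_coord fun s => ?_
  induction hx using AddSubgroup.closure_induction with
  | mem x hx =>
    obtain ⟨c, hc, i, rfl⟩ := hx
    rw [map_smul, map_smul, exteriorPower.map_apply_ιMulti, exteriorPower.ιMultiDual_apply_ιMulti]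
    have h1 := mul_mem_degS hc (det_mem_degS (k := k) (n := n) (r := p) (t := 1)
      (M := Matrix.of fun p' q => (Pi.basisFun (RingS k n) ι).coord
        (Set.powersetCard.ofFinEmbEquiv.symm s q) (α (Pi.single (i p') 1))) fun p' q => by
        rw [Matrix.of_apply, Module.Basis.coord_apply, Pi.basisFun_repr]
        exact hα _ _)
    rw [sub_add_cancel] at h1
    exact h1
  | zero => rw [map_zero, map_zero]; exact zero_mem_degS _
  | add x y _ _ hx hy => rw [map_add, map_add]; exact add_mem_degS hx hy
  | neg x _ hx => rw [map_neg, map_neg]; exact neg_mem_degS hx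

end Graded

end BEMult

end

/-! ### Assembly of the theorem -/

theorem theorem4 {k : Type*} [Field k] {n : ℕ} (hn : 0 < n)
    -- the generators `f_0, …, f_n` of `I`, all homogeneous of the same degree
    (f : Fin (n + 1) → MvPolynomial (Fin n) k) (D : ℕ) (hf : ∀ i, (f i).IsHomogeneous D)
    -- `I` is perfect of codimension two
    (hcodim : (BEMult.idealI f).height = 2)
    (hperf : CategoryTheory.projectiveDimension
      (ModuleCat.of (MvPolynomial (Fin n) k) (MvPolynomial (Fin n) k ⧸ BEMult.idealI f)) = 2)
    -- the homogeneous presentation matrix `φ` with column degrees `1 ≤ d_1 ≤ ⋯ ≤ d_n`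
    (d : Fin n → ℕ) (hd : ∀ j, 1 ≤ d j) (hmono : Monotone d)
    (φ : Matrix (Fin (n + 1)) (Fin n) (MvPolynomial (Fin n) k))
    (hφ : ∀ i j, (φ i j).IsHomogeneous (d j))
    (hpres : ∀ v : Fin (n + 1) → MvPolynomial (Fin n) k,
      ∑ i, v i * f i = 0 ↔ ∃ w : Fin n → MvPolynomial (Fin n) k, φ.mulVec w = v)
    -- `μ(I_p) ≤ dim R_p` for all primes `p ⊇ I` other than `𝔪`
    (hG : ∀ (p : Ideal (MvPolynomial (Fin n) k)) [p.IsPrime], BEMult.idealI f ≤ p →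
      p ≠ BEMult.maxIdeal k n →
      ((((BEMult.idealI f).map (algebraMap (MvPolynomial (Fin n) k)
        (Localization.AtPrime p))).spanFinrank : ℕ) : WithBot ℕ∞) ≤
          ringKrullDim (Localization.AtPrime p))
    -- `0 ≤ i ≤ δ = d_1 + ⋯ + d_n - n` and `c = δ - i`
    (i c : ℕ) (hic : i + c + n = ∑ j, d j)
    -- orientations of the modules `F_t` in the strand of degree `c = δ - i`
    (η : ∀ t, BEMult.TopOrientation (BEMult.RingS k n) (BEMult.StrandMod k d c t)) :
    -- the strand is a linear graded free resolution of `Sym(I)_{δ-i}`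
    BEMult.IsStrandResolution f φ d c ∧
    -- `ker α_1^* ≅ 𝒜_i(n)` as graded `S`-modules
    (∃ e : LinearMap.ker (BEMult.strandDual φ d c) ≃ₗ[BEMult.RingS k n] BEMult.locCohPiece f i,
      ∀ (j : ℤ) (x : LinearMap.ker (BEMult.strandDual φ d c)),
        x.1 ∈ BEMult.degDual (BEMult.degFree 0) j ↔
          (e x).1 ∈ BEMult.shift (BEMult.degSym f i) n j) ∧
    -- there is a unique system of multipliers, and it has the following properties
    ∃ a : ∀ t : Fin n, ⋀[BEMult.RingS k n]^(BEMult.strandRk φ d c t) (BEMult.StrandMod k d c t),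
      BEMult.IsMultiplierSystem n (BEMult.strandDiff φ d c) η a ∧
      (∀ b, BEMult.IsMultiplierSystem n (BEMult.strandDiff φ d c) η b → b = a) ∧
      -- `a_1 : S(-s_1) → ⋀^{r_1} F_0`, `∂ : ⋀^{f_0-r_1-1} F_0 ⊗ S(-s_1) → F_0^*` and
      -- `α_1^* : F_0^* → F_1^*` are maps of graded modules
      a ⟨0, hn⟩ ∈ BEMult.degExt (BEMult.strandRk φ d c 0) 0 (BEMult.strandShift φ d c) ∧
      BEMult.IsGradedMap
        (BEMult.shift (BEMult.degExt (BEMult.strandExp φ d c) 0) (-BEMult.strandShift φ d c))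
        (BEMult.degDual (BEMult.degFree 0))
        (BEMult.multMap (η 0) (a ⟨0, hn⟩) (BEMult.strandExp φ d c)) ∧
      BEMult.IsGradedMap (BEMult.degDual (BEMult.degFree 0)) (BEMult.degDual (BEMult.degFree 1))
        (BEMult.strandDual φ d c) ∧
      -- (1) `⋀^{f_0-r_1-1} F_0 ⊗ S(-s_1) → F_0^* → F_1^*` is a complex
      BEMult.strandDual φ d c ∘ₗ
        BEMult.multMap (η 0) (a ⟨0, hn⟩) (BEMult.strandExp φ d c) = 0 ∧
      (BEMult.strandF0 k d c = BEMult.strandRk φ d c 0 + 1 →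
        BEMult.toDual (η 0) (a ⟨0, hn⟩) ∈ LinearMap.ker (BEMult.strandDual φ d c)) ∧
      -- (2) if `Sym(I)_{δ-i}` has rank greater than one, the complex extends on the left
      (1 < Module.finrank (BEMult.RingS k n) (BEMult.symPiece f c) →
        BEMult.IsGradedMap
          (BEMult.shift (BEMult.degExt (BEMult.strandExp φ d c) 1) (-BEMult.strandShift φ d c))
          (BEMult.shift (BEMult.degExt (BEMult.strandExp φ d c) 0) (-BEMult.strandShift φ d c))
          (exteriorPower.map (BEMult.strandExp φ d c) (BEMult.strandDiff φ d c 0)) ∧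
        BEMult.multMap (η 0) (a ⟨0, hn⟩) (BEMult.strandExp φ d c) ∘ₗ
          exteriorPower.map (BEMult.strandExp φ d c) (BEMult.strandDiff φ d c 0) = 0) := by
  have hl : ∀ t, 1 ≤ t → BEMult.KoszulExact (BEMult.koszulForm φ) (BEMult.RingB k n) t :=
    BEMult.koszulExact_koszulForm f d φ hφ hpres hG
  have hres : ∀ c, BEMult.IsStrandResolution f φ d c := fun c =>
    BEMult.isStrandResolution f hφ hpres hl c
  have hα : ∀ t p q, BEMult.strandDiff φ d c t (Pi.single p 1) q ∈ BEMult.degS k n 1 := by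
    intro t p q
    rw [BEMult.strandDiff, Matrix.mulVecLin_apply, Matrix.mulVec_single_one]
    exact BEMult.strandMatrix_mem_degS hφ t q p
  have hempty : ∀ t, n < t → IsEmpty (BEMult.StrandIdx d c t) := fun t ht => ⟨fun p => by
    have h1 := p.2.1
    have h2 := Finset.card_le_univ p.1.1
    rw [Fintype.card_fin] at h2
    omega⟩
  obtain ⟨a, ha, huniq, hdeg, hann⟩ := BEMult.exists_isMultiplierSystem
    (ι := fun t => BEMult.StrandIdx d c t) η hα (hres c).exact hn hempty
  have hshift : BEMult.multDeg (ι := fun t => BEMult.StrandIdx d c t)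
      (BEMult.strandDiff φ d c) n 0 = BEMult.strandShift φ d c := by
    rw [BEMult.multDeg, BEMult.strandShift, Nat.sub_zero]
    exact Finset.sum_congr rfl fun s _ => by rw [zero_add]
  rw [hshift] at hdeg
  -- The vanishing in (1) holds for every exponent, so the truncated subtraction in `strandExp` does
  -- no harm there.
  refine ⟨hres c, BEMult.exists_ker_strandDual_equiv hφ hpres hl hic, a, ha, huniq, hdeg,
    BEMult.isGradedMap_multMap (η 0) hdeg _, ?_, BEMult.dualMap_comp_multMap (η 0) hann _,
    fun _ => BEMult.toDual_mem_ker (η 0) hann, fun hrank =>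
      ⟨BEMult.isGradedMap_map (hα 0) _ _, BEMult.multMap_comp_map (η 0) hann ?_⟩⟩
  · intro j g hg m x hx
    have h1 := (hres c).diff_graded 0 m x hx
    exact hg m _ h1
  -- By exactness at F_0 the rank of Sym(I)_c is f_0 - r_1; if it exceeds one, the exponent f_0 -
  -- r_1 - 1 is positive, as the second vanishing requires.
  · have h1 := BEMult.rk_add_rk (α := BEMult.strandAug f d c) (hres c).aug_exact
    have h2 : BEMult.rk (BEMult.strandAug f d c) =
        Module.finrank (BEMult.RingS k n) (BEMult.symPiece f c) := by
      rw [BEMult.rk, (hres c).aug_range]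
    rw [h2] at h1
    change 0 < Module.finrank (BEMult.RingS k n) (BEMult.StrandMod k d c 0) -
      BEMult.rk (BEMult.strandDiff φ d c 0) - 1
    omega
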